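/- Let $M$ be a smooth manifold of dimension $n\ge 3$ with a conformal structure $[g]$ of signature $(2p'+1,2q'+1)$ (so $n=2p'+2q'+2$). Let $(\mathcal T,h,\mathcal T^1,\nabla^{\mathcal T})$ be its standard tractor bundle: a real vector bundle with a bundle metric $h$ of signature $(2p'+2,2q'+2)$, the distinguished isotropic line subbundle $\mathcal T^1$, and the (normal) tractor connection. Let $\mathbb J$ be an orthogonal complex structure on $\mathcal T$ which is parallel for $\nabla^{\mathcal T}$, put $m=p'+q'+2$, and let $\nu$ be a nowhere vanishing section of the complex line bundle $\mathcal V=\Lambda^m_{\mathbb C}\mathcal T$ which is parallel for the connection induced by $\nabla^{\mathcal T}$. Let $\mathbb V$ be a complex vector space with a Hermitian inner product $\langle\ ,\ \rangle$ of signature $(p'+1,q'+1)$, let $L_{\mathbb R}\subset\mathbb V$ be a real isotropic line, and let $\nu_0\in\Lambda^m_{\mathbb C}\mathbb V$ be non-zero. Assume that $\nu$ is normalized by a (locally constant) factor such that, at some point of each connected component of $M$, the squared length of $\nu$ with respect to the Hermitian extension of $h$ equals the squared length of $\nu_0$ with respect to $\langle\ ,\ \rangle$. Let $\mathcal G$ be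 the Cartan bundle whose fibre $\mathcal G_x$ consists of all linear isomorphisms $u:\mathbb V\to\mathcal T_x$ which are orthogonal for $\operatorname{Re}\langle\ ,\ \rangle$ and $h$ and satisfy $u(L_{\mathbb R})=\mathcal T^1_x$. The canonical conformal Cartan connection $\omega$ is the $\mathfrak{so}(\mathbb V)$-valued smooth one-form on $\mathcal G$ such that, for every section $s$ of $\mathcal T$ with corresponding function $f:\mathcal G\to\mathbb V$, $f(u)=u^{-1}(s(x))$, the function corresponding to $\nabla^{\mathcal T}_\xi s$ is $\bar\xi\cdot f+\omega(\bar\xi)f$ for all lifts $\bar\xi$ of $\xi$. Let $\mathcal G^{SU}\subset\mathcal G$ be the subset of all $u\in\mathcal G_x$, $x\in M$, which are complex linear with respect to $\mathbb J_x$ and whose induced map on the $m$-th complex exterior power sends $\nu_0$ to $\nu(x)$, and let $P^{SU}$ be the stabilizer of $L_{\mathbb R}$ in $SU(\mathbb V)$. Then $\mathcal G^{SU}$ is a smooth principal bundle over $M$ with structure group $P^{SU}$ acting by $u\cdot g=u\circ g$. Moreover, the form $\omega$ exists and is unique, and it restricts to a Cartan connection $\omega^{SU}\in\Omega^1(\mathcal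 G^{SU},\mathfrak{su}(\mathbb V))$: on vectors tangent to $\mathcal G^{SU}$ the form $\omega$ has values in $\mathfrak{su}(\mathbb V)$, and the restriction $\omega^{SU}$ is smooth, is a linear isomorphism $T_u\mathcal G^{SU}\to\mathfrak{su}(\mathbb V)$ for each $u\in\mathcal G^{SU}$, satisfies $(r^g)^*\omega^{SU}=\operatorname{Ad}(g^{-1})\circ\omega^{SU}$ for all $g\in P^{SU}$, and reproduces the generators of fundamental vector fields. -/

import Mathlib

open Bundle Set Filter
open scoped Manifold ContDiff Topology

noncomputable section

namespace TractorSU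

/-! ## Linear algebra -/

/-- A real bilinear form `b` on `W` has signature `(r, s)`: there is a basis of `W` in which it is
diagonal, with `r` entries `+1` and `s` entries `-1`. -/
def HasSignature {W : Type*} [AddCommGroup W] [Module ℝ W] (b : W → W → ℝ) (r s : ℕ) : Prop :=
  ∃ e : Module.Basis (Fin r ⊕ Fin s) ℝ W, ∀ i j,
    b (e i) (e j) = if i = j then Sum.elim (fun _ => 1) (fun _ => -1) i else 0

/-- A sesquilinear form (conjugate linear in the first argument) is a Hermitian inner product of
signature `(r, s)`: there is a complex basis in which it is diagonal, with `r` entries `+1` and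
`s` entries `-1`. -/
def HasHermitianSignature {V : Type*} [AddCommGroup V] [Module ℂ V]
    (B : V →ₗ⋆[ℂ] V →ₗ[ℂ] ℂ) (r s : ℕ) : Prop :=
  ∃ e : Module.Basis (Fin r ⊕ Fin s) ℂ V, ∀ i j,
    B (e i) (e j) = if i = j then Sum.elim (fun _ => 1) (fun _ => -1) i else 0

section ComplexFiber

variable {W : Type*} [AddCommGroup W] [Module ℝ W] [TopologicalSpace W]

/-- The real vector space `W` viewed as a complex vector space, multiplication by `i` being the
given endomorphism `J` with `J ∘ J = -id`. -/
def ComplexFiber (J : W →L[ℝ] W) (_ : ∀ w, J (J w) = -w) : Type _ := W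

/-- An element of `W` as an element of the complex vector space `(W, J)`. -/
def ComplexFiber.of (J : W →L[ℝ] W) (hJ : ∀ w, J (J w) = -w) (w : W) : ComplexFiber J hJ := w

/-- Multiplication of `w` by the complex number `z` in `(W, J)`. -/
def complexSMul (J : W →L[ℝ] W) (z : ℂ) (w : W) : W := z.re • w + z.im • J w

instance (J : W →L[ℝ] W) (hJ : ∀ w, J (J w) = -w) : AddCommGroup (ComplexFiber J hJ) :=
  inferInstanceAs (AddCommGroup W)

instance (J : W →L[ℝ] W) (hJ : ∀ w, J (J w) = -w) : Module ℂ (ComplexFiber J hJ) where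
  smul z w := complexSMul (W := W) J z w
  one_smul := (fun w => by simp [complexSMul] : ∀ w : W, complexSMul J 1 w = w)
  mul_smul := (fun z z' w => by
    simp only [complexSMul, Complex.mul_re, Complex.mul_im, map_add, map_smul, hJ]
    module : ∀ (z z' : ℂ) (w : W),
      complexSMul J (z * z') w = complexSMul J z (complexSMul J z' w))
  smul_zero := (fun z => by simp [complexSMul] : ∀ z : ℂ, complexSMul J z (0 : W) = 0)
  smul_add := (fun z w w' => by
    simp only [complexSMul, map_add]
    module : ∀ (z : ℂ) (w w' : W),
      complexSMul J z (w + w') = complexSMul J z w + complexSMul J z w')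
  add_smul := (fun z z' w => by
    simp only [complexSMul, Complex.add_re, Complex.add_im]
    module : ∀ (z z' : ℂ) (w : W),
      complexSMul J (z + z') w = complexSMul J z w + complexSMul J z' w)
  zero_smul := (fun w => by simp [complexSMul] : ∀ w : W, complexSMul J 0 w = 0)

end ComplexFiber

/-- The Hermitian extension of a real bilinear form `b` on the complex vector space `(W, J)`: its
real part is `b`, and it is conjugate linear in the first argument if `J` is orthogonal. -/
def hermitianExtension {W : Type*} (b : W → W → ℝ) (J : W → W) (v w : W) : ℂ :=
  (b v w : ℂ) - Complex.I * (b v (J w) : ℂ)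

/-- `IsTopSqNorm H z a`: the squared length of `z ∈ Λ^m_ℂ W` with respect to the inner product
induced by `H` is `a`, i.e. `z = w₁ ∧ ⋯ ∧ w_m` and `a = det (H (w_i) (w_j))`. For `m = dim_ℂ W`
every `z` is of this form, and `a` is determined by `z`. -/
def IsTopSqNorm {W : Type*} [AddCommGroup W] [Module ℂ W] (H : W → W → ℂ) {m : ℕ}
    (z : ⋀[ℂ]^m W) (a : ℂ) : Prop :=
  ∃ w : Fin m → W, exteriorPower.ιMulti ℂ m w = z ∧
    (Matrix.of fun i j => H (w i) (w j)).det = a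

/-! ## Submanifolds and matrix groups -/

section Submanifold

variable {E : Type*} [NormedAddCommGroup E] [NormedSpace ℝ E]
  {H : Type*} [TopologicalSpace H] (I : ModelWithCorners ℝ E H)
  {X : Type*} [TopologicalSpace X] [ChartedSpace H X]

/-- `S` is an embedded smooth submanifold (of some dimension `k`) of the boundaryless manifold `X`:
around each point of `S` there is a smooth chart of `X`, with values in the model vector space,
which maps `S` to a `k`-dimensional linear subspace. -/
def IsEmbeddedSubmanifold (S : Set X) : Prop :=
  ∃ k : ℕ, ∀ p ∈ S, ∃ φ : OpenPartialHomeomorph X E, p ∈ φ.source ∧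
    ContMDiffOn I 𝓘(ℝ, E) ∞ φ φ.source ∧ ContMDiffOn 𝓘(ℝ, E) I ∞ φ.symm φ.target ∧
    ∃ W : Submodule ℝ E, Module.finrank ℝ W = k ∧ ∀ q ∈ φ.source, q ∈ S ↔ φ q ∈ W

/-- The tangent space at `u` of a submanifold `S` of `X`, as a subspace of the tangent space of
`X`: it is spanned by the velocities of the smooth curves in `S` through `u`. -/
def tangentTo (S : Set X) (u : X) : Submodule ℝ (TangentSpace I u) :=
  Submodule.span ℝ {ξ | ∃ γ : ℝ → X, ContMDiff 𝓘(ℝ, ℝ) I ∞ γ ∧ (∀ t, γ t ∈ S) ∧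
    tangentMap 𝓘(ℝ, ℝ) I γ ⟨0, (1 : ℝ)⟩ = (⟨u, ξ⟩ : TangentBundle I X)}

theorem tangentTo_mono {S S' : Set X} (h : S ⊆ S') (u : X) :
    tangentTo I S u ≤ tangentTo I S' u :=
  Submodule.span_mono fun _ ⟨γ, h₁, h₂, h₃⟩ => ⟨γ, h₁, fun t => h (h₂ t), h₃⟩

/-- One-forms on a submanifold `S` of `X` with values in a subspace `𝔤` of a vector space `A`
(no regularity is included here). -/
abbrev OneFormOn {A : Type*} [AddCommGroup A] [Module ℝ A] (S : Set X) (𝔤 : Submodule ℝ A) :=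
  (u : S) → tangentTo I S (u : X) →ₗ[ℝ] 𝔤

/-- A one-form on a submanifold `S` of `X` is smooth: locally it is the restriction to `S` of a
smooth one-form `η` on an open subset `U` of `X`, smoothness of `η` meaning that its value on every
smooth vector field is a smooth function. -/
def OneFormOn.IsSmooth {A : Type*} [NormedAddCommGroup A] [NormedSpace ℝ A] {S : Set X}
    {𝔤 : Submodule ℝ A} [IsManifold I 1 X] (θ : OneFormOn I S 𝔤) : Prop :=
  ∀ u₀ ∈ S, ∃ U : Set X, IsOpen U ∧ u₀ ∈ U ∧
    ∃ η : (u : X) → TangentSpace I u →L[ℝ] A,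
      (∀ Y : (u : X) → TangentSpace I u,
        ContMDiffOn I I.tangent ∞ (fun u => (⟨u, Y u⟩ : TangentBundle I X)) U →
        ContMDiffOn I 𝓘(ℝ, A) ∞ (fun u => η u (Y u)) U) ∧
      ∀ u : S, (u : X) ∈ U → ∀ ξ : tangentTo I S (u : X), η u ξ = θ u ξ

end Submanifold

section Groups

variable {V : Type*} [NormedAddCommGroup V] [NormedSpace ℂ V]

/-- The special unitary group `SU(V)` of the Hermitian inner product `B`, as a group of real linear
automorphisms of `V`. -/
def specialUnitary (B : V →ₗ⋆[ℂ] V →ₗ[ℂ] ℂ) : Subgroup (V ≃L[ℝ] V) where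
  carrier := {g | (∀ v w, B (g v) (g w) = B v w) ∧
    ∃ gC : V →ₗ[ℂ] V, (∀ v, gC v = g v) ∧ LinearMap.det gC = 1}
  one_mem' := ⟨fun _ _ => rfl, LinearMap.id, fun _ => rfl, LinearMap.det_id⟩
  mul_mem' := by
    rintro a b ⟨ha, aC, haC, hda⟩ ⟨hb, bC, hbC, hdb⟩
    refine ⟨fun v w => ?_, aC ∘ₗ bC, fun v => ?_, ?_⟩
    · change B (a (b v)) (a (b w)) = _
      rw [ha, hb]
    · change aC (bC v) = a (b v)
      rw [hbC, haC]
    · rw [LinearMap.det_comp, hda, hdb, one_mul]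
  inv_mem' := by
    rintro a ⟨ha, aC, haC, hda⟩
    have hinv : ∀ v, a (a⁻¹ v) = v := fun v => a.apply_symm_apply v
    have hinv' : ∀ v, a⁻¹ (a v) = v := fun v => a.symm_apply_apply v
    let bC : V →ₗ[ℂ] V :=
      { toFun := fun v => a⁻¹ v
        map_add' := fun v w => map_add _ v w
        map_smul' := fun z v => by
          apply a.injective
          change a (a⁻¹ (z • v)) = a (z • a⁻¹ v)
          rw [hinv, ← haC, map_smul, haC, hinv] }
    refine ⟨fun v w => ?_, bC, fun v => rfl, ?_⟩
    · rw [← ha, hinv, hinv]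
    · have h : bC ∘ₗ aC = LinearMap.id := by
        ext v
        change a⁻¹ (aC v) = v
        rw [haC, hinv']
      have := congrArg LinearMap.det h
      rwa [LinearMap.det_comp, hda, mul_one, LinearMap.det_id] at this

/-- The Lie algebra `𝔰𝔲(V)`: complex linear, skew-Hermitian, trace-free endomorphisms. -/
def su (B : V →ₗ⋆[ℂ] V →ₗ[ℂ] ℂ) : Submodule ℝ (V →L[ℝ] V) where
  carrier := {A | (∀ v w, B (A v) w + B v (A w) = 0) ∧
    ∃ AC : V →ₗ[ℂ] V, (∀ v, AC v = A v) ∧ LinearMap.trace ℂ V AC = 0}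
  zero_mem' := ⟨fun v w => by simp, 0, fun v => by simp, by simp⟩
  add_mem' := by
    rintro a b ⟨ha, aC, haC, hta⟩ ⟨hb, bC, hbC, htb⟩
    refine ⟨fun v w => ?_, aC + bC, fun v => by simp [haC, hbC], by simp [hta, htb]⟩
    have h₁ := ha v w
    have h₂ := hb v w
    simp only [add_apply, map_add, LinearMap.add_apply] at *
    linear_combination h₁ + h₂
  smul_mem' := by
    rintro c a ⟨ha, aC, haC, hta⟩
    refine ⟨fun v w => ?_, (c : ℂ) • aC, fun v => by simp [haC], by simp [hta]⟩
    have h₁ := ha v w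
    have e₁ : (c • a) v = (c : ℂ) • a v := by simp
    have e₂ : (c • a) w = (c : ℂ) • a w := by simp
    rw [e₁, e₂, LinearMap.map_smulₛₗ, map_smul, LinearMap.smul_apply, Complex.conj_ofReal,
      smul_eq_mul, smul_eq_mul]
    linear_combination (c : ℂ) * h₁

/-- The Lie algebra `𝔰𝔬(V)` of real linear endomorphisms which are skew symmetric with respect to
the real part of `B`. -/
def so (B : V →ₗ⋆[ℂ] V →ₗ[ℂ] ℂ) : Submodule ℝ (V →L[ℝ] V) where
  carrier := {A | ∀ v w, (B (A v) w).re + (B v (A w)).re = 0}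
  zero_mem' := fun v w => by simp
  add_mem' := by
    intro a b ha hb v w
    have h₁ := ha v w
    have h₂ := hb v w
    simp only [add_apply, map_add, LinearMap.add_apply, Complex.add_re]
    linear_combination h₁ + h₂
  smul_mem' := by
    intro c a ha v w
    have h₁ := ha v w
    have e₁ : (c • a) v = (c : ℂ) • a v := by simp
    have e₂ : (c • a) w = (c : ℂ) • a w := by simp
    rw [e₁, e₂, LinearMap.map_smulₛₗ, map_smul, LinearMap.smul_apply, Complex.conj_ofReal,
      smul_eq_mul, smul_eq_mul, Complex.re_ofReal_mul, Complex.re_ofReal_mul]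
    linear_combination c * h₁

/-- The group of linear automorphisms `g` of `V` with `g(L) = L`. -/
def lineStabilizer (L : Submodule ℝ V) : Subgroup (V ≃L[ℝ] V) where
  carrier := {g | ∀ v, g v ∈ L ↔ v ∈ L}
  one_mem' := fun _ => Iff.rfl
  mul_mem' := fun {a b} ha hb v => (ha (b v)).trans (hb v)
  inv_mem' := fun {a} ha v => by
    rw [← ha]
    change a (a.symm v) ∈ L ↔ _
    rw [a.apply_symm_apply]

/-- The Lie algebra of a closed subgroup `K` of the general linear group:
all `A` such that `exp (t A) ∈ K` for all real `t`. -/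
def lieAlgebraOf (K : Subgroup (V ≃L[ℝ] V)) : Set (V →L[ℝ] V) :=
  {A | ∀ t : ℝ, ∃ g ∈ K, (g : V →L[ℝ] V) = NormedSpace.exp (t • A)}

/-- A subgroup of the general linear group, viewed as a subset of the space of endomorphisms. -/
def endSet (K : Subgroup (V ≃L[ℝ] V)) : Set (V →L[ℝ] V) :=
  (fun g : V ≃L[ℝ] V => (g : V →L[ℝ] V)) '' (K : Set (V ≃L[ℝ] V))

end Groups

/-! ## Conformal structures and standard tractor bundles -/

section Bundles

variable {n : ℕ} {M : Type*} [TopologicalSpace M] [ChartedSpace (EuclideanSpace ℝ (Fin n)) M]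
  (F : Type*) [NormedAddCommGroup F] [NormedSpace ℝ F]
  (T : M → Type*) [TopologicalSpace (TotalSpace F T)]
  [∀ x, AddCommGroup (T x)] [∀ x, Module ℝ (T x)] [∀ x, TopologicalSpace (T x)]
  [∀ x, IsTopologicalAddGroup (T x)] [∀ x, ContinuousSMul ℝ (T x)]
  [FiberBundle F T] [VectorBundle ℝ F T]

variable (n) in
/-- Smooth sections of a vector bundle over `M`. -/
def SmoothSection (F : Type*) [NormedAddCommGroup F] [NormedSpace ℝ F]
    {T : M → Type*} [TopologicalSpace (TotalSpace F T)] [∀ x, TopologicalSpace (T x)]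
    [FiberBundle F T] (s : (x : M) → T x) : Prop :=
  ContMDiff (𝓡 n) ((𝓡 n).prod 𝓘(ℝ, F)) ∞ (fun x => TotalSpace.mk' F x (s x))

/-- A smooth bundle metric of signature `(r, s)` on a vector bundle. -/
structure BundleMetric (r s : ℕ) where
  /-- the inner product on the fibres -/
  form : (x : M) → T x →L[ℝ] T x →L[ℝ] ℝ
  symm : ∀ x v w, form x v w = form x w v
  signature : ∀ x, HasSignature (fun v w => form x v w) r s
  smooth : ContMDiff (𝓡 n) ((𝓡 n).prod 𝓘(ℝ, F →L[ℝ] F →L[ℝ] ℝ)) ∞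
    (fun x => TotalSpace.mk' (F →L[ℝ] F →L[ℝ] ℝ) x (form x))

variable (n M) in
/-- Pseudo-Riemannian metrics of signature `(r, s)` on `M`. -/
abbrev PseudoRiemannianMetric [IsManifold (𝓡 n) ∞ M] (r s : ℕ) :=
  BundleMetric (n := n) (EuclideanSpace ℝ (Fin n)) (fun x : M => TangentSpace (𝓡 n) x) r s

variable (n M) in
/-- A conformal structure of signature `(r, s)` on `M`: the class of all metrics which are obtained
from one fixed metric by multiplication with positive smooth functions. -/
structure ConformalStructure [IsManifold (𝓡 n) ∞ M] (r s : ℕ) where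
  /-- the metrics in the conformal class -/
  metrics : Set (PseudoRiemannianMetric n M r s)
  isClass : ∃ g : PseudoRiemannianMetric n M r s, ∀ g' : PseudoRiemannianMetric n M r s,
    g' ∈ metrics ↔ ∃ f : M → ℝ, ContMDiff (𝓡 n) 𝓘(ℝ, ℝ) ∞ f ∧
    (∀ x, 0 < f x) ∧ ∀ x ξ η, g'.form x ξ η = f x * g.form x ξ η

variable {F T} in
/-- The curvature `R(X, Y) s = ∇_X ∇_Y s - ∇_Y ∇_X s - ∇_[X,Y] s` of a linear connection. -/
def curvature (D : CovariantDerivative (𝓡 n) F T) (X Y : (x : M) → TangentSpace (𝓡 n) x)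
    (s : (x : M) → T x) (x : M) : T x :=
  D (fun y => D s y (Y y)) x (X x) - D (fun y => D s y (X y)) x (Y x) -
    D s x (VectorField.mlieBracket (𝓡 n) X Y x)

/-- Standard tractor bundles of a conformal manifold `(M, c)` of signature `(r, s)`: a vector bundle
`T` with a bundle metric of signature `(r + 1, s + 1)`, a line subbundle `line` (usually denoted by
`T¹`) with isotropic fibres, and a linear connection which is compatible with the metric,
nondegenerate with respect to `line`, and normal. The conformal structure is encoded as usual:
the metrics `g` in the conformal class correspond to sections `σ` of the trivial line bundle `line`
(the density bundle of weight `-1`) via `g(ξ, η) = h(∇_ξ σ, ∇_η σ)`.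
These data are determined by `(M, c)` up to isomorphism. -/
structure StandardTractorBundle [IsManifold (𝓡 n) ∞ M] [ContMDiffVectorBundle ∞ F T (𝓡 n)]
    {r s : ℕ} (c : ConformalStructure n M r s) where
  /-- the tractor metric -/
  metric : BundleMetric (n := n) F T (r + 1) (s + 1)
  /-- the distinguished line subbundle -/
  line : (x : M) → Submodule ℝ (T x)
  /-- the tractor connection -/
  conn : CovariantDerivative (𝓡 n) F T
  line_isotropic : ∀ x, ∀ v ∈ line x, metric.form x v v = 0
  conn_smooth : CovariantDerivative.ContMDiffCovariantDerivative conn ∞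
  conn_metric : ∀ s t : (x : M) → T x, SmoothSection n F s → SmoothSection n F t →
    ∀ (x : M) (ξ : TangentSpace (𝓡 n) x),
      mfderiv (𝓡 n) 𝓘(ℝ, ℝ) (fun y => metric.form y (s y) (t y)) x ξ =
        metric.form x (conn s x ξ) (t x) + metric.form x (s x) (conn t x ξ)
  /-- nondegeneracy of the connection with respect to the line subbundle -/
  nondegenerate : ∀ (x : M) (ξ : TangentSpace (𝓡 n) x), ξ ≠ 0 →
    ∃ σ : (x : M) → T x, SmoothSection n F σ ∧ (∀ y, σ y ∈ line y) ∧ conn σ x ξ ∉ line x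
  /-- every metric in the conformal class is induced by a nowhere vanishing smooth section of the
  line subbundle; in particular `line` is a smooth subbundle of rank one -/
  exists_scale : ∀ g ∈ c.metrics, ∃ σ : (x : M) → T x, SmoothSection n F σ ∧
    (∀ x, σ x ≠ 0 ∧ line x = Submodule.span ℝ {σ x}) ∧
    ∀ (x : M) (ξ η : TangentSpace (𝓡 n) x),
      metric.form x (conn σ x ξ) (conn σ x η) = g.form x ξ η
  /-- normality, first part (torsion-freeness): the curvature preserves the line subbundle -/
  torsion_free : ∀ (X Y : (x : M) → TangentSpace (𝓡 n) x) (σ : (x : M) → T x),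
    SmoothSection n (EuclideanSpace ℝ (Fin n)) X →
    SmoothSection n (EuclideanSpace ℝ (Fin n)) Y →
    SmoothSection n F σ → (∀ y, σ y ∈ line y) → ∀ x, curvature conn X Y σ x ∈ line x
  /-- normality, second part: let `σ` be a nowhere vanishing section of `line`. Since
  `ξ ↦ ∇_ξ σ` identifies the tangent bundle with `line^⊥ / line`, the curvature induces a tensor
  field `W` with `R(X, Y) ∇_Z σ = ∇_{W(X, Y) Z} σ` modulo `line`. Its Ricci type contraction,
  the trace of `X ↦ W(X, Y) Z`, vanishes. -/
  ricci_free : ∀ (Y Z : (x : M) → TangentSpace (𝓡 n) x) (σ : (x : M) → T x),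
    SmoothSection n (EuclideanSpace ℝ (Fin n)) Y →
    SmoothSection n (EuclideanSpace ℝ (Fin n)) Z →
    SmoothSection n F σ → (∀ y, σ y ∈ line y) → (∀ y, σ y ≠ 0) →
    ∀ (x : M) (A : TangentSpace (𝓡 n) x →ₗ[ℝ] TangentSpace (𝓡 n) x),
      (∀ X : (x : M) → TangentSpace (𝓡 n) x,
        SmoothSection n (EuclideanSpace ℝ (Fin n)) X →
        curvature conn X Y (fun y => conn σ y (Z y)) x - conn σ x (A (X x)) ∈ line x) →
      LinearMap.trace ℝ (TangentSpace (𝓡 n) x) A = 0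

variable {F T}

/-- A smooth orthogonal complex structure on a vector bundle with a bundle metric. -/
structure OrthogonalComplexStructure [ContMDiffVectorBundle ∞ F T (𝓡 n)] {r s : ℕ}
    (h : BundleMetric (n := n) F T r s) where
  /-- the endomorphisms of the fibres -/
  endo : (x : M) → T x →L[ℝ] T x
  sq : ∀ x v, endo x (endo x v) = -v
  orthogonal : ∀ x v w, h.form x (endo x v) (endo x w) = h.form x v w
  smooth : ContMDiff (𝓡 n) ((𝓡 n).prod 𝓘(ℝ, F →L[ℝ] F)) ∞
    (fun x => TotalSpace.mk' (F →L[ℝ] F) x (endo x))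

/-- The complex structure is parallel: `∇ (J s) = J ∇ s`. -/
def OrthogonalComplexStructure.IsParallel [ContMDiffVectorBundle ∞ F T (𝓡 n)] {r s : ℕ}
    {h : BundleMetric (n := n) F T r s} (J : OrthogonalComplexStructure h)
    (D : CovariantDerivative (𝓡 n) F T) : Prop :=
  ∀ s : (x : M) → T x, SmoothSection n F s → ∀ (x : M) (ξ : TangentSpace (𝓡 n) x),
    D (fun y => J.endo y (s y)) x ξ = J.endo x (D s x ξ)

/-- The fibre at `x` of the bundle `T`, viewed as a complex vector bundle by means of `J`. -/
abbrev OrthogonalComplexStructure.Fiber [ContMDiffVectorBundle ∞ F T (𝓡 n)] {r s : ℕ}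
    {h : BundleMetric (n := n) F T r s} (J : OrthogonalComplexStructure h) (x : M) :=
  ComplexFiber (J.endo x) (J.sq x)

/-- A section `ν` of the complex exterior power `Λ^m_ℂ T` is (smooth and) parallel for the connection
induced by `D`: locally `ν = e₁ ∧ ⋯ ∧ e_m` for smooth sections `e_i` of `T`, with
`∇_ξ ν = ∑ i, e₁ ∧ ⋯ ∧ ∇_ξ e_i ∧ ⋯ ∧ e_m = 0`. For the top exterior power every smooth section is
locally of the form `e₁ ∧ ⋯ ∧ e_m`. -/
def IsParallelTop [ContMDiffVectorBundle ∞ F T (𝓡 n)] {r s : ℕ}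
    {h : BundleMetric (n := n) F T r s} (J : OrthogonalComplexStructure h)
    (D : CovariantDerivative (𝓡 n) F T) {m : ℕ} (ν : (x : M) → ⋀[ℂ]^m (J.Fiber x)) : Prop :=
  ∀ x₀ : M, ∃ e : Fin m → (x : M) → T x, (∀ i, SmoothSection n F (e i)) ∧
    ∀ᶠ x in 𝓝 x₀,
      ν x = exteriorPower.ιMulti ℂ m
        (fun i => ComplexFiber.of (J.endo x) (J.sq x) (e i x)) ∧
      ∀ ξ : TangentSpace (𝓡 n) x,
        ∑ i, exteriorPower.ιMulti ℂ m
          (Function.update (fun j => ComplexFiber.of (J.endo x) (J.sq x) (e j x)) i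
            (ComplexFiber.of (J.endo x) (J.sq x) (D (e i) x ξ))) = 0

/-! ## Frame bundles -/

variable (V : Type*) [NormedAddCommGroup V] [NormedSpace ℂ V]

variable (F T) in
/-- The total space of the bundle over `M` whose fibre at `x` is the space of all real linear maps
`u : V → T x`. Frame bundles are submanifolds of this manifold. -/
abbrev FrameSpace := TotalSpace (V →L[ℝ] F) (fun x : M => Trivial M V x →L[ℝ] T x)

variable (n F) in
/-- The model with corners of the manifold `FrameSpace F T V`. -/
abbrev frameModel := (𝓡 n).prod 𝓘(ℝ, V →L[ℝ] F)

variable {V}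

/-- The map `V → T x` which is given by a point `u` over `x` of the frame space. -/
abbrev frameMap (u : FrameSpace F T V) : V →L[ℝ] T u.1 := u.2

/-- The right action `u · a = u ∘ a` of the endomorphisms of `V`. -/
def frameComp (a : V →L[ℝ] V) (u : FrameSpace F T V) : FrameSpace F T V :=
  ⟨u.1, (frameMap u).comp a⟩

variable (n) in
/-- `S` is (the total space of) a smooth principal bundle over `M` with structure group `K`,
consisting of linear frames `u : V → T x` and with principal right action `u · g = u ∘ g`. -/
structure IsPrincipalFrameBundle [IsManifold (𝓡 n) ∞ M] [ContMDiffVectorBundle ∞ F T (𝓡 n)]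
    (S : Set (FrameSpace F T V)) (K : Subgroup (V ≃L[ℝ] V)) : Prop where
  frames : ∀ u ∈ S, Function.Bijective (frameMap u)
  /-- the structure group is a Lie subgroup of the general linear group -/
  group_submanifold : IsEmbeddedSubmanifold 𝓘(ℝ, V →L[ℝ] V) (endSet K)
  total_submanifold : IsEmbeddedSubmanifold (frameModel n F V) S
  action_mem : ∀ u ∈ S, ∀ g ∈ K, frameComp (g : V →L[ℝ] V) u ∈ S
  /-- the action is free, and transitive on the fibres of `S → M` -/
  simply_transitive : ∀ u ∈ S, ∀ u' ∈ S, u.1 = u'.1 →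
    ∃! g : V ≃L[ℝ] V, g ∈ K ∧ u' = frameComp (g : V →L[ℝ] V) u
  /-- around each point of `M` there is a `K`-equivariant diffeomorphism `u ↦ (π u, τ u)` from
  `S|_U` onto `U × K`, with inverse `φ` -/
  locally_trivial : ∀ x₀ : M, ∃ U : Set M, IsOpen U ∧ x₀ ∈ U ∧
    ∃ (τ : FrameSpace F T V → (V →L[ℝ] V)) (φ : M × (V →L[ℝ] V) → FrameSpace F T V),
      ContMDiffOn (frameModel n F V) 𝓘(ℝ, V →L[ℝ] V) ∞ τ {u | u ∈ S ∧ u.1 ∈ U} ∧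
      ContMDiffOn ((𝓡 n).prod 𝓘(ℝ, V →L[ℝ] V)) (frameModel n F V) ∞ φ (U ×ˢ endSet K) ∧
      (∀ u ∈ S, u.1 ∈ U → τ u ∈ endSet K ∧ φ (u.1, τ u) = u) ∧
      (∀ x ∈ U, ∀ a ∈ endSet K, φ (x, a) ∈ S ∧ (φ (x, a)).1 = x ∧ τ (φ (x, a)) = a) ∧
      (∀ u ∈ S, u.1 ∈ U → ∀ g ∈ K,
        τ (frameComp (g : V →L[ℝ] V) u) = (τ u).comp (g : V →L[ℝ] V))

/-- `θ` is a Cartan connection on the principal `K`-bundle `S → M` with values in `𝔤`. -/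
structure IsCartanConnection [IsManifold (𝓡 n) ∞ M] [ContMDiffVectorBundle ∞ F T (𝓡 n)]
    {S : Set (FrameSpace F T V)} (K : Subgroup (V ≃L[ℝ] V)) {𝔤 : Submodule ℝ (V →L[ℝ] V)}
    (θ : OneFormOn (frameModel n F V) S 𝔤) : Prop where
  smooth : OneFormOn.IsSmooth (frameModel n F V) θ
  /-- `θ` is an absolute parallelism -/
  bijective : ∀ u : S, Function.Bijective (θ u)
  /-- `(r^g)^* θ = Ad(g⁻¹) ∘ θ` -/
  equivariant : ∀ g ∈ K, ∀ (u : S) (ξ : tangentTo (frameModel n F V) S (u : FrameSpace F T V)),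
    ∃ (hu : frameComp (g : V →L[ℝ] V) (u : FrameSpace F T V) ∈ S)
      (ξ' : tangentTo (frameModel n F V) S (frameComp (g : V →L[ℝ] V) (u : FrameSpace F T V))),
      (ξ' : TangentSpace (frameModel n F V) _) =
        mfderiv (frameModel n F V) (frameModel n F V) (frameComp (g : V →L[ℝ] V))
          (u : FrameSpace F T V) (ξ : TangentSpace (frameModel n F V) (u : FrameSpace F T V)) ∧
      (θ ⟨_, hu⟩ ξ' : V →L[ℝ] V) =
        ((g⁻¹ : V ≃L[ℝ] V) : V →L[ℝ] V).comp ((θ u ξ : V →L[ℝ] V).comp (g : V →L[ℝ] V))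
  /-- `θ` reproduces the generators `A` of the fundamental vector fields
  `ζ_A(u) = d/dt|_{t=0} u · exp(t A)` -/
  fundamental : ∀ A ∈ lieAlgebraOf K, ∀ u : S,
    ∃ ζ : tangentTo (frameModel n F V) S (u : FrameSpace F T V),
      tangentMap 𝓘(ℝ, ℝ) (frameModel n F V)
        (fun t : ℝ => frameComp (NormedSpace.exp (t • A)) (u : FrameSpace F T V)) ⟨0, (1 : ℝ)⟩ =
          (⟨u, ζ⟩ : TangentBundle (frameModel n F V) (FrameSpace F T V)) ∧
      (θ u ζ : V →L[ℝ] V) = A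

/-! ## The Cartan bundle, the canonical Cartan connection, and the reduced bundle -/

/-- The Hermitian bundle metric which extends the given bundle metric, on the complex vector bundle
`(T, J)`. -/
def OrthogonalComplexStructure.hermitian [ContMDiffVectorBundle ∞ F T (𝓡 n)] {r s : ℕ}
    {h : BundleMetric (n := n) F T r s} (J : OrthogonalComplexStructure h) (x : M)
    (v w : J.Fiber x) : ℂ :=
  hermitianExtension (W := T x) (fun v w => h.form x v w) (J.endo x) v w

section Cartan

variable [IsManifold (𝓡 n) ∞ M] [ContMDiffVectorBundle ∞ F T (𝓡 n)]
  {r s : ℕ} {c : ConformalStructure n M r s}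

/-- The Cartan bundle: its fibre at `x` consists of all linear isomorphisms `u : V → T x` which are
orthogonal for the real part of `B` and the tractor metric and satisfy `u(L) = line x`. -/
def cartanBundle (𝒯 : StandardTractorBundle F T c) (B : V →ₗ⋆[ℂ] V →ₗ[ℂ] ℂ)
    (L : Submodule ℝ V) : Set (FrameSpace F T V) :=
  {u | Function.Bijective (frameMap u) ∧
    (∀ v w, 𝒯.metric.form u.1 (frameMap u v) (frameMap u w) = (B v w).re) ∧
    L.map (frameMap u : V →ₗ[ℝ] T u.1) = 𝒯.line u.1}

/-- The reduced bundle: those `u` in the Cartan bundle which are complex linear and whose induced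
map on the `m`-th complex exterior power sends `ν₀` to `ν(x)`. -/
def suBundle (𝒯 : StandardTractorBundle F T c) (B : V →ₗ⋆[ℂ] V →ₗ[ℂ] ℂ)
    (L : Submodule ℝ V) (J : OrthogonalComplexStructure 𝒯.metric) {m : ℕ}
    (ν₀ : ⋀[ℂ]^m V) (ν : (x : M) → ⋀[ℂ]^m (J.Fiber x)) : Set (FrameSpace F T V) :=
  {u | u ∈ cartanBundle 𝒯 B L ∧ ∃ uC : V →ₗ[ℂ] J.Fiber u.1,
    (∀ v, uC v = ComplexFiber.of (J.endo u.1) (J.sq u.1) (frameMap u v)) ∧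
    exteriorPower.map m uC ν₀ = ν u.1}

theorem suBundle_subset (𝒯 : StandardTractorBundle F T c) (B : V →ₗ⋆[ℂ] V →ₗ[ℂ] ℂ)
    (L : Submodule ℝ V) (J : OrthogonalComplexStructure 𝒯.metric) {m : ℕ}
    (ν₀ : ⋀[ℂ]^m V) (ν : (x : M) → ⋀[ℂ]^m (J.Fiber x)) :
    suBundle 𝒯 B L J ν₀ ν ⊆ cartanBundle 𝒯 B L :=
  fun _ hu => hu.1

variable (V) in
/-- The equivariant function `f(u) = u⁻¹(s(x))` on the frame bundle which corresponds to a section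
`s` of `T`. -/
def equivariantFunction (s : (x : M) → T x) (u : FrameSpace F T V) : V :=
  (frameMap u).inverse (s u.1)

/-- The derivative `ξ · f` of a vector valued function on the frame space in direction `ξ`. -/
def derivAlong (f : FrameSpace F T V → V) (u : FrameSpace F T V)
    (ξ : TangentSpace (frameModel n F V) u) : V :=
  mfderiv (frameModel n F V) 𝓘(ℝ, V) f u ξ

/-- `θ` is the canonical conformal Cartan connection: the smooth `𝔰𝔬(V)`-valued one-form on the
Cartan bundle such that, for each section `s` of `T` with equivariant function `f`, the function
corresponding to `∇_ξ s` is `ξ' · f + θ(ξ') f` for all lifts `ξ'` of `ξ`. -/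
structure IsCanonicalCartanConnection (𝒯 : StandardTractorBundle F T c)
    (B : V →ₗ⋆[ℂ] V →ₗ[ℂ] ℂ) (L : Submodule ℝ V)
    (θ : OneFormOn (frameModel n F V) (cartanBundle 𝒯 B L) (so B)) : Prop where
  smooth : OneFormOn.IsSmooth (frameModel n F V) θ
  connection : ∀ (u : cartanBundle 𝒯 B L)
    (ξ : tangentTo (frameModel n F V) (cartanBundle 𝒯 B L) (u : FrameSpace F T V))
    (s : (x : M) → T x), SmoothSection n F s →
      (frameMap (u : FrameSpace F T V)).inverse
          (𝒯.conn s (u : FrameSpace F T V).1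
            (mfderiv (frameModel n F V) (𝓡 n) (fun u' : FrameSpace F T V => u'.1)
              (u : FrameSpace F T V)
              (ξ : TangentSpace (frameModel n F V) (u : FrameSpace F T V)))) =
        derivAlong (equivariantFunction V s) (u : FrameSpace F T V)
            (ξ : TangentSpace (frameModel n F V) (u : FrameSpace F T V)) +
          (θ u ξ : V →L[ℝ] V) (equivariantFunction V s (u : FrameSpace F T V))

end Cartan

end Bundles

end TractorSU

end

/-!
Write `𝒢` for the Cartan bundle, `𝒢^{SU}` for its reduction by `J` and `ν`, and `ω` for the
canonical form. Covariant derivatives of sections prescribe `ω(ξ)` on the values at `u` of all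
equivariant functions, that is, on all of `V`, so there is at most one such form. In a local
trivialization of `T`, where a frame `u` becomes a linear map `Û` and the connection a matrix of
one-forms `Γ`, the formula `ω = Û⁻¹ (dÛ + Γ Û)` defines it (`connForm`, `inverse_conn`,
`eq_connForm`); in particular this expression does not depend on the trivialization, is smooth,
is equivariant under the structure group and reproduces fundamental vectors. Functions
such as `Re ⟨f_s, f_t⟩ - h(s, t)`, where `f_s` corresponds to the section `s`, vanish along `𝒢` by
definition, and so do their derivatives on tangent vectors; since `h` is parallel, this says that
`ω` has values in `𝔰𝔬(V)`. In the same way `J` and `ν` give values in `𝔰𝔲(V)` on `𝒢^{SU}`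
(`connForm_mem_so`, `connForm_mem_su`).

The main point in showing that `𝒢^{SU}` is a bundle is that it has a smooth section near each point.
The squared length of `ν` is the determinant of a Gram matrix, its derivative vanishes since `h`,
`J` and `ν` are parallel (`sum_det_gram_update`), so that it equals the squared length of `ν₀`
everywhere (`isTopSqNorm_of_connectedComponent`). At a single point, an isometry of `V` with the
fibre which respects the lines exists by Witt's theorem for null vectors (`exists_isometry`); a
given signature of the real form determines that of the Hermitian form. Such an isometry is extended
to the nearby points in four steps, each of which keeps what has been achieved before: it is made
complex linear, then compatible with the pairing with the null vector, then orthogonal by means of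
an inverse square root, and finally it is composed with a transvection along a non-null vector
orthogonal to the line, whose determinant of absolute value one corrects the volume element
(`exists_adapted_extension`). This last step is where `p' + q' + 2 ≥ 3`, that is `n ≥ 3`, is needed:
in complex dimension two there is no such vector.

Two points of `𝒢^{SU}` over the same point of `M` differ by an element of `P^{SU}`. Hence a section
`Û` yields the parametrization `(x, A) ↦ Û(x) exp A` of the frame space, in which `𝒢^{SU}`
corresponds to `A ∈ 𝔭^{SU}`, because near zero `exp A` belongs to `P^{SU}` exactly if `A` belongs to
its Lie algebra (`eventually_exp_mem_iff`). This shows that `𝒢^{SU}` is a submanifold, and it is a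
principal bundle (`isPrincipalFrameBundle_suBundle`).

Let `ω(ξ) = 0`. Sections of the line bundle correspond to functions with values in `L`, and their
covariant derivatives in the direction of `ξ` again take values in the line. By the nondegeneracy of
the tractor connection `ξ` is vertical, and then it vanishes (`selfConnForm_injective`). Conversely
let `A ∈ 𝔰𝔲(V)`, and let `v₀ ∈ L` correspond to a null section `σ` of the line bundle. The vector
`A v₀` is orthogonal to `v₀`. Since the derivatives `∇_X σ` span the complement of `σ` up to
multiples of `σ`, a count of dimensions (`exists_conn_eq`), `A v₀` agrees with `ω(ξ) v₀` modulo `L`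
for some `ξ` tangent to `𝒢^{SU}`. The difference `A - ω(ξ)` belongs to `𝔭^{SU}`, so it is the value
of `ω` on a fundamental vector (`selfConnForm_surjective`).
-/

noncomputable section

namespace TractorSU

set_option linter.unusedSectionVars false

/-! ### Orthonormal bases of Hermitian forms -/

section Hermitian

variable {W : Type*} [AddCommGroup W] [Module ℂ W] {H : W →ₗ⋆[ℂ] W →ₗ[ℂ] ℂ}

theorem hermitian_self_im (hH : ∀ x y, H x y = starRingEnd ℂ (H y x)) (x : W) :
    (H x x).im = 0 := by
  have := congrArg Complex.im (hH x x)
  rw [Complex.conj_im] at this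
  linarith

theorem hermitian_self_eq (hH : ∀ x y, H x y = starRingEnd ℂ (H y x)) (x : W) :
    H x x = ((H x x).re : ℂ) :=
  Complex.ext (by simp) (by simp [hermitian_self_im hH])

/-- Polarization: a Hermitian form which vanishes on the diagonal of a subspace vanishes on it. -/
theorem hermitian_eq_zero_of_self (N : Submodule ℂ W)
    (h0 : ∀ x ∈ N, H x x = 0) : ∀ x ∈ N, ∀ y ∈ N, H x y = 0 := by
  intro x hx y hy
  have h1 := h0 (x + y) (N.add_mem hx hy)
  have h2 := h0 (x + Complex.I • y) (N.add_mem hx (N.smul_mem _ hy))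
  simp only [map_add, LinearMap.add_apply, map_smul, LinearMap.map_smulₛₗ, LinearMap.smul_apply,
    smul_eq_mul, h0 x hx, h0 y hy, Complex.conj_I] at h1 h2
  have h3 : H x y + H y x = 0 := by linear_combination h1
  have h4 : H x y - H y x = 0 := by
    have : Complex.I * (H x y - H y x) = 0 := by linear_combination h2
    simpa using this
  linear_combination (h3 + h4) / 2

theorem exists_norm_one_smul (hH : ∀ x y, H x y = starRingEnd ℂ (H y x)) {v : W}
    (hv : H v v ≠ 0) : ∃ (c : ℝ) (ε : ℝ), c ≠ 0 ∧ (ε = 1 ∨ ε = -1) ∧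
      H ((c : ℂ) • v) ((c : ℂ) • v) = ε := by
  have e := hermitian_self_eq hH v
  set a := (H v v).re with ha
  have ha0 : a ≠ 0 := fun h => hv (by rw [e, h]; simp)
  have hpos : 0 < |a| := abs_pos.mpr ha0
  refine ⟨(Real.sqrt |a|)⁻¹, a / |a|, by positivity, ?_, ?_⟩
  · rcases lt_or_gt_of_ne ha0 with h | h
    · right; rw [abs_of_neg h]; field_simp
    · left; rw [abs_of_pos h]; field_simp
  · simp only [LinearMap.map_smulₛₗ, LinearMap.smul_apply, map_smul, e, Complex.conj_ofReal,
      smul_eq_mul]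
    rw [← Complex.ofReal_mul, ← Complex.ofReal_mul]
    congr 1
    have : Real.sqrt |a| * Real.sqrt |a| = |a| := Real.mul_self_sqrt hpos.le
    have hs : Real.sqrt |a| ≠ 0 := by positivity
    have h2 : (Real.sqrt |a|)⁻¹ * (Real.sqrt |a|)⁻¹ = |a|⁻¹ := by rw [← mul_inv, this]
    rw [div_eq_mul_inv, ← h2]
    ring

/-- `e` is an orthonormal basis of the subspace `N` for the Hermitian form `H`, the squared lengths
being `ε i = ±1`. -/
structure IsOrthonormalFamily (H : W →ₗ⋆[ℂ] W →ₗ[ℂ] ℂ) (N : Submodule ℂ W) {k : ℕ}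
    (e : Fin k → W) (ε : Fin k → ℝ) : Prop where
  gram : ∀ i j, H (e i) (e j) = if i = j then (ε i : ℂ) else 0
  sign : ∀ i, ε i = 1 ∨ ε i = -1
  span_eq : Submodule.span ℂ (range e) = N

theorem IsOrthonormalFamily.mem {N : Submodule ℂ W} {k : ℕ} {e : Fin k → W} {ε : Fin k → ℝ}
    (h : IsOrthonormalFamily H N e ε) (i : Fin k) : e i ∈ N := by
  rw [← h.span_eq]; exact Submodule.subset_span ⟨i, rfl⟩

theorem IsOrthonormalFamily.sign_ne_zero {N : Submodule ℂ W} {k : ℕ} {e : Fin k → W}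
    {ε : Fin k → ℝ} (h : IsOrthonormalFamily H N e ε) (i : Fin k) : ε i ≠ 0 := by
  rcases h.sign i with h | h <;> rw [h] <;> norm_num

theorem IsOrthonormalFamily.linearIndependent {N : Submodule ℂ W} {k : ℕ} {e : Fin k → W}
    {ε : Fin k → ℝ} (h : IsOrthonormalFamily H N e ε) : LinearIndependent ℂ e := by
  rw [Fintype.linearIndependent_iff]
  intro g hg i
  have h1 : H (e i) (∑ j, g j • e j) = g i * ε i := by
    simp [map_sum, h.gram]
  rw [hg, map_zero] at h1
  have : (ε i : ℂ) ≠ 0 := by exact_mod_cast h.sign_ne_zero i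
  simpa [this] using h1.symm

/-- The orthogonal complement of `v` within `N`. -/
def orthIn (H : W →ₗ⋆[ℂ] W →ₗ[ℂ] ℂ) (N : Submodule ℂ W) (v : W) : Submodule ℂ W :=
  N ⊓ LinearMap.ker (H v)

/-- The Hermitian form `H` is nondegenerate on the subspace `N`. -/
def NondegenerateOn (H : W →ₗ⋆[ℂ] W →ₗ[ℂ] ℂ) (N : Submodule ℂ W) : Prop :=
  ∀ x ∈ N, (∀ y ∈ N, H x y = 0) → x = 0

theorem sub_mem_orthIn {N : Submodule ℂ W} {v : W} (hvN : v ∈ N) {ε : ℝ} (hε : ε = 1 ∨ ε = -1)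
    (hv : H v v = ε) {y : W} (hy : y ∈ N) : y - ((ε : ℂ) * H v y) • v ∈ orthIn H N v := by
  refine ⟨N.sub_mem hy (N.smul_mem _ hvN), ?_⟩
  change H v _ = 0
  rw [map_sub, map_smul, hv, smul_eq_mul]
  have : (ε : ℂ) * ε = 1 := by rcases hε with h | h <;> rw [h] <;> norm_num
  linear_combination (- H v y) * this

theorem NondegenerateOn.orthIn (hH : ∀ x y, H x y = starRingEnd ℂ (H y x)) {N : Submodule ℂ W}
    (hN : NondegenerateOn H N) {v : W} (hvN : v ∈ N) {ε : ℝ} (hε : ε = 1 ∨ ε = -1)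
    (hv : H v v = ε) : NondegenerateOn H (orthIn H N v) := by
  intro x hx h
  refine hN x hx.1 fun y hy => ?_
  have h1 := h _ (sub_mem_orthIn hvN hε hv hy)
  have h2 : H x v = 0 := by
    rw [hH, show H v x = 0 from hx.2, map_zero]
  rwa [map_sub, map_smul, h2, smul_zero, sub_zero] at h1

theorem IsOrthonormalFamily.cons (hH : ∀ x y, H x y = starRingEnd ℂ (H y x)) {N : Submodule ℂ W}
    {v : W} (hvN : v ∈ N) {s : ℝ} (hs : s = 1 ∨ s = -1) (hv : H v v = s) {k : ℕ}
    {e : Fin k → W} {ε : Fin k → ℝ} (h : IsOrthonormalFamily H (orthIn H N v) e ε) :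
    IsOrthonormalFamily H N (Fin.cons v e : Fin (k + 1) → W) (Fin.cons s ε : Fin (k + 1) → ℝ) where
  gram := by
    have h0 : ∀ i, H v (e i) = 0 := fun i => (h.mem i).2
    have h0' : ∀ i, H (e i) v = 0 := fun i => by rw [hH, h0, map_zero]
    intro i j
    refine Fin.cases ?_ (fun i => ?_) i <;> refine Fin.cases ?_ (fun j => ?_) j
    · simpa using hv
    · simp [h0, (Fin.succ_ne_zero j).symm]
    · simp [h0', Fin.succ_ne_zero i]
    · simp [h.gram]
  sign := by
    intro i
    refine Fin.cases ?_ (fun i => ?_) i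
    · simpa using hs
    · simpa using h.sign i
  span_eq := by
    rw [Fin.range_cons]
    apply le_antisymm
    · rw [Submodule.span_le]
      rintro _ (rfl | ⟨i, rfl⟩)
      · exact hvN
      · exact (h.mem i).1
    · intro y hy
      have h1 := sub_mem_orthIn hvN hs hv hy
      rw [← h.span_eq] at h1
      have h2 := Submodule.span_mono (R := ℂ) (subset_insert v (range e)) h1
      have h3 : v ∈ Submodule.span ℂ (insert v (range e)) :=
        Submodule.subset_span (mem_insert _ _)
      simpa using Submodule.add_mem _ h2 (Submodule.smul_mem _ ((s : ℂ) * H v y) h3)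

/-- Vectors of squared length `±1` are split off one after the other: by polarization, a
nondegenerate form on a nonzero space has a vector which is not null. -/
theorem exists_isOrthonormalFamily [FiniteDimensional ℂ W]
    (hH : ∀ x y, H x y = starRingEnd ℂ (H y x)) (N : Submodule ℂ W) (hN : NondegenerateOn H N) :
    ∃ (k : ℕ) (e : Fin k → W) (ε : Fin k → ℝ), IsOrthonormalFamily H N e ε := by
  induction hd : Module.finrank ℂ N using Nat.strong_induction_on generalizing N with
  | _ d ih =>
    by_cases h0 : ∀ x ∈ N, H x x = 0
    · have hbot : N = ⊥ := by
        rw [Submodule.eq_bot_iff]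
        exact fun x hx => hN x hx (hermitian_eq_zero_of_self N h0 x hx)
      exact ⟨0, Fin.elim0, Fin.elim0, fun i => i.elim0, fun i => i.elim0, by
        rw [hbot, Submodule.span_eq_bot]; rintro _ ⟨i, _⟩; exact i.elim0⟩
    · push Not at h0
      obtain ⟨w, hw, hww⟩ := h0
      obtain ⟨c, s, -, hs, hv⟩ := exists_norm_one_smul hH hww
      set v := (c : ℂ) • w with hvdef
      have hvN : v ∈ N := N.smul_mem _ hw
      have hlt : orthIn H N v < N := by
        refine lt_of_le_of_ne inf_le_left fun h => ?_
        have : v ∈ orthIn H N v := by rw [h]; exact hvN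
        have h2 : H v v = 0 := this.2
        rw [hv] at h2
        rcases hs with h | h <;> rw [h] at h2 <;> norm_num at h2
      obtain ⟨k, e, ε, he⟩ := ih _
        (by rw [← hd]; exact Submodule.finrank_lt_finrank_of_lt hlt) (orthIn H N v)
        (hN.orthIn hH hvN hs hv) rfl
      exact ⟨k + 1, _, _, IsOrthonormalFamily.cons hH hvN hs hv he⟩

/-- A null vector of a nondegenerate Hermitian form is the sum of the first two members of an
orthonormal basis, of squared lengths `1` and `-1`. -/
theorem exists_isOrthonormalFamily_of_null [FiniteDimensional ℂ W]
    (hH : ∀ x y, H x y = starRingEnd ℂ (H y x)) (hN : NondegenerateOn H ⊤) {v : W} (hv0 : v ≠ 0)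
    (hv : H v v = 0) :
    ∃ (k : ℕ) (e : Fin (k + 2) → W) (ε : Fin (k + 2) → ℝ), IsOrthonormalFamily H ⊤ e ε ∧
      ε 0 = 1 ∧ ε 1 = -1 ∧ v = e 0 + e 1 := by
  obtain ⟨u, hu⟩ : ∃ u, H v u ≠ 0 := by
    by_contra! h
    exact hv0 (hN v trivial fun y _ => h y)
  -- `v` is completed to a hyperbolic pair `v, w`, and the basis starts with `v / 2 ± w`
  obtain ⟨w, hw, hww⟩ : ∃ w, H v w = 1 ∧ H w w = 0 := by
    set t := (H v u)⁻¹ • u with ht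
    have ht1 : H v t = 1 := by rw [ht, map_smul, smul_eq_mul, inv_mul_cancel₀ hu]
    have ht2 : H t v = 1 := by rw [hH, ht1, map_one]
    refine ⟨t - (((H t t).re / 2 : ℝ) : ℂ) • v, by simp [ht1, hv], ?_⟩
    simp only [map_sub, LinearMap.sub_apply, LinearMap.map_smulₛₗ, map_smul, LinearMap.smul_apply,
      ht1, ht2, hv, Complex.conj_ofReal, smul_eq_mul]
    rw [hermitian_self_eq hH t]
    push_cast
    simp
    ring
  have hw' : H w v = 1 := by rw [hH, hw, map_one]
  set f := (2⁻¹ : ℂ) • v + w with hf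
  set g := (2⁻¹ : ℂ) • v - w with hg
  have c2 : (starRingEnd ℂ) 2 = 2 := Complex.conj_ofNat 2
  have hff : H f f = ((1 : ℝ) : ℂ) := by
    simp [hf, hv, hw, hw', hww, c2]; norm_num
  have hgg : H g g = ((-1 : ℝ) : ℂ) := by
    simp [hg, hv, hw, hw', hww, c2]; norm_num
  have hfg : H f g = 0 := by
    simp [hf, hg, hv, hw, hw', hww, c2]
  have hN1 := hN.orthIn hH (v := f) trivial (Or.inl rfl) hff
  have hgN : g ∈ orthIn H ⊤ f := ⟨trivial, hfg⟩
  have hN2 := hN1.orthIn hH hgN (Or.inr rfl) hgg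
  obtain ⟨k, e, ε, he⟩ := exists_isOrthonormalFamily hH _ hN2
  refine ⟨k, _, _, IsOrthonormalFamily.cons hH (N := ⊤) (v := f) trivial (Or.inl rfl) hff
    (IsOrthonormalFamily.cons hH hgN (Or.inr rfl) hgg he), rfl, rfl, ?_⟩
  change v = f + g
  simp only [hf, hg]
  module

/-- The basis given by an orthonormal family of the whole space. -/
def IsOrthonormalFamily.basis {k : ℕ} {e : Fin k → W} {ε : Fin k → ℝ}
    (h : IsOrthonormalFamily H ⊤ e ε) : Module.Basis (Fin k) ℂ W :=
  Module.Basis.mk h.linearIndependent h.span_eq.ge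

theorem IsOrthonormalFamily.basis_apply {k : ℕ} {e : Fin k → W} {ε : Fin k → ℝ}
    (h : IsOrthonormalFamily H ⊤ e ε) (i : Fin k) : h.basis i = e i := by
  simp [IsOrthonormalFamily.basis]

end Hermitian

/-! ### Signatures -/

/-- Sylvester's law of inertia in terms of bases in which a real bilinear form is diagonal. -/
theorem sigPos_eq_ncard {W : Type*} [AddCommGroup W] [Module ℝ W] {ι : Type*} [Fintype ι]
    [DecidableEq ι] (b : LinearMap.BilinForm ℝ W) (E : Module.Basis ι ℝ W) (w : ι → ℝ)
    (hE : ∀ i j, b (E i) (E j) = if i = j then w i else 0) :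
    sigPos b.toQuadraticMap = {i | 0 < w i}.ncard ∧
      sigNeg b.toQuadraticMap = {i | w i < 0}.ncard := by
  have hQ : QuadraticMap.Equivalent b.toQuadraticMap (QuadraticMap.weightedSumSquares ℝ w) := by
    refine ⟨⟨E.equivFun, fun x => ?_⟩⟩
    rw [QuadraticMap.weightedSumSquares_apply]
    conv_rhs => rw [← E.sum_equivFun x]
    change _ = b _ _
    simp only [map_sum, LinearMap.sum_apply, map_smul, LinearMap.smul_apply, hE, smul_eq_mul]
    simp
    refine Finset.sum_congr rfl fun i _ => by ring
  exact ⟨QuadraticForm.sigPos_of_equiv_weightedSumSquares hQ,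
    QuadraticForm.sigNeg_of_equiv_weightedSumSquares hQ⟩

section RealComplex

variable {W : Type*} [AddCommGroup W] [Module ℂ W] [Module ℝ W] [IsScalarTower ℝ ℂ W]
  {H : W →ₗ⋆[ℂ] W →ₗ[ℂ] ℂ}

variable (H) in
/-- The real part of a Hermitian form, as a real bilinear form. -/
def reForm : LinearMap.BilinForm ℝ W :=
  LinearMap.mk₂ ℝ (fun x y => (H x y).re)
    (fun x y z => by simp) (fun c x y => by
      rw [← algebraMap_smul ℂ c x, LinearMap.map_smulₛₗ]; simp)
    (fun x y z => by simp) (fun c x y => by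
      rw [← algebraMap_smul ℂ c y, map_smul]; simp)

/-- The signature of the real part of a Hermitian form determines the signs in an orthonormal basis:
each complex basis vector `e` contributes the two real vectors `e` and `i e` of the same length. -/
theorem IsOrthonormalFamily.card_sign {k : ℕ} {e : Fin k → W} {ε : Fin k → ℝ}
    (h : IsOrthonormalFamily H ⊤ e ε) {r s : ℕ}
    (hsig : HasSignature (fun x y : W => (H x y).re) r s) :
    2 * {i | 0 < ε i}.ncard = r ∧ 2 * {i | ε i < 0}.ncard = s := by
  obtain ⟨E, hE⟩ := hsig
  have h1 := sigPos_eq_ncard (reForm H) E (Sum.elim (fun _ => 1) (fun _ => -1)) hE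
  have h2 := sigPos_eq_ncard (reForm H) (Complex.basisOneI.smulTower h.basis) (fun i => ε i.2) (by
    rintro ⟨a, i⟩ ⟨a', j⟩
    rw [Module.Basis.smulTower_apply, Module.Basis.smulTower_apply, h.basis_apply, h.basis_apply]
    change (H _ _).re = _
    simp only [LinearMap.map_smulₛₗ, LinearMap.smul_apply, map_smul, h.gram]
    by_cases hij : i = j
    · subst hij
      fin_cases a <;> fin_cases a' <;> simp
    · simp [hij])
  have c1 : {i : Fin r ⊕ Fin s | (0 : ℝ) < Sum.elim (fun _ => 1) (fun _ => -1) i} =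
      range Sum.inl := by
    ext (i | i) <;> simp
  have c2 : {i : Fin r ⊕ Fin s | Sum.elim (fun _ => (1 : ℝ)) (fun _ => -1) i < 0} =
      range Sum.inr := by
    ext (i | i) <;> simp
  have c3 : ∀ S : Set (Fin k), {i : Fin 2 × Fin k | i.2 ∈ S}.ncard = 2 * S.ncard := by
    intro S
    have : {i : Fin 2 × Fin k | i.2 ∈ S} = (univ : Set (Fin 2)) ×ˢ S := by ext; simp
    rw [this, Set.ncard_prod, Set.ncard_univ]; simp
  have n1 : (range (Sum.inl : Fin r → Fin r ⊕ Fin s)).ncard = r := by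
    rw [← image_univ, Set.ncard_image_of_injective _ Sum.inl_injective, Set.ncard_univ]; simp
  have n2 : (range (Sum.inr : Fin s → Fin r ⊕ Fin s)).ncard = s := by
    rw [← image_univ, Set.ncard_image_of_injective _ Sum.inr_injective, Set.ncard_univ]; simp
  constructor
  · rw [← c3, ← n1, ← c1, ← h1.1]; exact h2.1.symm
  · rw [← c3, ← n2, ← c2, ← h1.2]; exact h2.2.symm

end RealComplex

/-! ### Isometries matching null vectors -/

section Isometry

variable {V W : Type*} [AddCommGroup V] [Module ℂ V] [Module ℝ V] [IsScalarTower ℝ ℂ V]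
  [FiniteDimensional ℂ V] [AddCommGroup W] [Module ℂ W] [Module ℝ W] [IsScalarTower ℝ ℂ W]
  [FiniteDimensional ℂ W]

/-- Two families of signs with the same numbers of each sign agree up to a bijection of the
indices. -/
theorem exists_equiv_of_ncard_eq {ι κ : Type*} [Finite ι] [Finite κ] {ε : ι → ℝ} {ε' : κ → ℝ}
    (h : ∀ i, ε i = 1 ∨ ε i = -1) (h' : ∀ i, ε' i = 1 ∨ ε' i = -1)
    (hp : {i | 0 < ε i}.ncard = {i | 0 < ε' i}.ncard)
    (hn : {i | ε i < 0}.ncard = {i | ε' i < 0}.ncard) :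
    ∃ φ : ι ≃ κ, ∀ i, ε' (φ i) = ε i := by
  -- for `c ≠ ±1` both fibres are empty
  have key : ∀ c, Nonempty ({i // ε i = c} ≃ {i // ε' i = c}) := by
    intro c
    apply Finite.card_eq.mp
    change {i | ε i = c}.ncard = {i | ε' i = c}.ncard
    by_cases h1 : c = 1
    · convert hp using 2 <;> ext i <;> simp only [mem_ofPred_eq, h1]
      · rcases h i with h | h <;> rw [h] <;> norm_num
      · rcases h' i with h | h <;> rw [h] <;> norm_num
    · by_cases h2 : c = -1
      · convert hn using 2 <;> ext i <;> simp only [mem_ofPred_eq, h2]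
        · rcases h i with h | h <;> rw [h] <;> norm_num
        · rcases h' i with h | h <;> rw [h] <;> norm_num
      · have e1 : {i | ε i = c} = ∅ := by
          ext i
          rcases h i with h | h <;> simp [h, Ne.symm h1, Ne.symm h2]
        have e2 : {i | ε' i = c} = ∅ := by
          ext i
          rcases h' i with h | h <;> simp [h, Ne.symm h1, Ne.symm h2]
        rw [e1, e2]; simp
  exact ⟨Equiv.ofFiberEquiv fun c => (key c).some, fun i => Equiv.ofFiberEquiv_map _ i⟩

/-- A form of Witt's theorem: nondegenerate Hermitian forms of equal signature are isometric, by an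
isometry which maps a given null vector to a given null vector. -/
theorem exists_isometry {B : V →ₗ⋆[ℂ] V →ₗ[ℂ] ℂ} {H : W →ₗ⋆[ℂ] W →ₗ[ℂ] ℂ}
    (hB : ∀ x y, B x y = starRingEnd ℂ (B y x)) (hH : ∀ x y, H x y = starRingEnd ℂ (H y x))
    (nB : NondegenerateOn B ⊤) (nH : NondegenerateOn H ⊤) {r s : ℕ}
    (sB : HasSignature (fun x y : V => (B x y).re) r s)
    (sH : HasSignature (fun x y : W => (H x y).re) r s)
    {v : V} (hv0 : v ≠ 0) (hv : B v v = 0) {w : W} (hw0 : w ≠ 0) (hw : H w w = 0) :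
    ∃ U : V ≃ₗ[ℂ] W, (∀ x y, H (U x) (U y) = B x y) ∧ U v = w := by
  obtain ⟨k, e, ε, he, e0, e1, hve⟩ := exists_isOrthonormalFamily_of_null hB nB hv0 hv
  obtain ⟨k', f, δ, hf, f0, f1, hwf⟩ := exists_isOrthonormalFamily_of_null hH nH hw0 hw
  obtain ⟨p1, n1⟩ := he.card_sign sB
  obtain ⟨p2, n2⟩ := hf.card_sign sH
  obtain ⟨φ, hφ⟩ := exists_equiv_of_ncard_eq he.sign hf.sign (by omega) (by omega)
  -- a sign preserving bijection of the bases is adjusted such that it fixes the first two indices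
  have swap_sign : ∀ a b, δ a = δ b → ∀ j, δ (Equiv.swap a b j) = δ j := by
    intro a b hab j
    rcases eq_or_ne j a with rfl | ha
    · rw [Equiv.swap_apply_left, hab]
    · rcases eq_or_ne j b with rfl | hb
      · rw [Equiv.swap_apply_right, hab]
      · rw [Equiv.swap_apply_of_ne_of_ne ha hb]
  obtain ⟨φ, hφ, φ0⟩ : ∃ φ : Fin (k + 2) ≃ Fin (k' + 2), (∀ i, δ (φ i) = ε i) ∧ φ 0 = 0 := by
    refine ⟨φ.trans (Equiv.swap (φ 0) 0), fun i => ?_, by simp⟩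
    rw [Equiv.trans_apply, swap_sign _ _ (by rw [hφ, e0, f0]), hφ]
  obtain ⟨φ, hφ, φ0, φ1⟩ : ∃ φ : Fin (k + 2) ≃ Fin (k' + 2),
      (∀ i, δ (φ i) = ε i) ∧ φ 0 = 0 ∧ φ 1 = 1 := by
    refine ⟨φ.trans (Equiv.swap (φ 1) 1), fun i => ?_, ?_, by simp⟩
    · rw [Equiv.trans_apply, swap_sign _ _ (by rw [hφ, e1, f1]), hφ]
    · rw [Equiv.trans_apply, φ0, Equiv.swap_apply_of_ne_of_ne]
      · rw [← φ0]; exact fun h => absurd (φ.injective h) (by simp)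
      · simp
  let U : V ≃ₗ[ℂ] W := he.basis.equiv hf.basis φ
  have hU : ∀ i, U (e i) = f (φ i) := fun i => by
    rw [← he.basis_apply, ← hf.basis_apply]; exact he.basis.equiv_apply i hf.basis φ
  refine ⟨U, ?_, ?_⟩
  · have key : (H.comp (U : V →ₗ[ℂ] W)).compl₂ (U : V →ₗ[ℂ] W) = B := by
      refine he.basis.ext fun i => he.basis.ext fun j => ?_
      change H (U _) (U _) = _
      rw [he.basis_apply, he.basis_apply, hU, hU, hf.gram, he.gram, hφ]
      simp
    intro x y
    rw [← key]; rfl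
  · rw [hve, hwf, map_add, hU, hU, φ0, φ1]

end Isometry

/-! ### Top exterior powers -/

section TopPower

variable {W : Type*} [AddCommGroup W] [Module ℂ W] {m : ℕ}

theorem ιMulti_eq_det_smul (b : Module.Basis (Fin m) ℂ W) (w : Fin m → W) :
    exteriorPower.ιMulti ℂ m w = b.det w • exteriorPower.ιMulti ℂ m b := by
  have key : exteriorPower.ιMulti ℂ m =
      (b.det.smulRight (exteriorPower.ιMulti ℂ m (b : Fin m → W))) := by
    refine Module.Basis.ext_alternating b fun v hv => ?_
    let σ := Equiv.ofBijective v (Finite.injective_iff_bijective.mp hv)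
    have : (fun i => b (v i)) = (b : Fin m → W) ∘ σ := rfl
    rw [this, AlternatingMap.map_perm, AlternatingMap.map_perm]
    simp [b.det_self]
  exact congrArg (fun f => f w) key

theorem ιMulti_basis_ne_zero (b : Module.Basis (Fin m) ℂ W) :
    exteriorPower.ιMulti ℂ m (b : Fin m → W) ≠ 0 := by
  intro h
  have := exteriorPower.alternatingMapLinearEquiv_apply_ιMulti b.det (b : Fin m → W)
  rw [h, map_zero, b.det_self] at this
  exact zero_ne_one this

theorem exists_eq_smul_ιMulti (b : Module.Basis (Fin m) ℂ W) (z : ⋀[ℂ]^m W) :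
    ∃ c : ℂ, z = c • exteriorPower.ιMulti ℂ m (b : Fin m → W) := by
  have hz : z ∈ (⊤ : Submodule ℂ (⋀[ℂ]^m W)) := trivial
  rw [← exteriorPower.ιMulti_span] at hz
  induction hz using Submodule.span_induction with
  | mem x hx => obtain ⟨w, rfl⟩ := hx; exact ⟨_, ιMulti_eq_det_smul b w⟩
  | zero => exact ⟨0, by simp⟩
  | add x y _ _ hx hy =>
    obtain ⟨c, rfl⟩ := hx
    obtain ⟨d, rfl⟩ := hy
    exact ⟨c + d, by rw [add_smul]⟩
  | smul a x _ hx => obtain ⟨c, rfl⟩ := hx; exact ⟨a * c, by rw [mul_smul]⟩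

/-- Gram determinants change by the squared absolute value of the determinant. -/
theorem det_gram_eq (H : W →ₗ⋆[ℂ] W →ₗ[ℂ] ℂ) (b : Module.Basis (Fin m) ℂ W) (w : Fin m → W) :
    (Matrix.of fun i j => H (w i) (w j)).det =
      starRingEnd ℂ (b.det w) * b.det w * (Matrix.of fun i j => H (b i) (b j)).det := by
  have key : (Matrix.of fun i j => H (w i) (w j)) =
      (b.toMatrix w).conjTranspose * (Matrix.of fun i j => H (b i) (b j)) * b.toMatrix w := by
    ext i j
    conv_lhs => rw [Matrix.of_apply, ← b.sum_toMatrix_smul_self w i,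
      ← b.sum_toMatrix_smul_self w j]
    simp only [map_sum, LinearMap.sum_apply, LinearMap.map_smulₛₗ, map_smul, LinearMap.smul_apply,
      Matrix.mul_apply, Matrix.conjTranspose_apply, Matrix.of_apply, smul_eq_mul,
      Finset.sum_mul, Finset.mul_sum, Complex.star_def]
    refine Finset.sum_congr rfl fun k _ => ?_
    refine Finset.sum_congr rfl fun l _ => by ring
  rw [key, Matrix.det_mul, Matrix.det_mul, Matrix.det_conjTranspose, Module.Basis.det_apply]
  simp only [Complex.star_def]
  ring

theorem IsTopSqNorm.eq_of_smul {H : W →ₗ⋆[ℂ] W →ₗ[ℂ] ℂ} (b : Module.Basis (Fin m) ℂ W) {c a : ℂ}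
    (h : IsTopSqNorm (fun v w => H v w) (c • exteriorPower.ιMulti ℂ m (b : Fin m → W)) a) :
    a = starRingEnd ℂ c * c * (Matrix.of fun i j => H (b i) (b j)).det := by
  obtain ⟨w, hw, rfl⟩ := h
  rw [det_gram_eq H b]
  rw [ιMulti_eq_det_smul b w] at hw
  have := smul_left_injective ℂ (ιMulti_basis_ne_zero b) hw
  rw [this]

/-- The squared length of an element of the top exterior power is well defined. -/
theorem IsTopSqNorm.unique {H : W →ₗ⋆[ℂ] W →ₗ[ℂ] ℂ} (b : Module.Basis (Fin m) ℂ W)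
    {z : ⋀[ℂ]^m W} {a a' : ℂ} (h : IsTopSqNorm (fun v w => H v w) z a)
    (h' : IsTopSqNorm (fun v w => H v w) z a') : a = a' := by
  obtain ⟨c, rfl⟩ := exists_eq_smul_ιMulti b z
  exact (h.eq_of_smul b).trans (h'.eq_of_smul b).symm

/-- The derivation of the top exterior power induced by an endomorphism is multiplication by its
trace. -/
theorem sum_update_eq_trace {N : Type*} [AddCommGroup N] [Module ℂ N] (g : W [⋀^Fin m]→ₗ[ℂ] N)
    (b : Module.Basis (Fin m) ℂ W) (A : W →ₗ[ℂ] W) :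
    ∑ i, g (Function.update b i (A (b i))) = LinearMap.trace ℂ W A • g b := by
  have key : ∀ i, g (Function.update b i (A (b i))) = b.repr (A (b i)) i • g b := by
    intro i
    conv_lhs => rw [← b.sum_repr (A (b i))]
    rw [← AlternatingMap.coe_multilinearMap, MultilinearMap.map_update_sum]
    simp only [MultilinearMap.map_update_smul]
    rw [Finset.sum_eq_single i]
    · rw [Function.update_eq_self]
    · intro k _ hk
      rw [AlternatingMap.coe_multilinearMap, AlternatingMap.map_update_self _ _ hk.symm, smul_zero]
    · simp
  simp only [key]
  rw [← Finset.sum_smul, LinearMap.trace_eq_matrix_trace ℂ b]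
  congr 1
  simp [Matrix.trace, LinearMap.toMatrix_apply]

end TopPower

/-! ### Local diffeomorphisms and the exponential map -/

/-- The inverse function theorem, with smoothness on the whole domain of the local inverse. -/
theorem exists_local_diffeo {E E' : Type*} [NormedAddCommGroup E] [NormedSpace ℝ E]
    [CompleteSpace E] [NormedAddCommGroup E'] [NormedSpace ℝ E'] [CompleteSpace E']
    {f : E → E'} {a : E}
    {U : Set E} (hU : U ∈ 𝓝 a) (hf : ∀ᶠ y in 𝓝 a, ContDiffAt ℝ ∞ f y) (f' : E ≃L[ℝ] E')
    (hf' : HasFDerivAt f (f' : E →L[ℝ] E') a) :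
    ∃ φ : OpenPartialHomeomorph E E', a ∈ φ.source ∧ φ.source ⊆ U ∧ ⇑φ = f ∧
      ContDiffOn ℝ ∞ φ φ.source ∧ ContDiffOn ℝ ∞ φ.symm φ.target := by
  have ha : ContDiffAt ℝ ∞ f a := hf.self_of_nhds
  have h0 : (∞ : WithTop ℕ∞) ≠ 0 := by simp
  let φ₀ := ha.toOpenPartialHomeomorph f hf' h0
  have hcont : ContinuousAt (fderiv ℝ f) a := by
    have : ContDiffAt ℝ 1 f a := ha.of_le (by simp)
    exact (this.fderiv_right (m := 0) (by simp)).continuousAt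
  have hunit : ∀ᶠ y in 𝓝 a, fderiv ℝ f y ∈ range ((↑) : (E ≃L[ℝ] E') → E →L[ℝ] E') := by
    apply hcont.eventually
    rw [hf'.fderiv]
    exact f'.nhds
  obtain ⟨O, hO, hOo, haO⟩ := mem_nhds_iff.mp (inter_mem hU (hf.and hunit))
  have hsrc : (φ₀.restrOpen O hOo).source = φ₀.source ∩ O := φ₀.restrOpen_source O hOo
  refine ⟨φ₀.restrOpen O hOo, ?_, ?_, rfl, ?_, ?_⟩
  · rw [hsrc]
    exact ⟨ha.mem_toOpenPartialHomeomorph_source hf' h0, haO⟩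
  · rw [hsrc]
    exact fun y hy => (hO hy.2).1
  · rw [hsrc]
    exact fun y hy => ((hO hy.2).2.1).contDiffWithinAt
  · intro z hz
    have hy : (φ₀.restrOpen O hOo).symm z ∈ φ₀.source ∩ O := by
      rw [← hsrc]; exact (φ₀.restrOpen O hOo).map_target hz
    obtain ⟨-, h1, g', hg'⟩ := hO hy.2
    refine ContDiffAt.contDiffWithinAt (OpenPartialHomeomorph.contDiffAt_symm _ hz
      (f₀' := g') ?_ h1)
    rw [hg']
    exact (h1.differentiableAt (by simp)).hasFDerivAt

section Exp

open NormedSpace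

variable {𝔸 : Type*} [NormedRing 𝔸] [NormedAlgebra ℝ 𝔸]

theorem contDiff_exp [CompleteSpace 𝔸] : ContDiff ℝ ∞ (exp : 𝔸 → 𝔸) :=
  contDiff_iff_contDiffAt.mpr fun x => (exp_analytic (𝕂 := ℝ) x).contDiffAt

theorem exp_injective_near_zero [CompleteSpace 𝔸] :
    ∃ O ∈ 𝓝 (0 : 𝔸), InjOn (exp : 𝔸 → 𝔸) O := by
  obtain ⟨φ, h0, -, hφ, -⟩ := exists_local_diffeo (univ_mem (f := 𝓝 (0 : 𝔸)))
    (Eventually.of_forall fun y => (contDiff_exp (𝔸 := 𝔸)).contDiffAt)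
    (ContinuousLinearEquiv.refl ℝ 𝔸) hasFDerivAt_exp_zero
  exact ⟨φ.source, φ.open_source.mem_nhds h0, hφ ▸ φ.injOn⟩

variable [FiniteDimensional ℝ 𝔸]

/-- The subspace `N` is closed under multiplication, but it need not contain `1`. -/
theorem exp_sub_one_mem {N : Submodule ℝ 𝔸} (hN : ∀ x ∈ N, ∀ y ∈ N, x * y ∈ N) {x : 𝔸}
    (hx : x ∈ N) : exp x - 1 ∈ N := by
  have : CompleteSpace 𝔸 := FiniteDimensional.complete ℝ 𝔸
  have hs := (hasSum_nat_add_iff' 1).mpr (exp_series_hasSum_exp' (𝕂 := ℝ) x)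
  simp only [Finset.range_one, Finset.sum_singleton, Nat.factorial_zero, Nat.cast_one, inv_one,
    pow_zero, one_smul] at hs
  have hpow : ∀ n : ℕ, x ^ (n + 1) ∈ N := by
    intro n
    induction n with
    | zero => simpa using hx
    | succ n ih => rw [pow_succ]; exact hN _ ih _ hx
  exact (Submodule.closed_of_finiteDimensional N).mem_of_tendsto hs
    (Eventually.of_forall fun s => N.sum_mem fun i _ => N.smul_mem _ (hpow i))

/-- Near the origin, the logarithm of an element of `1 + N` lies in the subalgebra `N`. -/
theorem eventually_mem_of_exp_sub_one_mem {N : Submodule ℝ 𝔸}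
    (hN : ∀ x ∈ N, ∀ y ∈ N, x * y ∈ N) : ∀ᶠ x in 𝓝 (0 : 𝔸), exp x - 1 ∈ N → x ∈ N := by
  have : CompleteSpace 𝔸 := FiniteDimensional.complete ℝ 𝔸
  obtain ⟨O, hO, hinj⟩ := exp_injective_near_zero (𝔸 := 𝔸)
  obtain ⟨pr, hpr⟩ := Submodule.ClosedComplemented.of_finiteDimensional N
  -- `exp - 1` restricts to a local homeomorphism of `N`, so that elements of `N` near `0` are of
  -- the form `exp y - 1` with `y ∈ N`; by injectivity of `exp`, there is no other choice of `y`
  let f : N → N := fun x => pr (exp (x : 𝔸) - 1)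
  have hfx : ∀ x : N, (f x : 𝔸) = exp (x : 𝔸) - 1 := fun x => by
    change ((pr (exp (x : 𝔸) - 1) : N) : 𝔸) = _
    rw [hpr ⟨_, exp_sub_one_mem hN x.2⟩]
  have hf : HasStrictFDerivAt f ((ContinuousLinearEquiv.refl ℝ N : N ≃L[ℝ] N) : N →L[ℝ] N) 0 := by
    have h1 : HasStrictFDerivAt (fun x : N => exp (x : 𝔸)) ((1 : 𝔸 →L[ℝ] 𝔸).comp N.subtypeL) 0 := by
      have h : HasStrictFDerivAt (exp : 𝔸 → 𝔸) (1 : 𝔸 →L[ℝ] 𝔸) (N.subtypeL 0) := by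
        rw [map_zero]; exact hasStrictFDerivAt_exp_zero
      exact h.comp 0 N.subtypeL.hasStrictFDerivAt
    have h2 := pr.hasStrictFDerivAt.comp (0 : N) (h1.sub_const 1)
    have e : ((ContinuousLinearEquiv.refl ℝ N : N ≃L[ℝ] N) : N →L[ℝ] N) =
        pr.comp ((1 : 𝔸 →L[ℝ] 𝔸).comp N.subtypeL) :=
      ContinuousLinearMap.ext fun x => (hpr x).symm
    rw [e]
    exact h2
  have hmap := hf.map_nhds_eq_of_equiv
  have hO' : (N.subtypeL ⁻¹' O) ∈ 𝓝 (0 : N) :=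
    N.subtypeL.continuous.continuousAt.preimage_mem_nhds (by rwa [map_zero])
  have him := hmap ▸ image_mem_map (m := f) hO'
  have f0 : f 0 = 0 := by
    apply Subtype.ext; rw [hfx]; simp
  rw [f0] at him
  have hpre : ∀ᶠ x in 𝓝 (0 : 𝔸), pr (exp x - 1) ∈ f '' (N.subtypeL ⁻¹' O) := by
    have hc : ContinuousAt (fun x : 𝔸 => pr (exp x - 1)) 0 :=
      (pr.continuous.comp (contDiff_exp.continuous.sub continuous_const)).continuousAt
    apply hc.preimage_mem_nhds
    simpa using him
  filter_upwards [hpre, hO] with x hx hxO hxN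
  obtain ⟨y, hyO, hy⟩ := hx
  have h1 : exp (y : 𝔸) = exp x := by
    have h2 := hfx y
    rw [hy, hpr ⟨_, hxN⟩] at h2
    exact (sub_left_injective h2).symm
  rw [← hinj hyO hxO h1]
  exact y.2

/-- A continuous linear antiautomorphism commutes with the exponential map. -/
theorem map_exp_of_anti (τ : 𝔸 →ₗ[ℝ] 𝔸) (h1 : τ 1 = 1) (hmul : ∀ x y, τ (x * y) = τ y * τ x)
    (x : 𝔸) : τ (exp x) = exp (τ x) := by
  have : CompleteSpace 𝔸 := FiniteDimensional.complete ℝ 𝔸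
  have hpow : ∀ n : ℕ, τ (x ^ n) = τ x ^ n := by
    intro n
    induction n with
    | zero => simpa using h1
    | succ n ih => rw [pow_succ, hmul, ih, pow_succ']
  have hs := (exp_series_hasSum_exp' (𝕂 := ℝ) x).map τ.toAddMonoidHom
    (LinearMap.continuous_of_finiteDimensional τ)
  refine hs.unique ?_
  convert exp_series_hasSum_exp' (𝕂 := ℝ) (τ x) using 1
  ext n
  simp [hpow]

end Exp

/-! ### Nondegenerate forms -/

section Forms

variable {V : Type*} [NormedAddCommGroup V] [NormedSpace ℂ V] {B : V →ₗ⋆[ℂ] V →ₗ[ℂ] ℂ} {r s : ℕ}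

theorem HasHermitianSignature.symm (hB : HasHermitianSignature B r s) (x y : V) :
    B x y = starRingEnd ℂ (B y x) := by
  obtain ⟨e, he⟩ := hB
  rw [← e.sum_repr x, ← e.sum_repr y]
  simp only [map_sum, LinearMap.sum_apply, LinearMap.map_smulₛₗ, map_smul, LinearMap.smul_apply,
    smul_eq_mul, map_mul, he, Complex.conj_conj, mul_ite,
    mul_zero, Finset.sum_ite_eq', Finset.mem_univ, if_true]
  refine Finset.sum_congr rfl fun i _ => ?_
  rcases i with i | i <;> simp <;> ring

theorem HasHermitianSignature.nondegenerate (hB : HasHermitianSignature B r s) :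
    NondegenerateOn B ⊤ := by
  have hs := hB.symm
  obtain ⟨e, he⟩ := hB
  intro x _ h
  have key : ∀ i, e.repr x i = 0 := by
    intro i
    have h1 : B (e i) x = 0 := by rw [hs, h _ trivial, map_zero]
    rw [← e.sum_repr x] at h1
    simp only [map_sum, map_smul, he, smul_eq_mul] at h1
    rcases i with i | i <;> simpa using h1
  rw [← e.sum_repr x]
  simp [key]

theorem HasHermitianSignature.finrank (hB : HasHermitianSignature B r s) :
    Module.finrank ℂ V = r + s := by
  obtain ⟨e, -⟩ := hB
  simp [Module.finrank_eq_card_basis e]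

theorem HasHermitianSignature.real (hB : HasHermitianSignature B r s) :
    HasSignature (fun x y : V => (B x y).re) (2 * r) (2 * s) := by
  obtain ⟨e, he⟩ := hB
  let φ : Fin 2 × (Fin r ⊕ Fin s) ≃ Fin (2 * r) ⊕ Fin (2 * s) :=
    (Equiv.prodSumDistrib _ _ _).trans (Equiv.sumCongr finProdFinEquiv finProdFinEquiv)
  have hφ : ∀ a i, Sum.elim (fun _ => (1 : ℝ)) (fun _ => -1) (φ (a, i)) =
      Sum.elim (fun _ => 1) (fun _ => -1) i := by
    rintro a (i | i) <;> simp [φ]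
  refine ⟨(Complex.basisOneI.smulTower e).reindex φ, fun i j => ?_⟩
  obtain ⟨⟨a, i⟩, rfl⟩ := φ.surjective i
  obtain ⟨⟨a', j⟩, rfl⟩ := φ.surjective j
  rw [Module.Basis.reindex_apply, Module.Basis.reindex_apply, Equiv.symm_apply_apply,
    Equiv.symm_apply_apply, hφ, Module.Basis.smulTower_apply, Module.Basis.smulTower_apply]
  simp only [LinearMap.map_smulₛₗ, LinearMap.smul_apply, map_smul, he, φ.injective.eq_iff]
  by_cases hij : i = j
  · subst hij
    rcases i with i | i <;> fin_cases a <;> fin_cases a' <;> simp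
  · simp [hij]

theorem im_eq_neg_re (x y : V) : (B x y).im = -(B x (Complex.I • y)).re := by
  simp

/-- Multiplication by the imaginary unit, as a real linear map. -/
def mulI (V : Type*) [NormedAddCommGroup V] [NormedSpace ℂ V] : V →L[ℝ] V :=
  (Complex.I • ContinuousLinearMap.id ℂ V).restrictScalars ℝ

@[simp] theorem mulI_apply (v : V) : mulI V v = Complex.I • v := rfl

variable (V) in
/-- The algebra of complex linear endomorphisms, within the real linear ones. -/
def complexEnd : Submodule ℝ (V →L[ℝ] V) where
  carrier := {A | ∀ v, A (Complex.I • v) = Complex.I • A v}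
  zero_mem' := fun v => by simp
  add_mem' := fun ha hb v => by simp [ha v, hb v]
  smul_mem' := fun c a ha v => by
    change c • a _ = _ • c • a v
    rw [ha, smul_comm]

theorem mul_mem_complexEnd : ∀ x ∈ complexEnd V, ∀ y ∈ complexEnd V, x * y ∈ complexEnd V :=
  fun x hx y hy v => by
    change x (y _) = _ • x (y v)
    rw [hy v, hx]

/-- A real linear map which commutes with multiplication by `i`, as a complex linear map. -/
def complexify {W : Type*} [AddCommGroup W] [Module ℂ W] [Module ℝ W] [IsScalarTower ℝ ℂ W]
    (A : V →ₗ[ℝ] W) (hA : ∀ v, A (Complex.I • v) = Complex.I • A v) : V →ₗ[ℂ] W where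
  toFun := A
  map_add' := map_add A
  map_smul' z v := by
    have hz : z • v = z.re • v + z.im • Complex.I • v := by
      conv_lhs => rw [← Complex.re_add_im z]
      rw [add_smul, mul_smul]; rfl
    have hz' : z • A v = z.re • A v + z.im • Complex.I • A v := by
      conv_lhs => rw [← Complex.re_add_im z]
      rw [add_smul, mul_smul]
      have : ∀ (c : ℝ) (w : W), (c : ℂ) • w = c • w := fun c w => algebraMap_smul ℂ c w
      rw [this, this]
    rw [RingHom.id_apply, hz, hz', map_add, map_smul, map_smul, hA]

theorem reForm_nondegenerate (hB : HasHermitianSignature B r s) : (reForm B).Nondegenerate := by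
  have key : ∀ v, (∀ w, (B v w).re = 0) → v = 0 := fun v h =>
    hB.nondegenerate v trivial fun w _ =>
      Complex.ext (h w) (by rw [im_eq_neg_re, h, neg_zero]; rfl)
  refine ⟨fun v h => key v h, fun v h => key v fun w => ?_⟩
  rw [hB.symm, Complex.conj_re]
  exact h w

theorem HasHermitianSignature.ext_re (hB : HasHermitianSignature B r s) {v v' : V}
    (h : ∀ w, (B v w).re = (B v' w).re) : v = v' := by
  rw [← sub_eq_zero]
  refine (reForm_nondegenerate hB).1 _ fun w => ?_
  change (B (v - v') w).re = 0
  rw [map_sub, LinearMap.sub_apply, Complex.sub_re, h, sub_self]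

variable [FiniteDimensional ℂ V]

/-- The Riesz isomorphism of the real part of a nondegenerate Hermitian form. -/
theorem exists_riesz (hB : HasHermitianSignature B r s) :
    ∃ R : (V →L[ℝ] ℝ) →L[ℝ] V, ∀ φ w, (B (R φ) w).re = φ w := by
  let R₀ : (V →ₗ[ℝ] ℝ) ≃ₗ[ℝ] V :=
    (LinearMap.BilinForm.toDual (reForm B) (reForm_nondegenerate hB)).symm
  let R₁ : (V →L[ℝ] ℝ) →ₗ[ℝ] V := R₀.toLinearMap.comp
    (LinearMap.toContinuousLinearMap (𝕜 := ℝ) (E := V) (F' := ℝ)).symm.toLinearMap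
  refine ⟨LinearMap.toContinuousLinearMap R₁, fun φ w => ?_⟩
  exact LinearMap.BilinForm.apply_toDual_symm_apply (B := reForm B)
    (hB := reForm_nondegenerate hB) (φ : V →ₗ[ℝ] ℝ) w

end Forms

/-! ### The stabilizer of a line in the special unitary group -/

section Group

open NormedSpace

variable {V : Type*} [NormedAddCommGroup V] [NormedSpace ℂ V]
  {B : V →ₗ⋆[ℂ] V →ₗ[ℂ] ℂ} {r s : ℕ}

/-- The complex determinant of real linear endomorphisms, given by the images of a complex basis.
It is the usual determinant on complex linear endomorphisms only. -/
def detOn {m : ℕ} (b : Module.Basis (Fin m) ℂ V) (A : V →L[ℝ] V) : ℂ := b.det fun i => A (b i)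

theorem detOn_eq {m : ℕ} (b : Module.Basis (Fin m) ℂ V) {A : V →L[ℝ] V} {AC : V →ₗ[ℂ] V}
    (h : ∀ v, AC v = A v) : detOn b A = LinearMap.det AC := by
  have := b.det_comp AC b
  rw [b.det_self, mul_one] at this
  rw [← this, detOn]
  congr 1
  ext i
  exact (h _).symm

theorem exp_comm_I {A : V →L[ℝ] V} (hA : ∀ v, A (Complex.I • v) = Complex.I • A v) (v : V) :
    exp A (Complex.I • v) = Complex.I • exp A v := by
  have h : Commute A (mulI V) := ContinuousLinearMap.ext fun v => hA v
  exact congrArg (fun f : V →L[ℝ] V => f v) h.exp_left.eq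

/-- The derivative of the determinant at the identity is the trace. -/
theorem hasDerivAt_detOn_one_add {m : ℕ} (b : Module.Basis (Fin m) ℂ V) {A : V →L[ℝ] V}
    {AC : V →ₗ[ℂ] V} (h : ∀ v, AC v = A v) :
    HasDerivAt (fun t : ℝ => detOn b (1 + t • A)) (LinearMap.trace ℂ V AC) 0 := by
  have e : ∀ t : ℝ, detOn b (1 + t • A) =
      (fun z : ℂ => Matrix.det (1 + z • LinearMap.toMatrix b b AC)) t := by
    intro t
    have h1 : ∀ v, ((1 : V →ₗ[ℂ] V) + (t : ℂ) • AC) v = (1 + t • A : V →L[ℝ] V) v := by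
      intro v
      simp [h]
    rw [detOn_eq b h1, ← LinearMap.det_toMatrix b, map_add, map_smul, LinearMap.toMatrix_one]
  simp only [e]
  refine HasDerivAt.comp_ofReal (e := fun z : ℂ => Matrix.det (1 + z • LinearMap.toMatrix b b AC)) ?_
  rw [LinearMap.trace_eq_matrix_trace ℂ b]
  set P := (Matrix.det (1 + (Polynomial.X : Polynomial ℂ) •
    (LinearMap.toMatrix b b AC).map Polynomial.C)).divX.divX with hP
  have h1 := ((hasDerivAt_id (0 : ℂ)).const_mul (Matrix.trace (LinearMap.toMatrix b b AC))).const_add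
    (1 : ℂ)
  have h2 := (P.hasDerivAt (0 : ℂ)).mul ((hasDerivAt_id (0 : ℂ)).pow 2)
  refine ((h1.add h2).congr_deriv (by simp)).congr_of_eventuallyEq (Eventually.of_forall fun z => ?_)
  exact Matrix.det_one_add_smul z _

/-- The algebra of endomorphisms which map the subspace `L` to itself. -/
def lineStabilizerAlgebra (L : Submodule ℝ V) : Submodule ℝ (V →L[ℝ] V) where
  carrier := {A | ∀ v ∈ L, A v ∈ L}
  zero_mem' := fun _ _ => L.zero_mem
  add_mem' := fun ha hb v hv => L.add_mem (ha v hv) (hb v hv)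
  smul_mem' := fun c _ ha v hv => L.smul_mem c (ha v hv)

variable (B) in
/-- The group `P^{SU}`: the stabilizer of the line `L` in the special unitary group. -/
abbrev suStabilizer (L : Submodule ℝ V) : Subgroup (V ≃L[ℝ] V) :=
  specialUnitary B ⊓ lineStabilizer L

variable (B) in
/-- The Lie algebra of the stabilizer of the line `L` in the special unitary group. -/
abbrev suStabilizerAlgebra (L : Submodule ℝ V) : Submodule ℝ (V →L[ℝ] V) :=
  su B ⊓ lineStabilizerAlgebra L

variable {L : Submodule ℝ V}

theorem apply_mem_iff_of_mem_endSet {a : V →L[ℝ] V} (ha : a ∈ endSet (suStabilizer B L)) (v : V) :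
    a v ∈ L ↔ v ∈ L := by
  obtain ⟨g, hg, rfl⟩ := ha
  exact hg.2 v

theorem su_comm_I {A : V →L[ℝ] V} (hA : A ∈ su B) (v : V) :
    A (Complex.I • v) = Complex.I • A v := by
  obtain ⟨-, AC, hAC, -⟩ := hA
  rw [← hAC, ← hAC, map_smul]

variable [FiniteDimensional ℂ V]

theorem contDiff_basis_det {m : ℕ} (b : Module.Basis (Fin m) ℂ V) :
    ContDiff ℝ ∞ (fun w : Fin m → V => b.det w) := by
  have hco : ∀ i, ContDiff ℝ ∞ (fun v : V => b.repr v i) := fun i =>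
    (LinearMap.toContinuousLinearMap ((b.coord i).restrictScalars ℝ)).contDiff
  simp only [Module.Basis.det_apply, Matrix.det_apply]
  refine ContDiff.sum fun σ _ => ContDiff.const_smul _ (contDiff_prod fun i _ => ?_)
  exact (hco _).comp (contDiff_apply ℝ V i)

theorem contDiff_detOn {m : ℕ} (b : Module.Basis (Fin m) ℂ V) : ContDiff ℝ ∞ (detOn b) :=
  (contDiff_basis_det b).comp (contDiff_pi.mpr fun i =>
    (ContinuousLinearMap.apply ℝ V (b i)).contDiff)

/-- The function `t ↦ det (exp (t A))` is a homomorphism with derivative `tr A` at `0`. -/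
theorem detOn_exp {m : ℕ} (b : Module.Basis (Fin m) ℂ V) {A : V →L[ℝ] V}
    {AC : V →ₗ[ℂ] V} (h : ∀ v, AC v = A v) :
    detOn b (exp A) = Complex.exp (LinearMap.trace ℂ V AC) := by
  have hI : ∀ v, A (Complex.I • v) = Complex.I • A v := fun v => by rw [← h, ← h, map_smul]
  have hIt : ∀ (t : ℝ) v, (t • A) (Complex.I • v) = Complex.I • (t • A) v := fun t v => by
    change t • A _ = _ • t • A v
    rw [hI, smul_comm]
  set τ := LinearMap.trace ℂ V AC
  set f : ℝ → ℂ := fun t => detOn b (exp (t • A)) with hf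
  have f0 : f 0 = 1 := by
    simp only [hf, zero_smul, exp_zero]
    exact b.det_self
  have fadd : ∀ t u, f (t + u) = f t * f u := by
    intro t u
    have e1 : exp ((t + u) • A) = exp (t • A) * exp (u • A) := by
      rw [add_smul]
      let _ : NormedAlgebra ℚ (V →L[ℝ] V) := NormedAlgebra.restrictScalars ℚ ℝ _
      exact exp_add_of_commute (((Commute.refl A).smul_left t).smul_right u)
    let g : ℝ → V →ₗ[ℂ] V := fun t => complexify (exp (t • A) : V →L[ℝ] V) (exp_comm_I (hIt t))
    have hg : ∀ t v, g t v = exp (t • A) v := fun t v => rfl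
    have hg2 : ∀ v, (g t ∘ₗ g u) v = exp ((t + u) • A) v := fun v => by rw [e1]; rfl
    simp only [hf]
    rw [detOn_eq b (hg t), detOn_eq b (hg u), detOn_eq b hg2, LinearMap.det_comp]
  have d0 : HasDerivAt f τ 0 := by
    have hD : HasFDerivAt (detOn b) (fderiv ℝ (detOn b) 1) 1 :=
      ((contDiff_detOn b).differentiable (by simp) 1).hasFDerivAt
    have h1 : HasDerivAt (fun t : ℝ => (1 : V →L[ℝ] V) + t • A) A 0 := by
      simpa using ((hasDerivAt_id (0 : ℝ)).smul_const A).const_add 1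
    have h2 : HasDerivAt (fun t : ℝ => detOn b (1 + t • A)) (fderiv ℝ (detOn b) 1 A) 0 := by
      refine HasFDerivAt.comp_hasDerivAt (l := detOn b) 0 ?_ h1
      simpa using hD
    have h3 : fderiv ℝ (detOn b) 1 A = τ := h2.unique (hasDerivAt_detOn_one_add b h)
    rw [← h3]
    have h4 : HasDerivAt (fun t : ℝ => exp (t • A)) A 0 := by
      have := hasDerivAt_exp_smul_const (𝕂 := ℝ) A (0 : ℝ)
      simpa using this
    refine HasFDerivAt.comp_hasDerivAt (l := detOn b) 0 ?_ h4
    simpa using hD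
  have dt : ∀ t, HasDerivAt f (f t * τ) t := by
    intro t
    have h1 : HasDerivAt (fun u => f t * f (u - t)) (f t * τ) t := by
      have : HasDerivAt f τ (t - t) := by rwa [sub_self]
      exact (this.comp_sub_const t t).const_mul (f t)
    refine h1.congr_of_eventuallyEq (Eventually.of_forall fun u => ?_)
    change f u = f t * f (u - t)
    rw [← fadd]
    congr 1
    ring
  -- `f t * exp (-t τ)` is constant
  have dg : ∀ t : ℝ, HasDerivAt (fun t : ℝ => f t * Complex.exp (-(t * τ))) 0 t := by
    intro t
    have h1 : HasDerivAt (fun t : ℝ => Complex.exp (-(t * τ))) (Complex.exp (-(t * τ)) * -τ) t := by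
      have h2 : HasDerivAt (fun t : ℝ => -((t : ℂ) * τ)) (-τ) t := by
        simpa using ((hasDerivAt_id t).ofReal_comp.mul_const τ).fun_neg
      exact h2.cexp
    exact ((dt t).mul h1).congr_deriv (by ring)
  have hc := is_const_of_deriv_eq_zero (fun t => (dg t).differentiableAt) (fun t => (dg t).deriv) 1 0
  simp only [f0, Complex.ofReal_one, one_mul, Complex.ofReal_zero, zero_mul, neg_zero,
    Complex.exp_zero] at hc
  have hf1 : f 1 = detOn b (exp A) := by simp [hf]
  rw [← hf1, ← mul_one (Complex.exp τ), ← hc, mul_left_comm, ← Complex.exp_add]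
  simp

/-- Endomorphisms with the defining properties of the group are invertible. -/
theorem mem_endSet_suStabilizer {a : V →L[ℝ] V} (hB : ∀ v w, B (a v) (a w) = B v w)
    {aC : V →ₗ[ℂ] V} (haC : ∀ v, aC v = a v) (hdet : LinearMap.det aC = 1)
    (hL : ∀ v ∈ L, a v ∈ L) : a ∈ endSet (suStabilizer B L) := by
  have hinj : Function.Injective a := by
    have h1 : Function.Injective aC :=
      (LinearMap.equivOfDetNeZero aC (by rw [hdet]; exact one_ne_zero)).injective
    intro v w h
    exact h1 (by rw [haC, haC, h])
  let g : V ≃L[ℝ] V := (LinearEquiv.ofInjectiveEndo (a : V →ₗ[ℝ] V) hinj).toContinuousLinearEquiv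
  have hg : ∀ v, g v = a v := fun v => rfl
  refine ⟨g, ⟨⟨fun v w => ?_, aC, fun v => ?_, hdet⟩, fun v => ⟨fun h => ?_, fun h => ?_⟩⟩, ?_⟩
  · rw [hg, hg, hB]
  · rw [hg, haC]
  · have hmap : L.map (a : V →ₗ[ℝ] V) = L := by
      apply Submodule.eq_of_le_of_finrank_eq
      · rintro _ ⟨w, hw, rfl⟩
        exact hL w hw
      · exact (Submodule.equivMapOfInjective (a : V →ₗ[ℝ] V) hinj L).finrank_eq.symm
    rw [hg, ← hmap] at h
    obtain ⟨w, hw, hwv⟩ := h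
    rw [← hinj hwv]
    exact hw
  · rw [hg]; exact hL v h
  · ext v; exact hg v

/-- The adjoint of endomorphisms with respect to the real part of a Hermitian form. -/
theorem exists_adjoint (hB : HasHermitianSignature B r s) :
    ∃ τ : (V →L[ℝ] V) →ₗ[ℝ] (V →L[ℝ] V), τ 1 = 1 ∧ (∀ x y, τ (x * y) = τ y * τ x) ∧
      ∀ A v w, (B (τ A v) w).re = (B v (A w)).re := by
  obtain ⟨R, hR⟩ := exists_riesz hB
  have hnd := fun v v' => hB.ext_re (v := v) (v' := v')
  let β : V →L[ℝ] V →L[ℝ] ℝ := LinearMap.toContinuousBilinearMap (reForm B)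
  let τ : (V →L[ℝ] V) →ₗ[ℝ] (V →L[ℝ] V) :=
    { toFun := fun A => R.comp (((ContinuousLinearMap.compL ℝ V V ℝ).flip A).comp β)
      map_add' := fun A A' => ContinuousLinearMap.ext fun v => by
        change R ((β v).comp (A + A')) = R ((β v).comp A) + R ((β v).comp A')
        rw [ContinuousLinearMap.comp_add, map_add]
      map_smul' := fun c A => ContinuousLinearMap.ext fun v => by
        change R ((β v).comp (c • A)) = c • R ((β v).comp A)
        rw [ContinuousLinearMap.comp_smul, map_smul] }
  have key : ∀ A v w, (B (τ A v) w).re = (B v (A w)).re := fun A v w => hR _ w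
  refine ⟨τ, ?_, fun x y => ?_, key⟩
  · ext v
    exact hnd _ _ fun w => key 1 v w
  · ext v
    refine hnd _ _ fun w => ?_
    rw [key]
    change (B v (x (y w))).re = (B (τ y (τ x v)) w).re
    rw [key, key]

theorem eq_of_re_eq {W : Type*} [AddCommGroup W] [Module ℂ W]
    {H H' : W →ₗ⋆[ℂ] W →ₗ[ℂ] ℂ} {v w v' w' : W}
    (h : ∀ c : ℂ, (H v (c • w)).re = (H' v' (c • w')).re) : H v w = H' v' w' := by
  have h1 := h 1
  have h2 := h Complex.I
  simp only [one_smul] at h1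
  simp at h2
  exact Complex.ext h1 h2

/-- `exp A` is orthogonal for the real part of `B` if and, for small `A`, only if `A` is skew. -/
theorem exp_orthogonal (hB : HasHermitianSignature B r s) :
    (∀ A : V →L[ℝ] V, (∀ v w, (B (A v) w).re + (B v (A w)).re = 0) →
      ∀ v w, (B (exp A v) (exp A w)).re = (B v w).re) ∧
    ∀ᶠ A in 𝓝 (0 : V →L[ℝ] V),
      (∀ v w, (B ((exp A : V →L[ℝ] V) v) ((exp A : V →L[ℝ] V) w)).re = (B v w).re) →
      ∀ v w, (B (A v) w).re + (B v (A w)).re = 0 := by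
  let _ : NormedAlgebra ℚ (V →L[ℝ] V) := NormedAlgebra.restrictScalars ℚ ℝ _
  obtain ⟨τ, h1, hmul, hτ⟩ := exists_adjoint hB
  have hnd := fun v v' => hB.ext_re (v := v) (v' := v')
  have hskew : ∀ A : V →L[ℝ] V, (∀ v w, (B (A v) w).re + (B v (A w)).re = 0) ↔ τ A = -A := by
    intro A
    constructor
    · intro h
      ext v
      refine hnd _ _ fun w => ?_
      have := h v w
      rw [hτ, neg_apply, map_neg, LinearMap.neg_apply, Complex.neg_re]
      linarith
    · intro h v w
      rw [← hτ, h, neg_apply, map_neg, LinearMap.neg_apply, Complex.neg_re]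
      ring
  have hinv : ∀ A : V →L[ℝ] V, exp (-A) * exp A = 1 := fun A => by
    rw [← exp_add_of_commute (Commute.refl A).neg_left, neg_add_cancel, exp_zero]
  have hinv' : ∀ A : V →L[ℝ] V, exp A * exp (-A) = 1 := fun A => by
    simpa using hinv (-A)
  refine ⟨fun A hA v w => ?_, ?_⟩
  · rw [← hτ, map_exp_of_anti τ h1 hmul, (hskew A).mp hA]
    change (B ((exp (-A) * exp A : V →L[ℝ] V) v) w).re = _
    rw [hinv]; rfl
  · obtain ⟨O, hO, hinj⟩ := exp_injective_near_zero (𝔸 := V →L[ℝ] V)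
    have hc : Continuous τ := LinearMap.continuous_of_finiteDimensional τ
    have e1 : ∀ᶠ A in 𝓝 (0 : V →L[ℝ] V), τ A ∈ O :=
      hc.continuousAt.preimage_mem_nhds (by rwa [map_zero])
    have e2 : ∀ᶠ A in 𝓝 (0 : V →L[ℝ] V), -A ∈ O :=
      continuous_neg.continuousAt.preimage_mem_nhds (by rwa [neg_zero])
    filter_upwards [e1, e2] with A hA1 hA2 h
    rw [hskew]
    apply hinj hA1 hA2
    have h3 : τ (exp A) * exp A = 1 := by
      ext v
      refine hnd _ _ fun w => ?_
      change (B (τ (exp A) (exp A v)) w).re = _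
      rw [hτ, h]; rfl
    rw [← map_exp_of_anti τ h1 hmul]
    calc τ (exp A) = τ (exp A) * (exp A * exp (-A)) := by rw [hinv', mul_one]
      _ = exp (-A) := by rw [← mul_assoc, h3, one_mul]

theorem exp_mem_suStabilizer (hB : HasHermitianSignature B r s) {A : V →L[ℝ] V}
    (hA : A ∈ suStabilizerAlgebra B L) : exp A ∈ endSet (suStabilizer B L) := by
  have hI := su_comm_I hA.1
  have hexp := exp_comm_I hI
  obtain ⟨⟨hsk, AC, hAC, htr⟩, hAL⟩ := hA
  refine mem_endSet_suStabilizer (aC := complexify (exp A : V →L[ℝ] V) hexp) (fun v w => ?_)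
    (fun v => rfl) ?_ fun v hv => ?_
  · refine eq_of_re_eq fun c => ?_
    let eC : V →ₗ[ℂ] V := complexify (exp A : V →L[ℝ] V) hexp
    have h1 : c • exp A w = exp A (c • w) := (eC.map_smul c w).symm
    rw [h1]
    refine (exp_orthogonal hB).1 A (fun v w => ?_) v (c • w)
    rw [← Complex.add_re, hsk]; rfl
  · rw [← detOn_eq (Module.finBasis ℂ V) (A := exp A) (fun v => rfl), detOn_exp _ hAC, htr,
      Complex.exp_zero]
  · have h1 : exp A - 1 ∈ lineStabilizerAlgebra L :=
      exp_sub_one_mem (N := lineStabilizerAlgebra L) (fun x hx y hy v hv => hx _ (hy v hv)) hAL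
    have h2 := L.add_mem (h1 v hv) hv
    simpa using h2

/-- Near `0`, only the elements of its Lie algebra have an exponential in the stabilizer of `L`. -/
theorem eventually_mem_suStabilizerAlgebra (hB : HasHermitianSignature B r s) (L : Submodule ℝ V) :
    ∀ᶠ A in 𝓝 (0 : V →L[ℝ] V), exp A ∈ endSet (suStabilizer B L) → A ∈ suStabilizerAlgebra B L := by
  -- `exp (tr A) = 1` means `tr A ∈ 2πiℤ`
  have htrace : ∀ᶠ A in 𝓝 (0 : V →L[ℝ] V), ∀ AC : V →ₗ[ℂ] V, (∀ v, AC v = A v) →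
      Complex.exp (LinearMap.trace ℂ V AC) = 1 → LinearMap.trace ℂ V AC = 0 := by
    let b := Module.finBasis ℂ V
    let t : (V →L[ℝ] V) → ℂ := fun A => ∑ i, b.repr (A (b i)) i
    have ht : Continuous t := by
      refine continuous_finsetSum _ fun i _ => ?_
      exact (LinearMap.continuous_of_finiteDimensional ((b.coord i).restrictScalars ℝ)).comp
        (ContinuousLinearMap.apply ℝ V (b i)).continuous
    have ht0 : t 0 = 0 := by simp [t]
    have h1 : ∀ᶠ A in 𝓝 (0 : V →L[ℝ] V), ‖t A‖ < 1 := by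
      have : Continuous fun A => ‖t A‖ := ht.norm
      exact this.continuousAt.eventually_lt continuousAt_const (by rw [ht0]; simp)
    filter_upwards [h1] with A hA AC hAC hexp
    have h2 : LinearMap.trace ℂ V AC = t A := by
      rw [LinearMap.trace_eq_matrix_trace ℂ b]
      simp [Matrix.trace, LinearMap.toMatrix_apply, t, hAC]
    rw [h2] at hexp ⊢
    obtain ⟨n, hn⟩ := Complex.exp_eq_one_iff.mp hexp
    rw [hn] at hA ⊢
    rcases eq_or_ne n 0 with rfl | h0
    · simp
    · exfalso
      have h3 : (1 : ℝ) ≤ |(n : ℝ)| := by exact_mod_cast Int.one_le_abs h0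
      rw [norm_mul, Complex.norm_intCast] at hA
      have h4 : ‖(2 * Real.pi * Complex.I : ℂ)‖ = 2 * Real.pi := by
        simp [abs_of_pos Real.pi_pos]
      rw [h4] at hA
      nlinarith [Real.pi_gt_three]
  filter_upwards [(exp_orthogonal hB).2, eventually_mem_of_exp_sub_one_mem mul_mem_complexEnd, htrace,
    eventually_mem_of_exp_sub_one_mem (N := lineStabilizerAlgebra L)
      (fun x hx y hy v hv => hx _ (hy v hv))] with A h1 h2 h3 h4 hA
  have hAL := apply_mem_iff_of_mem_endSet hA
  obtain ⟨g, ⟨⟨hgB, gC, hgC, hdet⟩, -⟩, hgA⟩ := hA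
  have hgA' : ∀ v, g v = exp A v := fun v => congrArg (fun f : V →L[ℝ] V => f v) hgA
  have hI : ∀ v, A (Complex.I • v) = Complex.I • A v := h2 fun v => by
    change exp A (Complex.I • v) - Complex.I • v = Complex.I • (exp A v - v)
    rw [← hgA', ← hgA', ← hgC, ← hgC, map_smul, smul_sub]
  have hsk := h1 fun v w => by rw [← hgA', ← hgA', hgB]
  refine ⟨⟨fun v w => ?_, complexify (A : V →ₗ[ℝ] V) hI, fun v => rfl, ?_⟩, ?_⟩
  · have : B (A v) w = B (-v) (A w) := by
      refine eq_of_re_eq fun c => ?_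
      have h5 : c • A w = A (c • w) := ((complexify (W := V) (A : V →ₗ[ℝ] V) hI).map_smul c w).symm
      have h6 := hsk v (c • w)
      rw [h5, map_neg, LinearMap.neg_apply, Complex.neg_re]
      linarith
    rw [this, map_neg, LinearMap.neg_apply, neg_add_cancel]
  · refine h3 _ (fun v => rfl) ?_
    rw [← detOn_exp (Module.finBasis ℂ V) (A := A) (fun v => rfl), detOn_eq _ (AC := gC), hdet]
    intro v
    rw [hgC, hgA']
  · refine h4 fun v hv => ?_
    change exp A v - v ∈ L
    exact L.sub_mem ((hAL v).mpr hv) hv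

end Group

/-! ### Smoothness of operator valued maps -/

section OperatorValued

variable {V G : Type*} [NormedAddCommGroup V] [NormedSpace ℝ V] [FiniteDimensional ℝ V]
  [NormedAddCommGroup G] [NormedSpace ℝ G]

variable (V G) in
/-- A linear map on a finite dimensional space depends linearly and continuously on its values on
a basis. -/
theorem exists_clm_of_basis_values : ∃ Φ : (Fin (Module.finrank ℝ V) → G) →L[ℝ] (V →L[ℝ] G),
    ∀ A : V →L[ℝ] G, Φ (fun i => A (Module.finBasis ℝ V i)) = A := by
  let b := Module.finBasis ℝ V
  let c : Fin (Module.finrank ℝ V) → (V →L[ℝ] ℝ) := fun i =>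
    LinearMap.toContinuousLinearMap (b.coord i)
  refine ⟨∑ i, (ContinuousLinearMap.smulRightL ℝ V G (c i)).comp
    (ContinuousLinearMap.proj i), fun A => ?_⟩
  ext v
  conv_rhs => rw [← b.sum_repr v]
  simp only [sum_apply, map_sum, map_smul]
  rfl

theorem contDiffAt_clm_of_apply {E : Type*} [NormedAddCommGroup E] [NormedSpace ℝ E]
    {f : E → V →L[ℝ] G} {y : E} {k : WithTop ℕ∞} (h : ∀ v, ContDiffAt ℝ k (fun y => f y v) y) :
    ContDiffAt ℝ k f y := by
  obtain ⟨Φ, hΦ⟩ := exists_clm_of_basis_values V G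
  have := Φ.contDiff.contDiffAt.comp y
    (contDiffAt_pi.mpr fun i => h (Module.finBasis ℝ V i))
  refine this.congr_of_eventuallyEq (Eventually.of_forall fun z => (hΦ (f z)).symm)

theorem contMDiffWithinAt_clm_of_apply {E : Type*} [NormedAddCommGroup E] [NormedSpace ℝ E]
    {H : Type*} [TopologicalSpace H] {I : ModelWithCorners ℝ E H}
    {X : Type*} [TopologicalSpace X] [ChartedSpace H X]
    {f : X → V →L[ℝ] G} {s : Set X} {x : X} {k : WithTop ℕ∞}
    (h : ∀ v, ContMDiffWithinAt I 𝓘(ℝ, G) k (fun y => f y v) s x) :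
    ContMDiffWithinAt I 𝓘(ℝ, V →L[ℝ] G) k f s x := by
  obtain ⟨Φ, hΦ⟩ := exists_clm_of_basis_values V G
  have := Φ.contMDiff.contMDiffAt.comp_contMDiffWithinAt x
    (contMDiffWithinAt_pi_space.mpr fun i => h (Module.finBasis ℝ V i))
  exact this.congr (fun z _ => (hΦ (f z)).symm) (hΦ (f x)).symm

end OperatorValued

/-! ### Smooth extension of adapted frames -/

/-- The value of the Hermitian extension on the images of a complex linear isometry. -/
theorem hermitianExtension_map {V : Type*} [AddCommGroup V] [Module ℂ V]
    {B : V →ₗ⋆[ℂ] V →ₗ[ℂ] ℂ} {W : Type*} {h : W → W → ℝ} {J : W → W} {U : V → W}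
    (hUI : ∀ v, U (Complex.I • v) = J (U v)) (hU : ∀ v w, h (U v) (U w) = (B v w).re) (v w : V) :
    hermitianExtension h J (U v) (U w) = B v w := by
  rw [hermitianExtension, ← hUI, hU, hU]
  apply Complex.ext <;> simp

theorem det_gram_ne_zero {V : Type*} [NormedAddCommGroup V] [NormedSpace ℂ V]
    {B : V →ₗ⋆[ℂ] V →ₗ[ℂ] ℂ} {r s m : ℕ} (hB : HasHermitianSignature B r s)
    (b : Module.Basis (Fin m) ℂ V) : (Matrix.of fun i j => B (b i) (b j)).det ≠ 0 := by
  intro h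
  obtain ⟨c, hc, h0⟩ := Matrix.exists_mulVec_eq_zero_iff.mpr h
  have hv : ∑ j, c j • b j = 0 := by
    refine hB.nondegenerate _ trivial fun w _ => ?_
    have : ∀ i, B (b i) (∑ j, c j • b j) = 0 := by
      intro i
      have := congrFun h0 i
      simp only [Matrix.mulVec, dotProduct, Matrix.of_apply, Pi.zero_apply] at this
      simp only [map_sum, map_smul, smul_eq_mul]
      rw [← this]
      exact Finset.sum_congr rfl fun j _ => mul_comm _ _
    generalize ∑ j, c j • b j = v at this ⊢
    rw [hB.symm, ← b.sum_repr w]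
    simp only [map_sum, LinearMap.sum_apply, LinearMap.map_smulₛₗ, LinearMap.smul_apply, this,
      smul_zero, Finset.sum_const_zero, map_zero]
  exact hc (funext fun j => Fintype.linearIndependent_iff.mp b.linearIndependent c hv j)

section Extension

open NormedSpace

variable {V : Type*} [NormedAddCommGroup V] [NormedSpace ℂ V] [FiniteDimensional ℂ V]
  {B : V →ₗ⋆[ℂ] V →ₗ[ℂ] ℂ} {r s : ℕ}
  {E : Type*} [NormedAddCommGroup E] [NormedSpace ℝ E]
  {F : Type*} [NormedAddCommGroup F] [NormedSpace ℝ F]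

/-- A null vector `v` has a partner `w` with `⟨v, w⟩ = 1`, and in dimension at least three it is
orthogonal to a vector of squared length `±1`. -/
theorem exists_partner (hB : HasHermitianSignature B r s) (h3 : 3 ≤ r + s) {v : V} (hv0 : v ≠ 0)
    (hv : B v v = 0) : ∃ (w u : V) (ε : ℝ), B v w = 1 ∧ B v u = 0 ∧ (ε = 1 ∨ ε = -1) ∧
      B u u = ε := by
  obtain ⟨k, e, ε, he, e0, e1, rfl⟩ :=
    exists_isOrthonormalFamily_of_null hB.symm hB.nondegenerate hv0 hv
  have hk : k + 2 = r + s := by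
    rw [← hB.finrank, Module.finrank_eq_card_basis he.basis, Fintype.card_fin]
  let i2 : Fin (k + 2) := ⟨2, by omega⟩
  have h02 : (0 : Fin (k + 2)) ≠ i2 := by simp [i2, Fin.ext_iff]
  have h12 : (1 : Fin (k + 2)) ≠ i2 := by simp [i2, Fin.ext_iff]
  have h01 : (0 : Fin (k + 2)) ≠ 1 := by simp
  refine ⟨(2⁻¹ : ℂ) • (e 0 - e 1), e i2, ε i2, ?_, ?_, he.sign i2, ?_⟩
  · simp only [map_smul, map_sub, map_add, LinearMap.add_apply, he.gram, e0, e1, h01, h01.symm]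
    norm_num
  · simp [he.gram, h02, h12]
  · simp [he.gram]

theorem exists_equiv_of_bijective {W : Type*} [NormedAddCommGroup W] [NormedSpace ℝ W]
    {A : V →L[ℝ] W} (hA : Function.Bijective A) :
    ∃ A' : V ≃L[ℝ] W, (A' : V →L[ℝ] W) = A := by
  have : FiniteDimensional ℝ W := Module.Finite.of_surjective (A : V →ₗ[ℝ] W) hA.2
  exact ⟨(LinearEquiv.ofBijective (A : V →ₗ[ℝ] W) hA).toContinuousLinearEquiv, by ext; rfl⟩

/-- A complex linear map `U₀` with `U₀ v₀ = σ(y₀)` is extended to complex linear maps with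
`U y v₀ = σ y`: its complex linear part with respect to `J y` is corrected by a multiple of
`⟨w₀, ·⟩`, where `⟨w₀, v₀⟩ = 1`. -/
theorem extend_complexLinear {J : E → F →L[ℝ] F} {σ : E → F} {y₀ : E} {U₀ : V →L[ℝ] F} {v₀ w₀ : V}
    (hv : B w₀ v₀ = 1) (hJ : ∀ᶠ y in 𝓝 y₀, ContDiffAt ℝ ∞ J y)
    (hσ : ∀ᶠ y in 𝓝 y₀, ContDiffAt ℝ ∞ σ y) (hJ2 : ∀ v, J y₀ (J y₀ v) = -v)
    (hU : ∀ v, U₀ (Complex.I • v) = J y₀ (U₀ v)) (hUv : U₀ v₀ = σ y₀) :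
    ∃ U : E → V →L[ℝ] F, U y₀ = U₀ ∧ ∀ᶠ y in 𝓝 y₀, ContDiffAt ℝ ∞ U y ∧
      ((∀ v, J y (J y v) = -v) → (∀ v, U y (Complex.I • v) = J y (U y v)) ∧ U y v₀ = σ y) := by
  -- the part of `U₀` which is complex linear with respect to `J y`
  let U₁ : E → V →L[ℝ] F := fun y =>
    (2⁻¹ : ℝ) • (U₀ - (J y).comp (U₀.comp (mulI V)))
  let lre : V →L[ℝ] ℝ := LinearMap.toContinuousLinearMap (Complex.reLm.comp
    ((B w₀).restrictScalars ℝ))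
  let lim : V →L[ℝ] ℝ := LinearMap.toContinuousLinearMap (Complex.imLm.comp
    ((B w₀).restrictScalars ℝ))
  let U : E → V →L[ℝ] F := fun y => U₁ y + lre.smulRight (σ y - U₁ y v₀) +
    lim.smulRight (J y (σ y - U₁ y v₀))
  have hre : ∀ v, lre v = (B w₀ v).re := fun v => rfl
  have him : ∀ v, lim v = (B w₀ v).im := fun v => rfl
  have hU₁ : ∀ y v, U₁ y v = (2⁻¹ : ℝ) • (U₀ v - J y (U₀ (Complex.I • v))) := fun y v => rfl
  have hUy : ∀ y v, U y v = U₁ y v + (B w₀ v).re • (σ y - U₁ y v₀) +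
    (B w₀ v).im • J y (σ y - U₁ y v₀) := fun y v => rfl
  have hy₀ : ∀ v, U₁ y₀ v = U₀ v := by
    intro v
    rw [hU₁, hU, hJ2]
    module
  refine ⟨U, ?_, ?_⟩
  · ext v
    rw [hUy, hy₀, hy₀, hUv]
    simp
  · filter_upwards [hJ, hσ] with y h1 h2
    have c1 : ContDiffAt ℝ ∞ U₁ y :=
      (contDiffAt_const.sub (h1.clm_comp contDiffAt_const)).const_smul _
    have c2 : ContDiffAt ℝ ∞ (fun y => σ y - U₁ y v₀) y :=
      h2.sub (c1.clm_apply contDiffAt_const)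
    refine ⟨(c1.add (contDiffAt_const.smulRight c2)).add
      (contDiffAt_const.smulRight (h1.clm_apply c2)), fun hJy => ⟨fun v => ?_, ?_⟩⟩
    · have e1 : U₁ y (Complex.I • v) = J y (U₁ y v) := by
        have : (Complex.I • Complex.I • v) = -v := by
          rw [smul_smul, Complex.I_mul_I, neg_one_smul]
        rw [hU₁, hU₁, this]
        simp only [map_smul, map_sub, hJy, map_neg]
        module
      have e2 : (B w₀ (Complex.I • v)).re = -(B w₀ v).im := by simp
      have e3 : (B w₀ (Complex.I • v)).im = (B w₀ v).re := by simp
      rw [hUy, hUy, e1, e2, e3]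
      simp only [map_add, map_smul, hJy]
      module
    · rw [hUy, hv]
      simp

/-- A complex linear frame which maps `v₀` to a null vector is modified such that it respects the
inner products with `v₀`: it is composed with a map `v ↦ v + λ(v) w₀`, where `⟨v₀, w₀⟩ = 1` and
`λ(v₀) = 0`. -/
theorem extend_pairing {h : E → F →L[ℝ] F →L[ℝ] ℝ} {J : E → F →L[ℝ] F} {U : E → V →L[ℝ] F} {y₀ : E}
    {v₀ w₀ : V} (hvw : B v₀ w₀ = 1) (hvv : B v₀ v₀ = 0)
    (hh : ∀ᶠ y in 𝓝 y₀, ContDiffAt ℝ ∞ h y) (hU : ∀ᶠ y in 𝓝 y₀, ContDiffAt ℝ ∞ U y)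
    (hy₀ : ∀ v w, h y₀ (U y₀ v) (U y₀ w) = (B v w).re) :
    ∃ U' : E → V →L[ℝ] F, U' y₀ = U y₀ ∧ ∀ᶠ y in 𝓝 y₀, ContDiffAt ℝ ∞ U' y ∧
      ((∀ v, J y (J y v) = -v) → (∀ v w, h y v w = h y w v) →
        (∀ v w, h y (J y v) (J y w) = h y v w) →
        (∀ v, U y (Complex.I • v) = J y (U y v)) → h y (U y v₀) (U y v₀) = 0 →
        (∀ v, U' y (Complex.I • v) = J y (U' y v)) ∧ U' y v₀ = U y v₀ ∧
        ∀ v, h y (U' y v₀) (U' y v) = (B v₀ v).re) := by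
  let β : V →L[ℝ] ℂ := LinearMap.toContinuousLinearMap ((B v₀).restrictScalars ℝ)
  let g : E → V →L[ℝ] ℝ := fun y => (h y (U y v₀)).comp (U y)
  -- the defect `B(v₀, ·) - H(v₀, ·)`, where `H` is the Hermitian form pulled back by `U y`
  let c : E → V →L[ℝ] ℂ := fun y => β - Complex.ofRealCLM.comp (g y) +
    Complex.I • Complex.ofRealCLM.comp ((g y).comp (mulI V))
  -- `d = H(v₀, w₀)`, so that adding `d⁻¹ c(v) w₀` to `v` removes the defect
  let d : E → ℂ := fun y => 1 - c y w₀
  let κ : ℂ →L[ℝ] V := (ContinuousLinearMap.toSpanSingleton ℂ w₀).restrictScalars ℝ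
  let U' : E → V →L[ℝ] F := fun y => (U y).comp (ContinuousLinearMap.id ℝ V +
    κ.comp (((ContinuousLinearMap.mul ℝ ℂ) (d y)⁻¹).comp (c y)))
  have hc : ∀ y v, c y v = B v₀ v - h y (U y v₀) (U y v) +
    Complex.I * h y (U y v₀) (U y (Complex.I • v)) := fun y v => rfl
  have hU' : ∀ y v, U' y v = U y (v + ((d y)⁻¹ * c y v) • w₀) := fun y v => rfl
  have hc₀ : ∀ v, c y₀ v = 0 := by
    intro v
    rw [hc, hy₀, hy₀]
    apply Complex.ext <;> simp
  have hd₀ : d y₀ = 1 := by simp only [d, hc₀, sub_zero]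
  have cg : ∀ᶠ y in 𝓝 y₀, ContDiffAt ℝ ∞ c y := by
    filter_upwards [hh, hU] with y h1 h2
    have hg : ContDiffAt ℝ ∞ g y := (h1.clm_apply (h2.clm_apply contDiffAt_const)).clm_comp h2
    exact (contDiffAt_const.sub (contDiffAt_const.clm_comp hg)).add
      ((contDiffAt_const.clm_comp (hg.clm_comp contDiffAt_const)).const_smul _)
  have cd : ∀ y, ContDiffAt ℝ ∞ c y → ContDiffAt ℝ ∞ d y := fun y h1 =>
    contDiffAt_const.sub (h1.clm_apply contDiffAt_const)
  have hd : ∀ᶠ y in 𝓝 y₀, d y ≠ 0 :=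
    (cd _ cg.self_of_nhds).continuousAt.eventually_ne (by rw [hd₀]; exact one_ne_zero)
  refine ⟨U', ?_, ?_⟩
  · ext v
    rw [hU', hc₀]
    simp
  · filter_upwards [hU, cg, hd] with y h2 h3 h4
    refine ⟨h2.clm_comp (contDiffAt_const.add (contDiffAt_const.clm_comp (ContDiffAt.clm_comp
      (contDiffAt_const.clm_apply ((cd y h3).inv h4)) h3))), fun hJ hs ho hUJ hnull => ?_⟩
    have hxJ : ∀ x, h y x (J y x) = 0 := by
      intro x
      have h5 := ho x (J y x)
      rw [hJ, map_neg, hs] at h5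
      linarith
    have hcv₀ : c y v₀ = 0 := by
      rw [hc, hUJ, hxJ, hnull, hvv]
      simp
    have hcI : ∀ v, c y (Complex.I • v) = Complex.I * c y v := by
      intro v
      rw [hc, hc]
      simp only [hUJ, hJ, map_neg, map_smul, smul_eq_mul]
      push_cast
      linear_combination (-(h y (U y v₀) (J y (U y v)) : ℂ)) * Complex.I_mul_I
    have hv₀ : U' y v₀ = U y v₀ := by
      rw [hU', hcv₀]
      simp
    refine ⟨fun v => ?_, hv₀, fun v => ?_⟩
    · rw [hU', hU', hcI, ← hUJ, smul_add, smul_smul, mul_left_comm]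
    · rw [hv₀, hU', map_add, map_add]
      set z := (d y)⁻¹ * c y v with hz
      have hzd : z * d y = c y v := by rw [hz]; field_simp
      have hzw : z • w₀ = z.re • w₀ + z.im • Complex.I • w₀ := by
        conv_lhs => rw [← Complex.re_add_im z]
        rw [add_smul, mul_smul]; rfl
      have e1 : d y = h y (U y v₀) (U y w₀) - Complex.I * h y (U y v₀) (J y (U y w₀)) := by
        change 1 - c y w₀ = _
        rw [hc, hvw, hUJ]
        ring
      have e2 := congrArg Complex.re hzd
      rw [e1, hc] at e2
      simp at e2
      rw [hzw]
      simp only [map_add, map_smul, hUJ, smul_eq_mul]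
      linarith

/-- Near zero, only the fixed points of a linear antiautomorphism have an exponential which is
fixed. -/
theorem eventually_fixed_of_exp_fixed {𝔸 : Type*} [NormedRing 𝔸] [NormedAlgebra ℝ 𝔸]
    [FiniteDimensional ℝ 𝔸] (τ : 𝔸 →ₗ[ℝ] 𝔸) (h1 : τ 1 = 1) (hmul : ∀ x y, τ (x * y) = τ y * τ x) :
    ∀ᶠ A in 𝓝 (0 : 𝔸), τ (exp A) = exp A → τ A = A := by
  have : CompleteSpace 𝔸 := FiniteDimensional.complete ℝ 𝔸
  obtain ⟨O, hO, hinj⟩ := exp_injective_near_zero (𝔸 := 𝔸)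
  have hc : Continuous τ := LinearMap.continuous_of_finiteDimensional τ
  have e1 : ∀ᶠ A in 𝓝 (0 : 𝔸), τ A ∈ O :=
    hc.continuousAt.preimage_mem_nhds (by rwa [map_zero])
  filter_upwards [e1, hO] with A hA1 hA2 h
  exact hinj hA1 hA2 (by rw [← map_exp_of_anti τ h1 hmul, h])

/-- A frame which is complex linear is made orthogonal by composition with the inverse square root
of the endomorphism which represents the pulled back metric. -/
theorem extend_orthogonal (hB : HasHermitianSignature B r s)
    {h : E → F →L[ℝ] F →L[ℝ] ℝ} {J : E → F →L[ℝ] F} {U : E → V →L[ℝ] F} {y₀ : E} {v₀ : V}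
    (hh : ∀ᶠ y in 𝓝 y₀, ContDiffAt ℝ ∞ h y) (hU : ∀ᶠ y in 𝓝 y₀, ContDiffAt ℝ ∞ U y)
    (hy₀ : ∀ v w, h y₀ (U y₀ v) (U y₀ w) = (B v w).re) :
    ∃ U' : E → V →L[ℝ] F, U' y₀ = U y₀ ∧ ∀ᶠ y in 𝓝 y₀, ContDiffAt ℝ ∞ U' y ∧
      ((∀ v, J y (J y v) = -v) → (∀ v w, h y v w = h y w v) →
        (∀ v w, h y (J y v) (J y w) = h y v w) →
        (∀ v, U y (Complex.I • v) = J y (U y v)) → (∀ v, h y (U y v₀) (U y v) = (B v₀ v).re) →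
        (∀ v, U' y (Complex.I • v) = J y (U' y v)) ∧ U' y v₀ = U y v₀ ∧
        ∀ v w, h y (U' y v) (U' y w) = (B v w).re) := by
  let _ : NormedAlgebra ℚ (V →L[ℝ] V) := NormedAlgebra.restrictScalars ℚ ℝ _
  have hnd := fun v v' => hB.ext_re (v := v) (v' := v')
  obtain ⟨R, hR⟩ := exists_riesz hB
  obtain ⟨τ, τ1, τmul, hτ⟩ := exists_adjoint hB
  -- `P y` represents the metric pulled back by `U y`, and `U y ∘ P⁻¹ᐟ²` is orthogonal
  let P : E → V →L[ℝ] V := fun y =>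
    R.comp (((ContinuousLinearMap.compL ℝ V F ℝ).flip (U y)).comp ((h y).comp (U y)))
  have hP : ∀ y v w, (B (P y v) w).re = h y (U y v) (U y w) := fun y v w => hR _ w
  have hP₀ : P y₀ = 1 := by
    ext v
    exact hnd _ _ fun w => by rw [hP, hy₀]; rfl
  have cP : ∀ᶠ y in 𝓝 y₀, ContDiffAt ℝ ∞ P y := by
    filter_upwards [hh, hU] with y h1 h2
    refine contDiffAt_clm_of_apply fun v => ?_
    have c1 : ContDiffAt ℝ ∞ (fun y => (h y (U y v)).comp (U y)) y :=
      (h1.clm_apply (h2.clm_apply contDiffAt_const)).clm_comp h2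
    exact contDiffAt_const.clm_apply c1
  obtain ⟨φ, h0, -, hφ, -, hφs⟩ := exists_local_diffeo (univ_mem (f := 𝓝 (0 : V →L[ℝ] V)))
    (Eventually.of_forall fun y => (contDiff_exp (𝔸 := V →L[ℝ] V)).contDiffAt)
    (ContinuousLinearEquiv.refl ℝ (V →L[ℝ] V)) hasFDerivAt_exp_zero
  have hφ0 : φ 0 = 1 := by rw [hφ, exp_zero]
  have h1t : (1 : V →L[ℝ] V) ∈ φ.target := hφ0 ▸ φ.map_source h0
  have hPt : ∀ᶠ y in 𝓝 y₀, P y ∈ φ.target := by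
    apply cP.self_of_nhds.continuousAt.preimage_mem_nhds
    rw [hP₀]
    exact φ.open_target.mem_nhds h1t
  let X : E → V →L[ℝ] V := fun y => φ.symm (P y)
  have hX₀ : X y₀ = 0 := by
    change φ.symm (P y₀) = 0
    rw [hP₀, ← hφ0, φ.left_inv h0]
  have cX : ∀ᶠ y in 𝓝 y₀, ContDiffAt ℝ ∞ X y := by
    filter_upwards [cP, hPt] with y h1 h2
    exact (hφs.contDiffAt (φ.open_target.mem_nhds h2)).comp y h1
  have hXlim : Tendsto X (𝓝 y₀) (𝓝 0) := by
    rw [← hX₀]; exact cX.self_of_nhds.continuousAt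
  -- the logarithm `X` of `P` inherits from `P` that it is complex linear and self-adjoint, and
  -- it annihilates `v₀`
  let N₂ : Submodule ℝ (V →L[ℝ] V) :=
    { carrier := {A | A v₀ = 0}
      zero_mem' := rfl
      add_mem' := fun {a b} ha hb => by
        change a v₀ + b v₀ = 0
        rw [show a v₀ = 0 from ha, show b v₀ = 0 from hb, add_zero]
      smul_mem' := fun c a ha => by
        change c • a v₀ = 0
        rw [show a v₀ = 0 from ha, smul_zero] }
  have hN₂ : ∀ x ∈ N₂, ∀ y ∈ N₂, x * y ∈ N₂ := fun x hx y hy => by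
    change x (y v₀) = 0
    rw [show y v₀ = 0 from hy, map_zero]
  let Y : E → V →L[ℝ] V := fun y => (-2⁻¹ : ℝ) • X y
  refine ⟨fun y => (U y).comp (exp (Y y)), ?_, ?_⟩
  · simp only [Y, hX₀, smul_zero, exp_zero]
    rfl
  · filter_upwards [hU, cX, hPt, hXlim.eventually (eventually_mem_of_exp_sub_one_mem mul_mem_complexEnd),
      hXlim.eventually (eventually_mem_of_exp_sub_one_mem hN₂),
      hXlim.eventually (eventually_fixed_of_exp_fixed τ τ1 τmul)] with y h2 h3 hPy hX1 hX2 hX3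
    refine ⟨h2.clm_comp (contDiff_exp.contDiffAt.comp y (h3.const_smul _)),
      fun hJ hs ho hUJ hv₀ => ?_⟩
    have hexp : exp (X y) = P y := by
      have := φ.right_inv hPy
      rwa [hφ] at this
    have hPI : ∀ v, P y (Complex.I • v) = Complex.I • P y v := by
      intro v
      refine hnd _ _ fun w => ?_
      have e1 : (B (Complex.I • P y v) w).re = -(B (P y v) (Complex.I • w)).re := by simp
      rw [e1, hP, hP, hUJ, hUJ]
      have := ho (J y (U y v)) (U y w)
      rw [hJ, map_neg] at this
      exact this.symm
    have hPv : P y v₀ = v₀ := hnd _ _ fun w => by rw [hP, hv₀]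
    have hPτ : τ (P y) = P y := by
      ext v
      refine hnd _ _ fun w => ?_
      rw [hτ, hB.symm, Complex.conj_re, hP, hP, hs]
    have hXI : X y ∈ complexEnd V := hX1 fun v => by
      rw [hexp]
      change P y (Complex.I • v) - Complex.I • v = Complex.I • (P y v - v)
      rw [hPI, smul_sub]
    have hXv : X y ∈ N₂ := hX2 (by
      rw [hexp]
      change P y v₀ - v₀ = 0
      rw [hPv, sub_self])
    have hXτ : τ (X y) = X y := hX3 (by rw [hexp, hPτ])
    have hYτ : τ (exp (Y y)) = exp (Y y) := by
      rw [map_exp_of_anti τ τ1 τmul]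
      simp only [Y, map_smul, hXτ]
    have hYI := exp_comm_I ((complexEnd V).smul_mem (-2⁻¹ : ℝ) hXI)
    have hYv : exp (Y y) v₀ = v₀ := by
      have : exp (Y y) - 1 ∈ N₂ := exp_sub_one_mem hN₂ (N₂.smul_mem (-2⁻¹ : ℝ) hXv)
      exact sub_eq_zero.mp this
    have hYP : exp (Y y) * (P y * exp (Y y)) = 1 := by
      have c1 : Commute (X y) (Y y) := (Commute.refl _).smul_right _
      rw [← hexp, ← exp_add_of_commute c1,
        ← exp_add_of_commute (c1.symm.add_right (Commute.refl (Y y)))]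
      have : Y y + (X y + Y y) = 0 := by
        simp only [Y]; module
      rw [this, exp_zero]
    refine ⟨fun v => ?_, ?_, fun v w => ?_⟩
    · change U y (exp (Y y) (Complex.I • v)) = J y (U y (exp (Y y) v))
      rw [hYI, hUJ]
    · change U y (exp (Y y) v₀) = _
      rw [hYv]
    · change h y (U y (exp (Y y) v)) (U y (exp (Y y) w)) = _
      rw [← hP, ← hτ, hYτ]
      exact congrArg (fun A : V →L[ℝ] V => (B (A v) w).re) hYP

/-- A frame which is complex linear and orthogonal is modified by a rotation in the direction of
`u` such that it maps a given volume element to the prescribed one. -/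
theorem extend_determinant (hB : HasHermitianSignature B r s) {m : ℕ}
    (b : Module.Basis (Fin m) ℂ V)
    {h : E → F →L[ℝ] F →L[ℝ] ℝ} {J : E → F →L[ℝ] F} {U : E → V →L[ℝ] F} {e : Fin m → E → F}
    {y₀ : E} {v₀ u : V} {ε : ℝ} {c₀ : ℂ} (hvu : B v₀ u = 0) (hε : ε = 1 ∨ ε = -1) (hu : B u u = ε)
    (hc₀ : c₀ ≠ 0) (hU : ∀ᶠ y in 𝓝 y₀, ContDiffAt ℝ ∞ U y)
    (he : ∀ i, ∀ᶠ y in 𝓝 y₀, ContDiffAt ℝ ∞ (e i) y)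
    (hbij : Function.Bijective (U y₀)) (hUI₀ : ∀ v, U y₀ (Complex.I • v) = J y₀ (U y₀ v))
    (hUh₀ : ∀ v w, h y₀ (U y₀ v) (U y₀ w) = (B v w).re)
    (hdet₀ : (Matrix.of fun i j =>
        hermitianExtension (fun v w => h y₀ v w) (J y₀) (e i y₀) (e j y₀)).det =
      starRingEnd ℂ c₀ * c₀ * (Matrix.of fun i j => B (b i) (b j)).det) :
    ∃ U' : E → V →L[ℝ] F, ∀ᶠ y in 𝓝 y₀, ContDiffAt ℝ ∞ U' y ∧
      Function.Bijective (U' y) ∧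
      ((∀ v, U y (Complex.I • v) = J y (U y v)) → (∀ v w, h y (U y v) (U y w) = (B v w).re) →
        (Matrix.of fun i j => hermitianExtension (fun v w => h y v w) (J y) (e i y) (e j y)).det =
          starRingEnd ℂ c₀ * c₀ * (Matrix.of fun i j => B (b i) (b j)).det →
        (∀ v, U' y (Complex.I • v) = J y (U' y v)) ∧ U' y v₀ = U y v₀ ∧
        (∀ v w, h y (U' y v) (U' y w) = (B v w).re) ∧
        b.det (fun i => (U' y).inverse (e i y)) = c₀) := by
  have hcV : CompleteSpace V := FiniteDimensional.complete ℝ V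
  have hnear : ∀ U' : E → V →L[ℝ] F, ContinuousAt U' y₀ → Function.Bijective (U' y₀) →
      ∀ᶠ y in 𝓝 y₀, ∃ A' : V ≃L[ℝ] F, (A' : V →L[ℝ] F) = U' y := by
    intro U' h1 h2
    obtain ⟨A₁, hA₁⟩ := exists_equiv_of_bijective h2
    exact h1.eventually (p := fun A => ∃ A' : V ≃L[ℝ] F, (A' : V →L[ℝ] F) = A)
      (by rw [← hA₁]; exact A₁.nhds)
  -- the factor by which `U y` misses the volume element
  let ζ : E → ℂ := fun y => b.det (fun i => (U y).inverse (e i y)) / c₀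
  let β : V →L[ℝ] ℂ := LinearMap.toContinuousLinearMap ((B u).restrictScalars ℝ)
  let κ : ℂ →L[ℝ] V := (ContinuousLinearMap.toSpanSingleton ℂ u).restrictScalars ℝ
  -- multiplication by `ζ` on the line of `u`, and the identity on its orthogonal complement
  let D : E → V →L[ℝ] V := fun y => ContinuousLinearMap.id ℝ V +
    κ.comp (((ContinuousLinearMap.mul ℝ ℂ) ((ζ y - 1) * ε)).comp β)
  let U' : E → V →L[ℝ] F := fun y => (U y).comp (D y)
  have hD : ∀ y v, D y v = v + ((ζ y - 1) * ε * B u v) • u := fun y v => rfl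
  have hU' : ∀ y v, U' y v = U y (D y v) := fun y v => rfl
  have hεε : (ε : ℂ) * ε = 1 := by rcases hε with rfl | rfl <;> norm_num
  have hdetD : ∀ y, LinearMap.det (LinearMap.transvection (((ζ y - 1) * ε) • B u) u) = ζ y := by
    intro y
    rw [LinearMap.transvection.det]
    simp only [LinearMap.smul_apply, hu, smul_eq_mul]
    linear_combination (ζ y - 1) * hεε
  -- since the squared lengths agree, `|ζ| = 1`, so that `D` is unitary
  have hζ : ∀ y, (∃ A' : V ≃L[ℝ] F, (A' : V →L[ℝ] F) = U y) →
      (∀ v, U y (Complex.I • v) = J y (U y v)) → (∀ v w, h y (U y v) (U y w) = (B v w).re) →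
      (Matrix.of fun i j => hermitianExtension (fun v w => h y v w) (J y) (e i y) (e j y)).det =
        starRingEnd ℂ c₀ * c₀ * (Matrix.of fun i j => B (b i) (b j)).det →
      starRingEnd ℂ (ζ y) * ζ y = 1 := by
    rintro y ⟨A, hA⟩ hUI hUh hdet
    have hw : ∀ i, e i y = U y ((U y).inverse (e i y)) := by
      intro i
      rw [← hA, ContinuousLinearMap.inverse_equiv]
      exact (A.apply_symm_apply _).symm
    have e1 : (Matrix.of fun i j => hermitianExtension (fun v w => h y v w) (J y) (e i y) (e j y)) =
        Matrix.of fun i j => B ((U y).inverse (e i y)) ((U y).inverse (e j y)) := by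
      ext i j
      rw [Matrix.of_apply, Matrix.of_apply]
      conv_lhs => rw [hw i, hw j]
      exact hermitianExtension_map hUI hUh _ _
    rw [e1, det_gram_eq B b] at hdet
    have h2 := mul_right_cancel₀ (det_gram_ne_zero hB b) hdet
    have h3 : starRingEnd ℂ c₀ ≠ 0 := by simpa using hc₀
    simp only [ζ, map_div₀]
    rw [div_mul_div_comm, h2, div_self (mul_ne_zero h3 hc₀)]
  have h0 : Function.Bijective (U' y₀) := by
    have h1 := hζ y₀ (exists_equiv_of_bijective hbij) hUI₀ hUh₀ hdet₀
    have h2 : ζ y₀ ≠ 0 := by rintro h; rw [h, mul_zero] at h1; exact zero_ne_one h1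
    exact hbij.comp (LinearMap.equivOfDetNeZero _ ((hdetD y₀).trans_ne h2)).bijective
  have hUe := hnear U hU.self_of_nhds.continuousAt hbij
  have cζ : ∀ᶠ y in 𝓝 y₀, ContDiffAt ℝ ∞ ζ y := by
    filter_upwards [hU, eventually_all.mpr he, hUe] with y h1 h2 ⟨A, hA⟩
    have h3 : ContDiffAt ℝ ∞ (fun y => (U y).inverse) y := by
      have := contDiffAt_map_inverse (n := ∞) A
      rw [hA] at this
      exact this.comp y h1
    exact ((contDiff_basis_det b).contDiffAt.comp y
      (contDiffAt_pi.mpr fun i => h3.clm_apply (h2 i))).div_const _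
  have cU' : ∀ᶠ y in 𝓝 y₀, ContDiffAt ℝ ∞ U' y := by
    filter_upwards [hU, cζ] with y h1 h2
    refine h1.clm_comp (contDiffAt_const.add (contDiffAt_const.clm_comp (ContDiffAt.clm_comp
      (contDiffAt_const.clm_apply ((h2.sub contDiffAt_const).mul contDiffAt_const))
      contDiffAt_const)))
  refine ⟨U', ?_⟩
  filter_upwards [cU', hnear U' cU'.self_of_nhds.continuousAt h0, hUe] with y h1 ⟨A', hA'⟩ ⟨A, hA⟩
  refine ⟨h1, by rw [← hA']; exact A'.bijective, fun hUI hUh hdet => ?_⟩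
  replace hζ := hζ y ⟨A, hA⟩ hUI hUh hdet
  have huv : B u v₀ = 0 := by rw [hB.symm, hvu, map_zero]
  have hBD : ∀ v w, B (D y v) (D y w) = B v w := by
    intro v w
    rw [hD, hD]
    simp only [map_add, LinearMap.add_apply, LinearMap.map_smulₛₗ, map_smul, LinearMap.smul_apply,
      smul_eq_mul, hu, map_mul, map_sub, map_one, Complex.conj_ofReal, ← hB.symm v u]
    linear_combination (B v u * B u w * ε) * (hζ : _) +
      (B v u * B u w * ε * (starRingEnd ℂ (ζ y) - 1) * (ζ y - 1)) * hεε
  refine ⟨fun v => ?_, ?_, fun v w => ?_, ?_⟩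
  · rw [hU', hU', ← hUI, hD, hD, map_smul, smul_eq_mul, smul_add, smul_smul, mul_left_comm]
  · rw [hU', hD, huv]
    simp
  · rw [hU', hU', hUh, hBD]
  · have h2 : ∀ i, D y ((U' y).inverse (e i y)) = (U y).inverse (e i y) := by
      intro i
      have : U y (D y ((U' y).inverse (e i y))) = e i y := by
        rw [← hU', ← hA', ContinuousLinearMap.inverse_equiv]
        exact A'.apply_symm_apply _
      rw [← hA] at this ⊢
      rw [ContinuousLinearMap.inverse_equiv]
      exact (A.symm_apply_eq.mpr this.symm).symm
    have h3 := b.det_comp (LinearMap.transvection (((ζ y - 1) * ε) • B u) u)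
      fun i => (U' y).inverse (e i y)
    have h4 : (LinearMap.transvection (((ζ y - 1) * ε) • B u) u ∘ fun i => (U' y).inverse (e i y))
        = fun i => (U y).inverse (e i y) := funext fun i => h2 i
    have h5 : b.det (fun i => (U y).inverse (e i y)) = ζ y * c₀ := by
      simp only [ζ]; rw [div_mul_cancel₀ _ hc₀]
    have h6 : ζ y ≠ 0 := by rintro h; rw [h, mul_zero] at hζ; exact zero_ne_one hζ
    rw [h4, hdetD y, h5] at h3
    exact (mul_left_cancel₀ h6 h3).symm

/-- The data at `y` of an adapted frame problem are consistent: `J` is an orthogonal complex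
structure for the symmetric form `h`, the vector `σ` is isotropic, and the volume element
`e₁ ∧ ⋯ ∧ e_m` has the squared length of `c₀ • b₁ ∧ ⋯ ∧ b_m`. -/
structure Admissible (B : V →ₗ⋆[ℂ] V →ₗ[ℂ] ℂ) {m : ℕ} (b : Module.Basis (Fin m) ℂ V) (c₀ : ℂ)
    {W : Type*} [AddCommGroup W] (h : W → W → ℝ) (J : W → W) (σ : W) (e : Fin m → W) : Prop where
  sq : ∀ v, J (J v) = -v
  symm : ∀ v w, h v w = h w v
  orthogonal : ∀ v w, h (J v) (J w) = h v w
  null : h σ σ = 0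
  det : (Matrix.of fun i j => hermitianExtension h J (e i) (e j)).det =
    starRingEnd ℂ c₀ * c₀ * (Matrix.of fun i j => B (b i) (b j)).det

/-- A linear map `U` from `V` to `W` is an adapted frame: it is a complex linear isometry, maps
`v₀` to `σ`, and identifies `c₀ • b₁ ∧ ⋯ ∧ b_m` with `e₁ ∧ ⋯ ∧ e_m`. -/
structure Adapted (B : V →ₗ⋆[ℂ] V →ₗ[ℂ] ℂ) {m : ℕ} (b : Module.Basis (Fin m) ℂ V) (c₀ : ℂ) (v₀ : V)
    {W : Type*} (h : W → W → ℝ) (J : W → W) (σ : W) (e : Fin m → W) (U : V → W) : Prop where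
  bijective : Function.Bijective U
  complex : ∀ v, U (Complex.I • v) = J (U v)
  isometry : ∀ v w, h (U v) (U w) = (B v w).re
  line : U v₀ = σ
  det : ∀ w : Fin m → V, (∀ i, U (w i) = e i) → b.det w = c₀

/-- A complex linear isometry at one point which maps `v₀` to `σ` gives rise to a smooth family of
adapted frames at all nearby points. -/
theorem exists_adapted_extension (hB : HasHermitianSignature B r s) (h3 : 3 ≤ r + s) {m : ℕ}
    (b : Module.Basis (Fin m) ℂ V) {c₀ : ℂ} (hc₀ : c₀ ≠ 0) {v₀ : V} (hv₀ : v₀ ≠ 0)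
    (hvv : B v₀ v₀ = 0)
    {h : E → F →L[ℝ] F →L[ℝ] ℝ} {J : E → F →L[ℝ] F} {σ : E → F} {e : Fin m → E → F} {y₀ : E}
    (hh : ∀ᶠ y in 𝓝 y₀, ContDiffAt ℝ ∞ h y) (hJ : ∀ᶠ y in 𝓝 y₀, ContDiffAt ℝ ∞ J y)
    (hσ : ∀ᶠ y in 𝓝 y₀, ContDiffAt ℝ ∞ σ y)
    (he : ∀ i, ∀ᶠ y in 𝓝 y₀, ContDiffAt ℝ ∞ (e i) y)
    (hadm : ∀ᶠ y in 𝓝 y₀,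
      Admissible B b c₀ (fun v w => h y v w) (J y) (σ y) (fun i => e i y))
    {U₀ : V →L[ℝ] F} (hbij : Function.Bijective U₀) (hU₀ : ∀ v, U₀ (Complex.I • v) = J y₀ (U₀ v))
    (hUh : ∀ v w, h y₀ (U₀ v) (U₀ w) = (B v w).re) (hUv : U₀ v₀ = σ y₀) :
    ∃ U : E → V →L[ℝ] F, ∀ᶠ y in 𝓝 y₀, ContDiffAt ℝ ∞ U y ∧
      Adapted B b c₀ v₀ (fun v w => h y v w) (J y) (σ y) (fun i => e i y) (U y) := by
  obtain ⟨w₀, u, ε, hvw, hvu, hε, hu⟩ := exists_partner hB h3 hv₀ hvv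
  have hwv : B w₀ v₀ = 1 := by rw [hB.symm, hvw, map_one]
  obtain ⟨U₁, h10, h1⟩ := extend_complexLinear hwv hJ hσ hadm.self_of_nhds.sq hU₀ hUv
  obtain ⟨U₂, h20, h2⟩ := extend_pairing (J := J) hvw hvv hh (h1.mono fun y hy => hy.1)
    (by rw [h10]; exact hUh)
  obtain ⟨U₃, h30, h3⟩ := extend_orthogonal (J := J) (v₀ := v₀) hB hh (h2.mono fun y hy => hy.1)
    (by rw [h20, h10]; exact hUh)
  have hU₃ : U₃ y₀ = U₀ := by rw [h30, h20, h10]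
  have hinv : ∀ A : V →L[ℝ] F, Function.Bijective A → ∀ z, A (A.inverse z) = z := by
    intro A hA z
    obtain ⟨A', hA'⟩ := exists_equiv_of_bijective hA
    rw [← hA', ContinuousLinearMap.inverse_equiv]
    exact A'.apply_symm_apply _
  obtain ⟨U₄, h4⟩ := extend_determinant (h := h) (J := J) hB b hvu hε hu hc₀
    (h3.mono fun y hy => hy.1) he (by rwa [hU₃]) (by rwa [hU₃]) (by rwa [hU₃])
    hadm.self_of_nhds.det
  refine ⟨U₄, ?_⟩
  filter_upwards [h1, h2, h3, h4, hadm] with y ⟨_, g1⟩ ⟨_, g2⟩ ⟨_, g3⟩ ⟨c4, hbij, g4⟩ ha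
  obtain ⟨a1, a2⟩ := g1 ha.sq
  obtain ⟨b1, b2, b3⟩ := g2 ha.sq ha.symm ha.orthogonal a1 (by rw [a2]; exact ha.null)
  obtain ⟨d1, d2, d3⟩ := g3 ha.sq ha.symm ha.orthogonal b1 (by rw [b2] at b3 ⊢; exact b3)
  obtain ⟨e1, e2, e3, e4⟩ := g4 d1 d3 ha.det
  refine ⟨c4, hbij, e1, e3, by rw [e2, d2, b2, a2], fun w hw => ?_⟩
  rw [← e4]
  congr 1
  funext i
  apply hbij.1
  rw [hinv _ hbij, hw]

end Extension

/-! ### Bundle coordinates -/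

section Coordinates

variable {n : ℕ} {M : Type*} [TopologicalSpace M] [ChartedSpace (EuclideanSpace ℝ (Fin n)) M]
  {F : Type*} [NormedAddCommGroup F] [NormedSpace ℝ F]
  {T : M → Type*} [TopologicalSpace (TotalSpace F T)]
  [∀ x, AddCommGroup (T x)] [∀ x, Module ℝ (T x)] [∀ x, TopologicalSpace (T x)]
  [FiberBundle F T] [VectorBundle ℝ F T]

variable (F T) in
/-- The neighbourhood of `x₀` over which the preferred trivialization at `x₀` is defined. -/
abbrev coordDomain (x₀ : M) : Set M := (trivializationAt F T x₀).baseSet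

variable (F) in
/-- The preferred trivialization at `x₀`, as linear maps from the fibres to the model fibre. -/
def toCoord (x₀ x : M) : T x →L[ℝ] F := (trivializationAt F T x₀).continuousLinearMapAt ℝ x

variable (F) in
/-- The inverse of the preferred trivialization at `x₀`, as linear maps from the model fibre to the
fibres. -/
def ofCoord (x₀ x : M) : F →L[ℝ] T x := (trivializationAt F T x₀).symmL ℝ x

theorem toCoord_ofCoord {x₀ x : M} (hx : x ∈ coordDomain F T x₀) (a : F) :
    toCoord F x₀ x (ofCoord F x₀ x a : T x) = a :=
  (trivializationAt F T x₀).continuousLinearMapAt_symmL hx a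

theorem ofCoord_toCoord {x₀ x : M} (hx : x ∈ coordDomain F T x₀) (v : T x) :
    ofCoord F x₀ x (toCoord F x₀ x v) = v :=
  (trivializationAt F T x₀).symmL_continuousLinearMapAt hx v

theorem toCoord_apply {x₀ x : M} (hx : x ∈ coordDomain F T x₀) (v : T x) :
    toCoord F x₀ x v = (trivializationAt F T x₀ ⟨x, v⟩).2 := by
  rw [toCoord, Trivialization.continuousLinearMapAt_apply,
    Trivialization.coe_linearMapAt_of_mem _ hx]

theorem coordDomain_mem_nhds {x₀ x : M} (hx : x ∈ coordDomain F T x₀) :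
    coordDomain F T x₀ ∈ 𝓝 x :=
  (trivializationAt F T x₀).open_baseSet.mem_nhds hx

theorem self_mem_coordDomain (x₀ : M) : x₀ ∈ coordDomain F T x₀ :=
  mem_baseSet_trivializationAt F T x₀

section Maps

variable {E' : Type*} [NormedAddCommGroup E'] [NormedSpace ℝ E'] {H' : Type*} [TopologicalSpace H']
  {I' : ModelWithCorners ℝ E' H'} {X : Type*} [TopologicalSpace X] [ChartedSpace H' X]

theorem contMDiffWithinAt_toCoord {s : Set X} {a : X} {f : X → M} {v : (y : X) → T (f y)} {x₀ : M}
    (hv : ContMDiffWithinAt I' ((𝓡 n).prod 𝓘(ℝ, F)) ∞ (fun y => TotalSpace.mk' F (f y) (v y)) s a)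
    (ha : f a ∈ coordDomain F T x₀) [ContMDiffVectorBundle ∞ F T (𝓡 n)] :
    ContMDiffWithinAt I' 𝓘(ℝ, F) ∞ (fun y => toCoord F x₀ (f y) (v y)) s a := by
  have h := ((trivializationAt F T x₀).contMDiffWithinAt_iff
    ((trivializationAt F T x₀).mem_source.mpr ha)).mp hv
  refine h.2.congr_of_eventuallyEq ?_ (toCoord_apply ha _)
  filter_upwards [h.1.continuousWithinAt.preimage_mem_nhdsWithin (coordDomain_mem_nhds ha)]
    with y hy using toCoord_apply hy _

variable [∀ x, IsTopologicalAddGroup (T x)] [∀ x, ContinuousSMul ℝ (T x)]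

variable {V : Type*} [NormedAddCommGroup V] [NormedSpace ℂ V]

/-- The frame `u` as a linear map into the model fibre, with respect to the preferred
trivialization at `x₀`. -/
def frameCoord (x₀ : M) (u : FrameSpace F T V) : V →L[ℝ] F :=
  (toCoord F x₀ u.1).comp (frameMap u)

/-- The frame over `x` which is represented by the linear map `A` into the model fibre. -/
def frameOf (x₀ x : M) (A : V →L[ℝ] F) : FrameSpace F T V :=
  ⟨x, (ofCoord F x₀ x).comp A⟩

theorem frameCoord_frameOf {x₀ x : M} (hx : x ∈ coordDomain F T x₀) (A : V →L[ℝ] F) :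
    frameCoord x₀ (frameOf x₀ x A : FrameSpace F T V) = A :=
  ContinuousLinearMap.ext fun v => toCoord_ofCoord (T := T) hx (A v)

theorem frameOf_frameCoord {x₀ : M} {u : FrameSpace F T V} (hu : u.1 ∈ coordDomain F T x₀) :
    frameOf x₀ u.1 (frameCoord x₀ u) = u := by
  obtain ⟨x, u⟩ := u
  exact congrArg (TotalSpace.mk x)
    (ContinuousLinearMap.ext fun v => ofCoord_toCoord (F := F) hu (u v))

variable [ContMDiffVectorBundle ∞ F T (𝓡 n)]

theorem contMDiffWithinAt_frame_iff {f : X → FrameSpace F T V} {s : Set X} {a : X} {x₀ : M}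
    (ha : (f a).1 ∈ coordDomain F T x₀) :
    ContMDiffWithinAt I' (frameModel n F V) ∞ f s a ↔
      ContMDiffWithinAt I' (𝓡 n) ∞ (fun y => (f y).1) s a ∧
      ContMDiffWithinAt I' 𝓘(ℝ, V →L[ℝ] F) ∞ (fun y => frameCoord x₀ (f y)) s a := by
  have h := (trivializationAt (V →L[ℝ] F) (fun x : M => Trivial M V x →L[ℝ] T x)
    x₀).contMDiffWithinAt_iff (IM := I') (IB := 𝓡 n) (n := ∞) (f := f) (s := s) (x₀ := a)
    (by simpa using ha)
  rw [h]
  have key : ∀ u : FrameSpace F T V,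
      (trivializationAt (V →L[ℝ] F) (fun x : M => Trivial M V x →L[ℝ] T x) x₀ u).2 =
        frameCoord x₀ u := by
    intro u
    rw [hom_trivializationAt_apply]
    ext v
    simp [ContinuousLinearMap.inCoordinates, frameCoord, toCoord]
  simp only [key]

end Maps

variable [ContMDiffVectorBundle ∞ F T (𝓡 n)]

variable (F T) in
/-- Near `x₀`, the local frames of the preferred trivialization are the restrictions of global
smooth sections. -/
theorem exists_global_sections [T2Space M] [IsManifold (𝓡 n) ∞ M] (x₀ : M) :
    ∃ (N : Set M) (s : F → (x : M) → T x), IsOpen N ∧ x₀ ∈ N ∧ N ⊆ coordDomain F T x₀ ∧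
      (∀ a, SmoothSection n F (s a)) ∧ ∀ x ∈ N, ∀ a, s a x = ofCoord F x₀ x a := by
  obtain ⟨ψ, -, hψ⟩ := (SmoothBumpFunction.nhds_basis_tsupport (I := 𝓡 n) x₀).mem_iff.mp
    (coordDomain_mem_nhds (self_mem_coordDomain (F := F) (T := T) x₀))
  refine ⟨interior {x | ψ x = 1} ∩ coordDomain F T x₀, fun a x => ψ x • ofCoord F x₀ x a,
    isOpen_interior.inter (trivializationAt F T x₀).open_baseSet,
    ⟨mem_interior_iff_mem_nhds.mpr ψ.eventuallyEq_one, self_mem_coordDomain x₀⟩,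
    inter_subset_right, fun a => ?_, fun x hx a => ?_⟩
  · have h1 : ContMDiffOn (𝓡 n) ((𝓡 n).prod 𝓘(ℝ, F)) ∞
        (fun x => TotalSpace.mk' F x (ofCoord F x₀ x a : T x)) (coordDomain F T x₀) := by
      rw [(trivializationAt F T x₀).contMDiffOn_section_baseSet_iff]
      refine contMDiffOn_const (c := a) |>.congr fun x hx => ?_
      rw [← toCoord_apply hx, toCoord_ofCoord hx]
    exact ContMDiffOn.smul_section_of_tsupport ψ.contMDiff.contMDiffOn
      (trivializationAt F T x₀).open_baseSet hψ h1
  · have : ψ x = 1 := interior_subset (s := {x | ψ x = 1}) hx.1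
    change ψ x • _ = _
    rw [this, one_smul]

end Coordinates

/-! ### Connections and bundle metrics in coordinates -/

section Connections

variable {n : ℕ} {M : Type*} [TopologicalSpace M] [ChartedSpace (EuclideanSpace ℝ (Fin n)) M]
  {F : Type*} [NormedAddCommGroup F] [NormedSpace ℝ F] [FiniteDimensional ℝ F]
  {T : M → Type*} [TopologicalSpace (TotalSpace F T)]
  [∀ x, AddCommGroup (T x)] [∀ x, Module ℝ (T x)] [∀ x, TopologicalSpace (T x)]
  [FiberBundle F T] [VectorBundle ℝ F T] [ContMDiffVectorBundle ∞ F T (𝓡 n)]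
  [T2Space M] [IsManifold (𝓡 n) ∞ M]

variable (n F T) in
/-- A neighbourhood of `x₀` on which the sections `globalSection` form the local frames of the
preferred trivialization at `x₀`. -/
def sectionDomain (x₀ : M) : Set M := (exists_global_sections (n := n) F T x₀).choose

variable (n T) in
/-- A global smooth section which agrees near `x₀` with the section that is constantly equal to `a`
in the preferred trivialization at `x₀`. -/
def globalSection (x₀ : M) (a : F) : (x : M) → T x :=
  (exists_global_sections (n := n) F T x₀).choose_spec.choose a

theorem isOpen_sectionDomain (x₀ : M) : IsOpen (sectionDomain n F T x₀) :=
  (exists_global_sections (n := n) F T x₀).choose_spec.choose_spec.1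

theorem self_mem_sectionDomain (x₀ : M) : x₀ ∈ sectionDomain n F T x₀ :=
  (exists_global_sections (n := n) F T x₀).choose_spec.choose_spec.2.1

theorem sectionDomain_subset (x₀ : M) : sectionDomain n F T x₀ ⊆ coordDomain F T x₀ :=
  (exists_global_sections (n := n) F T x₀).choose_spec.choose_spec.2.2.1

theorem smooth_globalSection (x₀ : M) (a : F) : SmoothSection n F (globalSection n T x₀ a) :=
  (exists_global_sections (n := n) F T x₀).choose_spec.choose_spec.2.2.2.1 a

theorem globalSection_apply {x₀ x : M} (hx : x ∈ sectionDomain n F T x₀) (a : F) :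
    globalSection n T x₀ a x = ofCoord F x₀ x a :=
  (exists_global_sections (n := n) F T x₀).choose_spec.choose_spec.2.2.2.2 x hx a

variable (n F) in
theorem exists_section_eq (x : M) (v : T x) :
    ∃ s : (x : M) → T x, SmoothSection n F s ∧ s x = v :=
  ⟨globalSection n T x (toCoord F x x v), smooth_globalSection _ _, by
    rw [globalSection_apply (self_mem_sectionDomain x), ofCoord_toCoord (self_mem_coordDomain x)]⟩

variable [∀ x, IsTopologicalAddGroup (T x)] [∀ x, ContinuousSMul ℝ (T x)]
  {D : CovariantDerivative (𝓡 n) F T}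

variable (F) in
/-- The coefficients with respect to a basis of the model fibre, as continuous linear forms. -/
def coeffs (k : Fin (Module.finrank ℝ F)) : F →L[ℝ] ℝ :=
  LinearMap.toContinuousLinearMap ((Module.finBasis ℝ F).coord k)

theorem sum_coeffs (a : F) : ∑ k, coeffs F k a • Module.finBasis ℝ F k = a :=
  (Module.finBasis ℝ F).sum_repr a

variable (D) in
/-- The connection form of `D` in the preferred trivialization at `x₀`. -/
def christoffel (x₀ x : M) : TangentSpace (𝓡 n) x →L[ℝ] (F →L[ℝ] F) :=
  ∑ k, (ContinuousLinearMap.smulRightL ℝ F F (coeffs F k)).comp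
    ((toCoord F x₀ x).comp (D (globalSection n T x₀ (Module.finBasis ℝ F k)) x))

theorem christoffel_apply (x₀ x : M) (ξ : TangentSpace (𝓡 n) x) (a : F) :
    christoffel D x₀ x ξ a = ∑ k, coeffs F k a •
      toCoord F x₀ x (D (globalSection n T x₀ (Module.finBasis ℝ F k)) x ξ) := by
  simp only [christoffel, sum_apply]
  rfl

theorem conn_sum {ι : Type*} (S : Finset ι) {s : ι → (x : M) → T x} {x : M}
    (hs : ∀ k ∈ S, MDifferentiableAt (𝓡 n) ((𝓡 n).prod 𝓘(ℝ, F))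
      (fun y => TotalSpace.mk' F y (s k y)) x) :
    D (∑ k ∈ S, s k) x = ∑ k ∈ S, D (s k) x ∧
      MDifferentiableAt (𝓡 n) ((𝓡 n).prod 𝓘(ℝ, F))
      (fun y => TotalSpace.mk' F y ((∑ k ∈ S, s k) y)) x := by
  classical
  induction S using Finset.induction_on with
  | empty =>
    simp only [Finset.sum_empty]
    refine ⟨by rw [CovariantDerivative.zero]; rfl, mdifferentiableAt_zeroSection ..⟩
  | insert k S hk ih =>
    have h1 := hs k (Finset.mem_insert_self _ _)
    have h2 := ih fun j hj => hs j (Finset.mem_insert_of_mem hj)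
    rw [Finset.sum_insert hk, Finset.sum_insert hk,
      D.isCovariantDerivativeOnUniv.add h1 h2.2, h2.1]
    exact ⟨rfl, mdifferentiableAt_add_section h1 h2.2⟩

/-- The covariant derivative in the preferred trivialization at `x₀`. -/
theorem toCoord_conn {x₀ x : M} (hx : x ∈ sectionDomain n F T x₀) {t : (x : M) → T x}
    (ht : SmoothSection n F t) (ξ : TangentSpace (𝓡 n) x) :
    toCoord F x₀ x (D t x ξ) = mvfderiv (𝓡 n) (fun y => toCoord F x₀ y (t y)) x ξ +
      christoffel D x₀ x ξ (toCoord F x₀ x (t x)) := by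
  set b := Module.finBasis ℝ F
  have hxc := sectionDomain_subset x₀ hx
  let g : Fin (Module.finrank ℝ F) → M → ℝ := fun k y => coeffs F k (toCoord F x₀ y (t y))
  let s : Fin (Module.finrank ℝ F) → (y : M) → T y := fun k => globalSection n T x₀ (b k)
  have hc : MDifferentiableAt (𝓡 n) 𝓘(ℝ, F) (fun y => toCoord F x₀ y (t y)) x :=
    ((contMDiffWithinAt_toCoord (s := univ) (f := fun y => y) (ht x).contMDiffWithinAt
      hxc).contMDiffAt univ_mem).mdifferentiableAt (by simp)
  have hg : ∀ k, MDifferentiableAt (𝓡 n) 𝓘(ℝ, ℝ) (g k) x := fun k =>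
    (coeffs F k).mdifferentiableAt.comp x hc
  have hs : ∀ k, MDifferentiableAt (𝓡 n) ((𝓡 n).prod 𝓘(ℝ, F))
      (fun y => TotalSpace.mk' F y (s k y)) x := fun k =>
    (smooth_globalSection x₀ (b k) x).mdifferentiableAt (by simp)
  have hsum := conn_sum (D := D) (x := x) Finset.univ (s := fun k => g k • s k)
    fun k _ => (hg k).smul_section (hs k)
  -- near `x`, the section is a combination of the local frame, and the Leibniz rule applies
  have heq : ∀ᶠ y in 𝓝 x, t y = (∑ k, g k • s k) y := by
    filter_upwards [(isOpen_sectionDomain x₀).mem_nhds hx] with y hy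
    have h1 : (∑ k, g k • s k) y = ∑ k, g k y • s k y := by
      rw [Finset.sum_apply]; rfl
    simp only [h1, s, globalSection_apply hy, ← map_smul, ← map_sum]
    simp only [g, b, sum_coeffs]
    exact (ofCoord_toCoord (sectionDomain_subset x₀ hy) _).symm
  rw [D.isCovariantDerivativeOnUniv.congr_of_eventuallyEq ((ht x).mdifferentiableAt (by simp))
    hsum.2 univ_mem heq, hsum.1]
  simp only [sum_apply, map_sum]
  have hlead : ∀ k, D (g k • s k) x = g k x • D (s k) x +
      (mvfderiv (𝓡 n) (g k) x).smulRight (s k x) := fun k =>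
    D.isCovariantDerivativeOnUniv.leibniz (hs k) (hg k)
  have hdg : ∀ k, mvfderiv (𝓡 n) (g k) x ξ =
      coeffs F k (mvfderiv (𝓡 n) (fun y => toCoord F x₀ y (t y)) x ξ) := by
    intro k
    have h1 := mfderiv_comp x (coeffs F k).mdifferentiableAt hc
    rw [ContinuousLinearMap.mfderiv_eq] at h1
    exact congrArg (fun f : TangentSpace (𝓡 n) x →L[ℝ] ℝ => f ξ) h1
  have hk : ∀ k, toCoord F x₀ x (D (g k • s k) x ξ) =
      coeffs F k (mvfderiv (𝓡 n) (fun y => toCoord F x₀ y (t y)) x ξ) • b k +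
      coeffs F k (toCoord F x₀ x (t x)) • toCoord F x₀ x (D (s k) x ξ) := by
    intro k
    rw [hlead, ← hdg]
    have : (g k x • D (s k) x + (mvfderiv (𝓡 n) (g k) x).smulRight (s k x)) ξ =
      g k x • D (s k) x ξ + mvfderiv (𝓡 n) (g k) x ξ • s k x := rfl
    rw [this, map_add, map_smul, map_smul, add_comm]
    simp only [s, globalSection_apply hx, toCoord_ofCoord hxc]
    rfl
  simp only [hk, Finset.sum_add_distrib]
  rw [christoffel_apply]
  congr 1
  exact sum_coeffs _

/-- The bundle metric in the preferred trivialization at `x₀`. -/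
def formCoord {r s : ℕ} (h : BundleMetric (n := n) F T r s) (x₀ x : M) : F →L[ℝ] F →L[ℝ] ℝ :=
  (ContinuousLinearMap.precomp ℝ (ofCoord F x₀ x : F →L[ℝ] T x)).comp
    ((h.form x).comp (ofCoord F x₀ x))

theorem formCoord_apply {r s : ℕ} (h : BundleMetric (n := n) F T r s) (x₀ x : M) (a b : F) :
    formCoord h x₀ x a b = h.form x (ofCoord F x₀ x a) (ofCoord F x₀ x b) := rfl

theorem contMDiff_form {r s : ℕ} (h : BundleMetric (n := n) F T r s) {t t' : (x : M) → T x}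
    (ht : SmoothSection n F t) (ht' : SmoothSection n F t') :
    ContMDiff (𝓡 n) 𝓘(ℝ, ℝ) ∞ (fun x => h.form x (t x) (t' x)) := by
  intro x
  have : ContMDiffAt (𝓡 n) ((𝓡 n).prod 𝓘(ℝ, ℝ)) ∞
      (fun x => TotalSpace.mk' ℝ (E := Bundle.Trivial M ℝ) x (h.form x (t x) (t' x))) x := by
    apply ContMDiffAt.clm_bundle_apply₂ (F₁ := F) (F₂ := F)
    · exact h.smooth x
    · exact ht x
    · exact ht' x
  simp only [contMDiffAt_totalSpace] at this
  exact this.2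

theorem contMDiffAt_formCoord {r s : ℕ} (h : BundleMetric (n := n) F T r s) {x₀ x : M}
    (hx : x ∈ sectionDomain n F T x₀) :
    ContMDiffAt (𝓡 n) 𝓘(ℝ, F →L[ℝ] F →L[ℝ] ℝ) ∞ (formCoord h x₀) x := by
  refine contMDiffWithinAt_clm_of_apply fun a => contMDiffWithinAt_clm_of_apply fun b => ?_
  refine (contMDiff_form h (smooth_globalSection x₀ a) (smooth_globalSection x₀ b)
    x).congr_of_eventuallyEq ?_ |>.contMDiffWithinAt
  filter_upwards [(isOpen_sectionDomain x₀).mem_nhds hx] with y hy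
  rw [formCoord_apply, globalSection_apply hy, globalSection_apply hy]

section ComplexStructure

variable {r s : ℕ} {h : BundleMetric (n := n) F T r s} (J : OrthogonalComplexStructure h)

/-- The complex structure in the preferred trivialization at `x₀`. -/
def endoCoord (x₀ x : M) : F →L[ℝ] F :=
  (toCoord F x₀ x).comp ((J.endo x).comp (ofCoord F x₀ x))

theorem endoCoord_toCoord {x₀ x : M} (hx : x ∈ coordDomain F T x₀) (v : T x) :
    endoCoord J x₀ x (toCoord F x₀ x v) = toCoord F x₀ x (J.endo x v) := by
  change toCoord F x₀ x (J.endo x (ofCoord F x₀ x _)) = _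
  rw [ofCoord_toCoord hx]

theorem smoothSection_endo {t : (x : M) → T x} (ht : SmoothSection n F t) :
    SmoothSection n F (fun x => J.endo x (t x)) :=
  J.smooth.clm_bundle_apply ht

theorem contMDiffAt_sectionCoord {x₀ x : M} (hx : x ∈ coordDomain F T x₀)
    {t : (x : M) → T x} (ht : SmoothSection n F t) :
    ContMDiffAt (𝓡 n) 𝓘(ℝ, F) ∞ (fun y => toCoord F x₀ y (t y)) x :=
  (contMDiffWithinAt_toCoord (s := univ) (f := fun y => y) (ht x).contMDiffWithinAt
      hx).contMDiffAt univ_mem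

theorem contMDiffAt_endoCoord {x₀ x : M} (hx : x ∈ sectionDomain n F T x₀) :
    ContMDiffAt (𝓡 n) 𝓘(ℝ, F →L[ℝ] F) ∞ (endoCoord J x₀) x := by
  refine contMDiffWithinAt_clm_of_apply fun a => ?_
  refine (contMDiffAt_sectionCoord (sectionDomain_subset x₀ hx)
    (smoothSection_endo J (smooth_globalSection x₀ a))).congr_of_eventuallyEq ?_
      |>.contMDiffWithinAt
  filter_upwards [(isOpen_sectionDomain x₀).mem_nhds hx] with y hy
  rw [globalSection_apply hy]
  rfl

end ComplexStructure

end Connections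

/-! ### Derivatives of vector valued functions on manifolds -/

section VectorValued

variable {E' : Type*} [NormedAddCommGroup E'] [NormedSpace ℝ E'] {H' : Type*} [TopologicalSpace H']
  {I : ModelWithCorners ℝ E' H'} {X : Type*} [TopologicalSpace X] [ChartedSpace H' X]
  {G₁ G₂ G : Type*} [NormedAddCommGroup G₁] [NormedSpace ℝ G₁] [NormedAddCommGroup G₂]
  [NormedSpace ℝ G₂] [NormedAddCommGroup G] [NormedSpace ℝ G] {x : X}

theorem mvfderiv_bilinear (Φ : G₁ →L[ℝ] G₂ →L[ℝ] G) {f : X → G₁} {g : X → G₂}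
    (hf : MDifferentiableAt I 𝓘(ℝ, G₁) f x) (hg : MDifferentiableAt I 𝓘(ℝ, G₂) g x)
    (ξ : TangentSpace I x) :
    mvfderiv I (fun y => Φ (f y) (g y)) x ξ =
      Φ (mvfderiv I f x ξ) (g x) + Φ (f x) (mvfderiv I g x ξ) := by
  have h1 := hf.hasMFDerivAt
  have h2 := hg.hasMFDerivAt
  have h3 : HasMFDerivAt I 𝓘(ℝ, G) (fun y => Φ (f y) (g y)) x
      (Φ.precompR E' (f x) (mfderiv I 𝓘(ℝ, G₂) g x) +
        Φ.precompL E' (mfderiv I 𝓘(ℝ, G₁) f x) (g x)) := by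
    refine ⟨?_, ?_⟩
    · exact (Φ.continuous.continuousAt.comp h1.1).clm_apply h2.1
    · have h4 := Φ.hasFDerivWithinAt_of_bilinear h1.2 h2.2
      simp only [writtenInExtChartAt, extChartAt_self_apply, Function.comp_def,
        extChartAt_to_inv] at h4
      exact h4
  have h4 := h3.mfderiv
  rw [add_comm (Φ (mvfderiv I f x ξ) (g x))]
  exact congrArg (fun A : E' →L[ℝ] G => A ξ) h4

theorem mvfderiv_clm_comp (Φ : G₁ →L[ℝ] G) {f : X → G₁} (hf : MDifferentiableAt I 𝓘(ℝ, G₁) f x)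
    (ξ : TangentSpace I x) : mvfderiv I (fun y => Φ (f y)) x ξ = Φ (mvfderiv I f x ξ) := by
  have h1 := mfderiv_comp x Φ.mdifferentiableAt hf
  rw [ContinuousLinearMap.mfderiv_eq] at h1
  exact congrArg (fun A : TangentSpace I x →L[ℝ] G => A ξ) h1

theorem mvfderiv_congr {f g : X → G} (h : f =ᶠ[𝓝 x] g) (ξ : TangentSpace I x) :
    mvfderiv I f x ξ = mvfderiv I g x ξ := by
  have h1 := h.mfderiv_eq (I := I) (I' := 𝓘(ℝ, G))
  exact congrArg (fun A : E' →L[ℝ] G => A ξ) h1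

theorem contMDiffOn_mvfderiv [IsManifold I 1 X] {U : Set X} (hU : IsOpen U) {f : X → G}
    (hf : ContMDiffOn I 𝓘(ℝ, G) ∞ f U) {Y : (x : X) → TangentSpace I x}
    (hY : ContMDiffOn I I.tangent ∞ (fun x => (⟨x, Y x⟩ : TangentBundle I X)) U) :
    ContMDiffOn I 𝓘(ℝ, G) ∞ (fun x => mvfderiv I f x (Y x)) U := by
  have h1 : ContMDiffOn I.tangent 𝓘(ℝ, G).tangent ∞ (tangentMapWithin I 𝓘(ℝ, G) f U)
      (TotalSpace.proj ⁻¹' U) := hf.contMDiffOn_tangentMapWithin (by simp) hU.uniqueMDiffOn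
  have h2 := contMDiff_snd_tangentBundle_modelSpace (n := ∞) G (I := 𝓘(ℝ, G))
  refine (h2.comp_contMDiffOn (h1.comp hY fun x hx => hx)).congr fun x hx => ?_
  simp only [Function.comp, tangentMapWithin, mfderivWithin_of_isOpen hU hx]
  rfl

/-- The derivative of a function along a smooth curve with velocity `ξ`. -/
theorem hasDerivAt_comp_curve {u : X} {ξ : TangentSpace I u} {γ : ℝ → X}
    (hγ : ContMDiff 𝓘(ℝ, ℝ) I ∞ γ)
    (h : tangentMap 𝓘(ℝ, ℝ) I γ ⟨0, (1 : ℝ)⟩ = (⟨u, ξ⟩ : TangentBundle I X)) {g : X → G}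
    (hg : MDifferentiableAt I 𝓘(ℝ, G) g u) : HasDerivAt (g ∘ γ) (mvfderiv I g u ξ) 0 := by
  have h0 : γ 0 = u := congrArg TotalSpace.proj h
  subst h0
  have h1 : mfderiv 𝓘(ℝ, ℝ) I γ 0 (1 : ℝ) = ξ := by
    simpa [tangentMap] using h
  have hγ0 : MDifferentiableAt 𝓘(ℝ, ℝ) I γ 0 := (hγ 0).mdifferentiableAt (by simp)
  have h2 := mfderiv_comp 0 hg hγ0
  have h4 : DifferentiableAt ℝ (g ∘ γ) 0 :=
    mdifferentiableAt_iff_differentiableAt.mp (hg.comp 0 hγ0)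
  have h5 := h4.hasDerivAt
  have h6 : deriv (g ∘ γ) 0 = mvfderiv I g (γ 0) ξ := by
    rw [← fderiv_apply_one_eq_deriv]
    rw [mfderiv_eq_fderiv] at h2
    rw [← h1]
    exact congrArg (fun A : ℝ →L[ℝ] G => A 1) h2
  rwa [h6] at h5

theorem tangentMap_comp_curve {u : X} {ξ : TangentSpace I u} {γ : ℝ → X}
    (hγ : ContMDiff 𝓘(ℝ, ℝ) I ∞ γ)
    (h : tangentMap 𝓘(ℝ, ℝ) I γ ⟨0, (1 : ℝ)⟩ = (⟨u, ξ⟩ : TangentBundle I X))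
    {E'' : Type*} [NormedAddCommGroup E''] [NormedSpace ℝ E''] {H'' : Type*} [TopologicalSpace H'']
    {I' : ModelWithCorners ℝ E'' H''} {Y : Type*} [TopologicalSpace Y] [ChartedSpace H'' Y]
    {f : X → Y} (hf : MDifferentiableAt I I' f u) :
    tangentMap 𝓘(ℝ, ℝ) I' (f ∘ γ) ⟨0, (1 : ℝ)⟩ =
      (⟨f u, mfderiv I I' f u ξ⟩ : TangentBundle I' Y) := by
  have h0 : γ 0 = u := congrArg TotalSpace.proj h
  subst h0
  have hγ0 : MDifferentiableAt 𝓘(ℝ, ℝ) I γ 0 := (hγ 0).mdifferentiableAt (by simp)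
  rw [tangentMap_comp_at (⟨0, (1 : ℝ)⟩ : TangentBundle 𝓘(ℝ, ℝ) ℝ) hf hγ0, h]
  rfl

/-- A map from `S` to `S'` maps tangent vectors of `S` to tangent vectors of `S'`. -/
theorem mfderiv_mem_tangentTo {E'' : Type*} [NormedAddCommGroup E''] [NormedSpace ℝ E'']
    {H'' : Type*} [TopologicalSpace H''] {I' : ModelWithCorners ℝ E'' H''} {Y : Type*}
    [TopologicalSpace Y] [ChartedSpace H'' Y] {f : X → Y} (hf : ContMDiff I I' ∞ f) {S : Set X}
    {S' : Set Y} (hS : MapsTo f S S') {u : X} {ξ : TangentSpace I u} (hξ : ξ ∈ tangentTo I S u) :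
    mfderiv I I' f u ξ ∈ tangentTo I' S' (f u) := by
  induction hξ using Submodule.span_induction with
  | zero => rw [map_zero]; exact Submodule.zero_mem _
  | add x y _ _ h1 h2 => rw [map_add]; exact Submodule.add_mem _ h1 h2
  | smul a x _ h => rw [map_smul]; exact Submodule.smul_mem _ a h
  | mem ξ h =>
    obtain ⟨γ, hγ, hγS, h⟩ := h
    exact Submodule.subset_span ⟨f ∘ γ, hf.comp hγ, fun t => hS (hγS t),
      tangentMap_comp_curve hγ h ((hf u).mdifferentiableAt (by simp))⟩

/-- If `g` maps points of `S` near `u` to the subspace `W`, then so does its derivative on the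
tangent space of `S`. -/
theorem mvfderiv_mem_of_tangentTo [FiniteDimensional ℝ G] {S : Set X} {u : X} (W : Submodule ℝ G)
    {g : X → G} (hg : MDifferentiableAt I 𝓘(ℝ, G) g u) (hS : ∀ᶠ q in 𝓝 u, q ∈ S → g q ∈ W)
    {ξ : TangentSpace I u} (hξ : ξ ∈ tangentTo I S u) : mvfderiv I g u ξ ∈ W := by
  induction hξ using Submodule.span_induction with
  | zero => rw [map_zero]; exact W.zero_mem
  | add x y _ _ h1 h2 => rw [map_add]; exact W.add_mem h1 h2
  | smul a x _ h => rw [map_smul]; exact W.smul_mem a h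
  | mem ξ h =>
    obtain ⟨γ, hγ, hγS, h⟩ := h
    have h0 : γ 0 = u := congrArg TotalSpace.proj h
    have h3 := hasDerivAt_comp_curve hγ h hg
    rw [← h0] at hS
    have hev : ∀ᶠ t in 𝓝 (0 : ℝ), g (γ t) ∈ W :=
      (hγ.continuous.continuousAt.eventually hS).mono fun t ht => ht (hγS t)
    obtain ⟨pr, hpr⟩ := (Submodule.ClosedComplemented.of_finiteDimensional W)
    -- the derivative is fixed by a projection onto `W`, because the curve is
    let P : G →L[ℝ] G := W.subtypeL.comp pr
    have hP : ∀ w ∈ W, P w = w := fun w hw => congrArg Subtype.val (hpr ⟨w, hw⟩)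
    have h7 : HasDerivAt (fun t => P (g (γ t))) (P (mvfderiv I g u ξ)) 0 :=
      P.hasFDerivAt.comp_hasDerivAt 0 h3
    have h8 := h7.unique (h3.congr_of_eventuallyEq (hev.mono fun t ht => hP _ ht))
    rw [← h8]
    exact (pr _).2

theorem mvfderiv_eq_zero_of_tangentTo [FiniteDimensional ℝ G] {S : Set X} {u : X} {g : X → G}
    (hg : MDifferentiableAt I 𝓘(ℝ, G) g u) {c : G} (hS : ∀ᶠ q in 𝓝 u, q ∈ S → g q = c)
    {ξ : TangentSpace I u} (hξ : ξ ∈ tangentTo I S u) : mvfderiv I g u ξ = 0 := by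
  have h1 := mvfderiv_mem_of_tangentTo (I := I) (⊥ : Submodule ℝ G) (g := fun q => g q - c)
    (hg.sub mdifferentiableAt_const) (hS.mono fun q hq hqS => by rw [hq hqS]; simp) hξ
  have h2 := mvfderiv_sub (I := I) hg (mdifferentiableAt_const (c := c))
  rw [mvfderiv_const, sub_zero] at h2
  rw [← h2]
  exact (Submodule.mem_bot ℝ).mp h1

end VectorValued

/-! ### The connection form on frames -/

section ConnectionForm

variable {n : ℕ} {M : Type*} [TopologicalSpace M] [ChartedSpace (EuclideanSpace ℝ (Fin n)) M]
  {F : Type*} [NormedAddCommGroup F] [NormedSpace ℝ F]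
  {T : M → Type*} [TopologicalSpace (TotalSpace F T)]
  [∀ x, AddCommGroup (T x)] [∀ x, Module ℝ (T x)] [∀ x, TopologicalSpace (T x)]
  [∀ x, IsTopologicalAddGroup (T x)] [∀ x, ContinuousSMul ℝ (T x)]
  [FiberBundle F T] [VectorBundle ℝ F T]
  {V : Type*} [NormedAddCommGroup V] [NormedSpace ℂ V] [FiniteDimensional ℂ V]

theorem frameCoord_bijective_iff {x₀ : M} {u : FrameSpace F T V}
    (hx : u.1 ∈ coordDomain F T x₀) :
    Function.Bijective (frameCoord x₀ u) ↔ Function.Bijective (frameMap u) := by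
  have h : Function.Bijective (toCoord F x₀ u.1 : T u.1 → F) :=
    ⟨Function.LeftInverse.injective (ofCoord_toCoord hx),
      Function.RightInverse.surjective (toCoord_ofCoord hx)⟩
  change Function.Bijective (toCoord F x₀ u.1 ∘ frameMap u) ↔ _
  exact h.of_comp_iff' _

/-- The preferred trivialization at `x₀` on the fibre over `x`. -/
def coordEquiv {x₀ x : M} (hx : x ∈ coordDomain F T x₀) : T x ≃L[ℝ] F :=
  ContinuousLinearEquiv.equivOfInverse (toCoord F x₀ x) (ofCoord F x₀ x)
    (ofCoord_toCoord hx) (toCoord_ofCoord hx)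

/-- A bijective frame is a homeomorphism; its inverse may be computed in coordinates. -/
theorem frame_inverse_apply {x₀ : M} {u : FrameSpace F T V} (hx : u.1 ∈ coordDomain F T x₀)
    (hu : Function.Bijective (frameMap u)) (v : T u.1) :
    (frameMap u).inverse v = (frameCoord x₀ u).inverse (toCoord F x₀ u.1 v) := by
  obtain ⟨A, hA⟩ := exists_equiv_of_bijective ((frameCoord_bijective_iff hx).mpr hu)
  let e := A.trans (coordEquiv hx).symm
  have he : (e : V →L[ℝ] T u.1) = frameMap u := by
    ext v
    change ofCoord F x₀ u.1 ((A : V →L[ℝ] F) v) = _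
    rw [hA]
    exact ofCoord_toCoord hx _
  rw [← he, ContinuousLinearMap.inverse_equiv, ← hA, ContinuousLinearMap.inverse_equiv]
  rfl

theorem frame_inverse_apply_self {u : FrameSpace F T V} (hu : Function.Bijective (frameMap u))
    (v : V) : (frameMap u).inverse (frameMap u v) = v := by
  have hx := self_mem_coordDomain (F := F) (T := T) u.1
  obtain ⟨A, hA⟩ := exists_equiv_of_bijective ((frameCoord_bijective_iff hx).mpr hu)
  rw [frame_inverse_apply hx hu, ← hA, ContinuousLinearMap.inverse_equiv]
  refine A.symm_apply_eq.mpr ?_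
  change _ = (A : V →L[ℝ] F) v
  rw [hA]
  rfl

theorem frame_apply_inverse {u : FrameSpace F T V} (hu : Function.Bijective (frameMap u))
    (v : T u.1) : frameMap u ((frameMap u).inverse v) = v := by
  obtain ⟨w, rfl⟩ := hu.2 v
  rw [frame_inverse_apply_self hu]

variable [ContMDiffVectorBundle ∞ F T (𝓡 n)]

theorem contMDiffAt_frameCoord {x₀ : M} {u : FrameSpace F T V} (hx : u.1 ∈ coordDomain F T x₀) :
    ContMDiffAt (frameModel n F V) 𝓘(ℝ, V →L[ℝ] F) ∞ (frameCoord x₀) u :=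
  ((contMDiffWithinAt_frame_iff (s := univ) (f := fun u : FrameSpace F T V => u) hx).mp
    contMDiffWithinAt_id).2.contMDiffAt univ_mem

theorem contMDiff_frameProj :
    ContMDiff (frameModel n F V) (𝓡 n) ∞ (fun u : FrameSpace F T V => u.1) :=
  contMDiff_proj _

theorem eventually_coordDomain {x₀ : M} {u : FrameSpace F T V}
    (hx : u.1 ∈ coordDomain F T x₀) : ∀ᶠ q : FrameSpace F T V in 𝓝 u, q.1 ∈ coordDomain F T x₀ :=
  (FiberBundle.continuous_proj _ _).continuousAt.preimage_mem_nhds (coordDomain_mem_nhds hx)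

theorem eventually_bijective {n : ℕ} [ChartedSpace (EuclideanSpace ℝ (Fin n)) M]
    [ContMDiffVectorBundle ∞ F T (𝓡 n)] {u : FrameSpace F T V}
    (hu : Function.Bijective (frameMap u)) :
    ∀ᶠ q : FrameSpace F T V in 𝓝 u, Function.Bijective (frameMap q) := by
  have hcV : CompleteSpace V := FiniteDimensional.complete ℝ V
  have hx := self_mem_coordDomain (F := F) (T := T) u.1
  obtain ⟨A, hA⟩ := exists_equiv_of_bijective ((frameCoord_bijective_iff hx).mpr hu)
  have h1 : ∀ᶠ q : FrameSpace F T V in 𝓝 u, Function.Bijective (frameCoord u.1 q) := by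
    refine ((contMDiffAt_frameCoord (n := n) hx).continuousAt.eventually
      (p := fun B : V →L[ℝ] F => Function.Bijective B) ?_)
    rw [← hA]
    filter_upwards [A.nhds] with B hB
    obtain ⟨B', rfl⟩ := hB
    exact B'.bijective
  filter_upwards [h1, eventually_coordDomain hx] with q hq hqx
  exact (frameCoord_bijective_iff hqx).mp hq

theorem contMDiffAt_frameCoord_inverse {x₀ : M} {u : FrameSpace F T V}
    (hx : u.1 ∈ coordDomain F T x₀) (hu : Function.Bijective (frameMap u)) :
    ContMDiffAt (frameModel n F V) 𝓘(ℝ, F →L[ℝ] V) ∞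
      (fun q : FrameSpace F T V => (frameCoord x₀ q).inverse) u := by
  have hcV : CompleteSpace V := FiniteDimensional.complete ℝ V
  obtain ⟨A, hA⟩ := exists_equiv_of_bijective ((frameCoord_bijective_iff hx).mpr hu)
  have h1 := (contDiffAt_map_inverse (n := ∞) A).contMDiffAt
  rw [hA] at h1
  exact h1.comp u (contMDiffAt_frameCoord hx)

variable [FiniteDimensional ℝ F] [T2Space M] [IsManifold (𝓡 n) ∞ M]

theorem contMDiffAt_equivariantFunction {u : FrameSpace F T V}
    (hu : Function.Bijective (frameMap u)) {s : (x : M) → T x} (hs : SmoothSection n F s) :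
    ContMDiffAt (frameModel n F V) 𝓘(ℝ, V) ∞ (equivariantFunction V s) u := by
  have hx := self_mem_coordDomain (F := F) (T := T) u.1
  have h1 := (contMDiffAt_frameCoord_inverse (n := n) hx hu).clm_apply
    ((contMDiffAt_sectionCoord hx hs).comp u (contMDiff_frameProj (V := V) u))
  refine h1.congr_of_eventuallyEq ?_
  filter_upwards [eventually_bijective (n := n) hu, eventually_coordDomain hx]
    with q hq hqx using frame_inverse_apply hqx hq _

variable {D : CovariantDerivative (𝓡 n) F T}

variable (n) in
/-- The projection of tangent vectors of the frame space to the base. -/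
def frameProj (u : FrameSpace F T V) :
    TangentSpace (frameModel n F V) u →L[ℝ] TangentSpace (𝓡 n) u.1 :=
  mfderiv (frameModel n F V) (𝓡 n) (fun u' : FrameSpace F T V => u'.1) u

variable (D V) in
/-- The connection form of `D` on frames, computed in the preferred trivialization at `x₀`:
`ω(ξ) = Û⁻¹ (dÛ(ξ) + Γ(π ξ) Û)`, where `Û` is the frame in coordinates. -/
def connForm (x₀ : M) (u : FrameSpace F T V) :
    TangentSpace (frameModel n F V) u →L[ℝ] (V →L[ℝ] V) :=
  (ContinuousLinearMap.postcomp V (frameCoord x₀ u).inverse).comp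
    (mvfderiv (frameModel n F V) (frameCoord x₀) u +
      (ContinuousLinearMap.precomp F (frameCoord x₀ u)).comp
        ((christoffel D x₀ u.1).comp (frameProj n u)))

theorem connForm_apply (x₀ : M) (u : FrameSpace F T V) (ξ : TangentSpace (frameModel n F V) u)
    (v : V) : connForm V D x₀ u ξ v = (frameCoord x₀ u).inverse
      (mvfderiv (frameModel n F V) (frameCoord x₀) u ξ v +
        christoffel D x₀ u.1 (frameProj n u ξ) (frameCoord x₀ u v)) := rfl

/-- The connection form determines the covariant derivative. -/
theorem inverse_conn {x₀ : M} {u : FrameSpace F T V} (hx : u.1 ∈ sectionDomain n F T x₀)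
    (hu : Function.Bijective (frameMap u)) (ξ : TangentSpace (frameModel n F V) u)
    {s : (x : M) → T x} (hs : SmoothSection n F s) :
    (frameMap u).inverse (D s u.1 (frameProj n u ξ)) =
      mvfderiv (frameModel n F V) (equivariantFunction V s) u ξ +
        connForm V D x₀ u ξ (equivariantFunction V s u) := by
  have hxc := sectionDomain_subset x₀ hx
  obtain ⟨A, hA⟩ := exists_equiv_of_bijective ((frameCoord_bijective_iff hxc).mpr hu)
  have hinv : ∀ a, (frameCoord x₀ u).inverse (frameCoord x₀ u a) = a := by
    intro a
    rw [← hA, ContinuousLinearMap.inverse_equiv]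
    exact A.symm_apply_apply a
  have hU := (contMDiffAt_frameCoord (n := n) (V := V) hxc).mdifferentiableAt
    (by simp : (∞ : WithTop ℕ∞) ≠ 0)
  have hf := (contMDiffAt_equivariantFunction hu hs).mdifferentiableAt
    (by simp : (∞ : WithTop ℕ∞) ≠ 0)
  have hs' := (contMDiffAt_sectionCoord hxc hs).mdifferentiableAt
    (by simp : (∞ : WithTop ℕ∞) ≠ 0)
  have hπ := (contMDiff_frameProj (n := n) u).mdifferentiableAt
    (by simp : (∞ : WithTop ℕ∞) ≠ 0)
  -- differentiate `Û f = ŝ ∘ π`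
  have h1 : (fun q : FrameSpace F T V => frameCoord x₀ q (equivariantFunction V s q)) =ᶠ[𝓝 u]
      fun q => toCoord F x₀ q.1 (s q.1) := by
    filter_upwards [eventually_bijective (n := n) hu] with q hq
    change toCoord F x₀ q.1 (frameMap q ((frameMap q).inverse (s q.1))) = _
    rw [frame_apply_inverse hq]
  have h2 := mvfderiv_congr (I := frameModel n F V) h1 ξ
  have h3 := mvfderiv_bilinear (ContinuousLinearMap.id ℝ (V →L[ℝ] F)) hU hf ξ
  have h4 : mvfderiv (frameModel n F V) (fun q : FrameSpace F T V => toCoord F x₀ q.1 (s q.1)) u ξ =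
      mvfderiv (𝓡 n) (fun y => toCoord F x₀ y (s y)) u.1 (frameProj n u ξ) := by
    have h5 := mfderiv_comp u hs' hπ
    exact congrArg (fun A : TangentSpace (frameModel n F V) u →L[ℝ] F => A ξ) h5
  rw [frame_inverse_apply hxc hu, toCoord_conn hx hs, ← h4, ← h2]
  refine (congrArg (fun a => (frameCoord x₀ u).inverse (a + _)) h3).trans ?_
  rw [connForm_apply]
  have h6 : frameCoord x₀ u (equivariantFunction V s u) = toCoord F x₀ u.1 (s u.1) :=
    h1.self_of_nhds
  rw [h6]
  change (frameCoord x₀ u).inverse (mvfderiv (frameModel n F V) (frameCoord x₀) u ξ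
    (equivariantFunction V s u) + frameCoord x₀ u _ + _) = _
  rw [add_right_comm, map_add _ (_ + _), hinv, add_comm]

end ConnectionForm

/-! ### Smoothness and uniqueness of the connection form -/

section ConnectionForm

variable {n : ℕ} {M : Type*} [TopologicalSpace M] [ChartedSpace (EuclideanSpace ℝ (Fin n)) M]
  {F : Type*} [NormedAddCommGroup F] [NormedSpace ℝ F]
  {T : M → Type*} [TopologicalSpace (TotalSpace F T)]
  [∀ x, AddCommGroup (T x)] [∀ x, Module ℝ (T x)] [∀ x, TopologicalSpace (T x)]
  [∀ x, IsTopologicalAddGroup (T x)] [∀ x, ContinuousSMul ℝ (T x)]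
  [FiberBundle F T] [VectorBundle ℝ F T]
  {V : Type*} [NormedAddCommGroup V] [NormedSpace ℂ V] [FiniteDimensional ℂ V]
  [ContMDiffVectorBundle ∞ F T (𝓡 n)]
  [FiniteDimensional ℝ F] [T2Space M] [IsManifold (𝓡 n) ∞ M]
  {D : CovariantDerivative (𝓡 n) F T}

variable (n F T V) in
/-- The invertible frames over the neighbourhood `sectionDomain n F T x₀` of `x₀`. -/
def frameDomain (x₀ : M) : Set (FrameSpace F T V) :=
  {u | u.1 ∈ sectionDomain n F T x₀ ∧ Function.Bijective (frameMap u)}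

theorem isOpen_frameDomain (x₀ : M) : IsOpen (frameDomain n F T V x₀) := by
  rw [isOpen_iff_mem_nhds]
  rintro u ⟨h1, h2⟩
  filter_upwards [(FiberBundle.continuous_proj _ _).continuousAt.preimage_mem_nhds
    ((isOpen_sectionDomain x₀).mem_nhds h1), eventually_bijective (n := n) h2] with q h3 h4
  exact ⟨h3, h4⟩

theorem mem_frameDomain_self {u : FrameSpace F T V} (hu : Function.Bijective (frameMap u)) :
    u ∈ frameDomain n F T V u.1 := ⟨self_mem_sectionDomain _, hu⟩

theorem exists_equivariantFunction_eq {u : FrameSpace F T V}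
    (hu : Function.Bijective (frameMap u)) (v : V) :
    ∃ s : (x : M) → T x, SmoothSection n F s ∧ equivariantFunction V s u = v := by
  obtain ⟨s, hs, h⟩ := exists_section_eq n F u.1 (frameMap u v)
  exact ⟨s, hs, by rw [equivariantFunction, h, frame_inverse_apply_self hu]⟩

/-- The connection form is the only endomorphism of `V` for which covariant derivatives are given
by derivatives of equivariant functions. -/
theorem eq_connForm {x₀ : M} {u : FrameSpace F T V} (hu : u ∈ frameDomain n F T V x₀)
    {ξ : TangentSpace (frameModel n F V) u} {A : V →L[ℝ] V}
    (hA : ∀ s : (x : M) → T x, SmoothSection n F s →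
      (frameMap u).inverse (D s u.1 (frameProj n u ξ)) =
        mvfderiv (frameModel n F V) (equivariantFunction V s) u ξ + A (equivariantFunction V s u)) :
    A = connForm V D x₀ u ξ := by
  ext v
  obtain ⟨s, hs, rfl⟩ := exists_equivariantFunction_eq (n := n) hu.2 v
  have h1 := hA s hs
  rw [inverse_conn hu.1 hu.2 ξ hs] at h1
  exact (add_left_cancel h1).symm

/-- By uniqueness, the connection form does not depend on the trivialization. -/
theorem connForm_eq {x₀ x₁ : M} {u : FrameSpace F T V} (h₀ : u ∈ frameDomain n F T V x₀)
    (h₁ : u ∈ frameDomain n F T V x₁) : connForm V D x₀ u = connForm V D x₁ u :=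
  ContinuousLinearMap.ext fun ξ => eq_connForm h₁ fun _ hs => inverse_conn h₀.1 h₀.2 ξ hs

theorem contMDiffOn_connForm (hD : CovariantDerivative.ContMDiffCovariantDerivative D ∞) (x₀ : M)
    {U : Set (FrameSpace F T V)} (hU : IsOpen U) (hUs : U ⊆ frameDomain n F T V x₀)
    {Y : (u : FrameSpace F T V) → TangentSpace (frameModel n F V) u}
    (hY : ContMDiffOn (frameModel n F V) (frameModel n F V).tangent ∞
      (fun u => (⟨u, Y u⟩ : TangentBundle (frameModel n F V) (FrameSpace F T V))) U) :
    ContMDiffOn (frameModel n F V) 𝓘(ℝ, V →L[ℝ] V) ∞ (fun u => connForm V D x₀ u (Y u)) U := by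
  have hxc : ∀ u ∈ U, u.1 ∈ coordDomain F T x₀ := fun u hu => sectionDomain_subset x₀ (hUs hu).1
  have hÛ : ContMDiffOn (frameModel n F V) 𝓘(ℝ, V →L[ℝ] F) ∞ (frameCoord x₀) U := fun u hu =>
    (contMDiffAt_frameCoord (hxc u hu)).contMDiffWithinAt
  have hinv : ContMDiffOn (frameModel n F V) 𝓘(ℝ, F →L[ℝ] V) ∞
      (fun q : FrameSpace F T V => (frameCoord x₀ q).inverse) U := fun u hu =>
    (contMDiffAt_frameCoord_inverse (hxc u hu) (hUs hu).2).contMDiffWithinAt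
  have hdÛ := contMDiffOn_mvfderiv hU hÛ hY
  have hproj : ContMDiffOn (frameModel n F V) (𝓡 n).tangent ∞
      (fun u => (⟨u.1, frameProj n u (Y u)⟩ : TangentBundle (𝓡 n) M)) U :=
    ((contMDiff_frameProj (n := n) (F := F) (T := T) (V := V)).contMDiff_tangentMap
      (by simp)).comp_contMDiffOn hY
  have hΓ : ∀ a : F, ContMDiffOn (frameModel n F V) 𝓘(ℝ, F) ∞
      (fun u : FrameSpace F T V =>
        toCoord F x₀ u.1 (D (globalSection n T x₀ a) u.1 (frameProj n u (Y u)))) U := by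
    intro a u hu
    have h1 := hD.contMDiff.contMDiff (σ := globalSection n T x₀ a)
      ((smooth_globalSection x₀ a).contMDiffOn.of_le (by simp))
    have h2 := (h1 u.1 trivial).contMDiffAt univ_mem |>.comp u (contMDiff_frameProj u)
    refine contMDiffWithinAt_toCoord (n := n) ?_ (hxc u hu)
    exact ContMDiffWithinAt.clm_bundle_apply (E₁ := fun x : M => TangentSpace (𝓡 n) x)
      (E₂ := T) h2.contMDiffWithinAt (hproj u hu)
  intro u hu
  refine contMDiffWithinAt_clm_of_apply fun v => ?_
  have h1 : ∀ q : FrameSpace F T V, connForm V D x₀ q (Y q) v = (frameCoord x₀ q).inverse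
      (mvfderiv (frameModel n F V) (frameCoord x₀) q (Y q) v +
        ∑ k, coeffs F k (frameCoord x₀ q v) • toCoord F x₀ q.1
          (D (globalSection n T x₀ (Module.finBasis ℝ F k)) q.1 (frameProj n q (Y q)))) := by
    intro q
    rw [connForm_apply, christoffel_apply]
  simp only [h1]
  refine (hinv u hu).clm_apply (((hdÛ u hu).clm_apply contMDiffWithinAt_const).add ?_)
  refine ContMDiffWithinAt.sum fun k _ => ?_
  have hc : ContMDiffWithinAt (frameModel n F V) 𝓘(ℝ, ℝ) ∞
      (fun q : FrameSpace F T V => coeffs F k (frameCoord x₀ q v)) U u :=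
    (coeffs F k).contMDiff.contMDiffAt.comp_contMDiffWithinAt u
      ((hÛ u hu).clm_apply contMDiffWithinAt_const)
  exact hc.smul (hΓ _ u hu)

end ConnectionForm

/-! ### Values of the connection form on the reduced bundle -/

section Multilinear

theorem mvfderiv_multilinear {E' : Type*} [NormedAddCommGroup E'] [NormedSpace ℝ E']
    {H' : Type*} [TopologicalSpace H'] {I : ModelWithCorners ℝ E' H'}
    {X : Type*} [TopologicalSpace X] [ChartedSpace H' X] {m : ℕ}
    {G₁ G : Type*} [NormedAddCommGroup G₁] [NormedSpace ℝ G₁] [NormedAddCommGroup G]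
    [NormedSpace ℝ G] (Ψ : ContinuousMultilinearMap ℝ (fun _ : Fin m => G₁) G) {f : Fin m → X → G₁}
    {x : X} (hf : ∀ i, MDifferentiableAt I 𝓘(ℝ, G₁) (f i) x) (ξ : TangentSpace I x) :
    MDifferentiableAt I 𝓘(ℝ, G) (fun y => Ψ fun i => f i y) x ∧
    mvfderiv I (fun y => Ψ fun i => f i y) x ξ =
      ∑ i, Ψ (Function.update (fun j => f j x) i (mvfderiv I (f i) x ξ)) := by
  have hp : MDifferentiableAt I 𝓘(ℝ, Fin m → G₁) (fun y i => f i y) x :=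
    (mdifferentiableAt_iff ..).mpr ⟨continuousAt_pi.mpr fun i => (hf i).continuousAt,
      differentiableWithinAt_pi.mpr fun i => ((mdifferentiableAt_iff ..).mp (hf i)).2⟩
  have h1 := (Ψ.hasFDerivAt (x := fun i => f i x)).hasMFDerivAt.comp x hp.hasMFDerivAt
  refine ⟨h1.mdifferentiableAt, ?_⟩
  have h2 : mvfderiv I (fun y => Ψ fun i => f i y) x ξ =
      Ψ.linearDeriv (fun i => f i x) (mvfderiv I (fun y i => f i y) x ξ) :=
    congrArg (fun A : TangentSpace I x →L[ℝ] G => A ξ) h1.mfderiv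
  rw [h2, ContinuousMultilinearMap.linearDeriv_apply]
  have h3 : ∀ i, (mvfderiv I (fun y i => f i y) x ξ) i = mvfderiv I (f i) x ξ := fun i =>
    (mvfderiv_clm_comp (ContinuousLinearMap.proj (R := ℝ) (φ := fun _ : Fin m => G₁) i) hp ξ).symm
  simp only [h3]

/-- The determinant of a complex basis, as a real multilinear map. -/
def detMultilinear {V : Type*} [NormedAddCommGroup V] [NormedSpace ℂ V] [FiniteDimensional ℂ V]
    {m : ℕ} (b : Module.Basis (Fin m) ℂ V) : ContinuousMultilinearMap ℝ (fun _ : Fin m => V) ℂ :=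
  { b.det.toMultilinearMap.restrictScalars ℝ with cont := (contDiff_basis_det b).continuous }

theorem ιMulti_map_eq {V W : Type*} [AddCommGroup V] [Module ℂ V] [AddCommGroup W] [Module ℂ W]
    {m : ℕ} (b : Module.Basis (Fin m) ℂ V) (U : V ≃ₗ[ℂ] W) (w : Fin m → V) :
    exteriorPower.ιMulti ℂ m (fun i => U (w i)) =
      b.det w • exteriorPower.ιMulti ℂ m (fun i => U (b i)) := by
  have h1 := ιMulti_eq_det_smul (b.map U) fun i => U (w i)
  have h2 : (b.map U).det (fun i => U (w i)) = b.det w := by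
    rw [Module.Basis.det_map]
    congr 1
    funext i
    exact U.symm_apply_apply _
  rw [h1, h2]
  congr 2

theorem ιMulti_ne_zero_of_equiv {W W' : Type*} [AddCommGroup W] [Module ℂ W] [AddCommGroup W']
    [Module ℂ W'] {m : ℕ} (b : Module.Basis (Fin m) ℂ W) (U : W ≃ₗ[ℂ] W') :
    exteriorPower.ιMulti ℂ m (fun i => U (b i)) ≠ 0 := by
  have := ιMulti_basis_ne_zero (b.map U)
  rwa [show ((b.map U : Module.Basis (Fin m) ℂ W') : Fin m → W') =
    fun i => U (b i) from funext fun i => b.map_apply U i] at this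

end Multilinear

section Values

variable {n : ℕ} {M : Type*} [TopologicalSpace M] [ChartedSpace (EuclideanSpace ℝ (Fin n)) M]
  {F : Type*} [NormedAddCommGroup F] [NormedSpace ℝ F]
  {T : M → Type*} [TopologicalSpace (TotalSpace F T)]
  [∀ x, AddCommGroup (T x)] [∀ x, Module ℝ (T x)] [∀ x, TopologicalSpace (T x)]
  [∀ x, IsTopologicalAddGroup (T x)] [∀ x, ContinuousSMul ℝ (T x)]
  [FiberBundle F T] [VectorBundle ℝ F T]
  {V : Type*} [NormedAddCommGroup V] [NormedSpace ℂ V] [FiniteDimensional ℂ V]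
  [ContMDiffVectorBundle ∞ F T (𝓡 n)]
  [FiniteDimensional ℝ F] [T2Space M] [IsManifold (𝓡 n) ∞ M]
  {r s : ℕ} {c : ConformalStructure n M r s} {𝒯 : StandardTractorBundle F T c}
  {B : V →ₗ⋆[ℂ] V →ₗ[ℂ] ℂ} {L : Submodule ℝ V}

theorem form_eq_re {u : FrameSpace F T V} (hu : u ∈ cartanBundle 𝒯 B L) (v w : T u.1) :
    𝒯.metric.form u.1 v w = (B ((frameMap u).inverse v) ((frameMap u).inverse w)).re := by
  rw [← hu.2.1, frame_apply_inverse hu.1, frame_apply_inverse hu.1]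

/-- The function `Re ⟨f_s, f_t⟩ - h(s, t)` of the frames vanishes on the Cartan bundle. Its
derivative expresses the skew symmetry of the connection form, because `h` is parallel. -/
theorem connForm_mem_so {x₀ : M} {u : FrameSpace F T V} (hu : u ∈ cartanBundle 𝒯 B L)
    (hx : u.1 ∈ sectionDomain n F T x₀) {ξ : TangentSpace (frameModel n F V) u}
    (hξ : ξ ∈ tangentTo (frameModel n F V) (cartanBundle 𝒯 B L) u) :
    connForm V 𝒯.conn x₀ u ξ ∈ so B := by
  intro v w
  obtain ⟨s, hs, rfl⟩ := exists_equivariantFunction_eq (n := n) hu.1 v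
  obtain ⟨t, ht, rfl⟩ := exists_equivariantFunction_eq (n := n) hu.1 w
  let Φ : V →L[ℝ] V →L[ℝ] ℝ := (reForm B).toContinuousBilinearMap
  have hΦ : ∀ v w, Φ v w = (B v w).re := fun v w => rfl
  have hfs := (contMDiffAt_equivariantFunction hu.1 hs).mdifferentiableAt
    (by simp : (∞ : WithTop ℕ∞) ≠ 0)
  have hft := (contMDiffAt_equivariantFunction hu.1 ht).mdifferentiableAt
    (by simp : (∞ : WithTop ℕ∞) ≠ 0)
  have hst := (contMDiff_form 𝒯.metric hs ht).contMDiffAt (x := u.1) |>.mdifferentiableAt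
    (by simp : (∞ : WithTop ℕ∞) ≠ 0)
  have hpr := (contMDiff_frameProj (n := n) (V := V) (F := F) (T := T) u).mdifferentiableAt
    (by simp : (∞ : WithTop ℕ∞) ≠ 0)
  have h1 : MDifferentiableAt (frameModel n F V) 𝓘(ℝ, ℝ)
      (fun q => Φ (equivariantFunction V s q) (equivariantFunction V t q)) u :=
    ((Φ.mdifferentiableAt.comp u hfs).clm_apply hft :)
  have h2 := hst.comp u hpr
  have h3 := mvfderiv_eq_zero_of_tangentTo (I := frameModel n F V) (h1.sub h2) (c := (0 : ℝ))
    (Eventually.of_forall fun q (hq : q ∈ cartanBundle 𝒯 B L) => by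
      change (B _ _).re - 𝒯.metric.form q.1 (s q.1) (t q.1) = 0
      rw [form_eq_re hq]
      exact sub_self _) hξ
  have h4 := mvfderiv_sub (I := frameModel n F V) h1 h2
  have h5 : mvfderiv (frameModel n F V)
      ((fun y => 𝒯.metric.form y (s y) (t y)) ∘ fun q : FrameSpace F T V => q.1) u ξ =
      mvfderiv (𝓡 n) (fun y => 𝒯.metric.form y (s y) (t y)) u.1 (frameProj n u ξ) :=
    congrArg (fun A : TangentSpace (frameModel n F V) u →L[ℝ] ℝ => A ξ) (mfderiv_comp u hst hpr)
  have h6 : mvfderiv (𝓡 n) (fun y => 𝒯.metric.form y (s y) (t y)) u.1 (frameProj n u ξ) =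
      𝒯.metric.form u.1 (𝒯.conn s u.1 (frameProj n u ξ)) (t u.1) +
        𝒯.metric.form u.1 (s u.1) (𝒯.conn t u.1 (frameProj n u ξ)) :=
    𝒯.conn_metric s t hs ht u.1 (frameProj n u ξ)
  have h7 := mvfderiv_bilinear (I := frameModel n F V) Φ hfs hft ξ
  rw [form_eq_re hu (𝒯.conn s u.1 _), form_eq_re hu (s u.1), inverse_conn hx hu.1 ξ hs,
    inverse_conn hx hu.1 ξ ht] at h6
  have h8 : mvfderiv (frameModel n F V)
      (fun q => Φ (equivariantFunction V s q) (equivariantFunction V t q)) u ξ -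
      mvfderiv (frameModel n F V)
      ((fun y => 𝒯.metric.form y (s y) (t y)) ∘ fun q : FrameSpace F T V => q.1) u ξ = 0 := by
    rw [← h3]
    exact congrArg (fun A : TangentSpace (frameModel n F V) u →L[ℝ] ℝ => A ξ) h4.symm
  rw [h7, h5, h6] at h8
  simp only [map_add, LinearMap.add_apply, Complex.add_re] at h8
  change (B _ (equivariantFunction V t u)).re + (B (equivariantFunction V s u) _).re - _ = 0 at h8
  change _ + _ - ((B _ (equivariantFunction V t u)).re + (B _ (equivariantFunction V t u)).re +
    ((B (equivariantFunction V s u) _).re + (B (equivariantFunction V s u) _).re)) = 0 at h8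
  linarith

theorem ComplexFiber.I_smul {W : Type*} [AddCommGroup W] [Module ℝ W] [TopologicalSpace W]
    {J : W →L[ℝ] W} {hJ : ∀ w, J (J w) = -w} (w : W) :
    Complex.I • ComplexFiber.of J hJ w = ComplexFiber.of J hJ (J w) := by
  change complexSMul J Complex.I w = J w
  simp [complexSMul]

variable {J : OrthogonalComplexStructure 𝒯.metric} {m : ℕ} {ν₀ : ⋀[ℂ]^m V}
  {ν : (x : M) → ⋀[ℂ]^m (J.Fiber x)}

theorem suBundle_complex {u : FrameSpace F T V} (hu : u ∈ suBundle 𝒯 B L J ν₀ ν) (v : V) :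
    frameMap u (Complex.I • v) = J.endo u.1 (frameMap u v) := by
  obtain ⟨-, uC, huC, -⟩ := hu
  have h1 := uC.map_smul Complex.I v
  rw [huC, huC, ComplexFiber.I_smul] at h1
  exact h1

theorem suBundle_inverse_complex {u : FrameSpace F T V} (hu : u ∈ suBundle 𝒯 B L J ν₀ ν)
    (v : T u.1) :
    (frameMap u).inverse (J.endo u.1 v) = Complex.I • (frameMap u).inverse v := by
  apply hu.1.1.1
  rw [suBundle_complex hu, frame_apply_inverse hu.1.1, frame_apply_inverse hu.1.1]

/-- A point of the reduced bundle is a complex linear isomorphism. -/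
theorem exists_suEquiv {u : FrameSpace F T V} (hu : u ∈ suBundle 𝒯 B L J ν₀ ν) :
    ∃ U : V ≃ₗ[ℂ] J.Fiber u.1,
      (∀ v, U v = ComplexFiber.of (J.endo u.1) (J.sq u.1) (frameMap u v)) ∧
      exteriorPower.map m (U : V →ₗ[ℂ] J.Fiber u.1) ν₀ = ν u.1 := by
  obtain ⟨⟨hbij, -⟩, uC, huC, hν⟩ := hu
  have h1 : Function.Bijective uC := by
    have : (uC : V → J.Fiber u.1) =
        fun v => ComplexFiber.of (J.endo u.1) (J.sq u.1) (frameMap u v) := funext huC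
    rw [this]
    exact hbij
  exact ⟨LinearEquiv.ofBijective uC h1, huC, hν⟩

/-- The frames of the reduced bundle identify the volume elements: if `ν = w₁ ∧ ⋯ ∧ w_m`, then the
preimages of the vectors `w_i` have the same determinant as `ν₀`. -/
theorem suBundle_det {b : Module.Basis (Fin m) ℂ V} {c₀ : ℂ}
    (hc : ν₀ = c₀ • exteriorPower.ιMulti ℂ m b) {u : FrameSpace F T V}
    (hu : u ∈ suBundle 𝒯 B L J ν₀ ν) {w : Fin m → T u.1}
    (hw : ν u.1 = exteriorPower.ιMulti ℂ m
      (fun i => ComplexFiber.of (J.endo u.1) (J.sq u.1) (w i))) :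
    b.det (fun i => (frameMap u).inverse (w i)) = c₀ := by
  obtain ⟨U, hU, hν⟩ := exists_suEquiv hu
  have h1 := ιMulti_map_eq b U fun i => (frameMap u).inverse (w i)
  have h2 : (fun i => U ((frameMap u).inverse (w i))) =
      fun i => ComplexFiber.of (J.endo u.1) (J.sq u.1) (w i) := by
    funext i
    rw [hU, frame_apply_inverse hu.1.1]
  have h3 : exteriorPower.ιMulti ℂ m (fun i => U (b i)) ≠ 0 := ιMulti_ne_zero_of_equiv b U
  rw [h2, ← hw, ← hν, hc, map_smul, exteriorPower.map_apply_ιMulti] at h1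
  exact (smul_left_injective ℂ h3 h1).symm

/-- On the reduced bundle, `f_{J s} = i f_s`, and the determinant of the functions of sections `e_i`
with `ν = e₁ ∧ ⋯ ∧ e_m` is constant. Since `J` and `ν` are parallel, differentiation shows that the
connection form is complex linear and trace-free. -/
theorem connForm_mem_su (hJ : J.IsParallel 𝒯.conn) (hν : IsParallelTop J 𝒯.conn ν)
    (b : Module.Basis (Fin m) ℂ V) (hν₀ : ν₀ ≠ 0) {x₀ : M} {u : FrameSpace F T V}
    (hu : u ∈ suBundle 𝒯 B L J ν₀ ν) (hx : u.1 ∈ sectionDomain n F T x₀)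
    {ξ : TangentSpace (frameModel n F V) u}
    (hξ : ξ ∈ tangentTo (frameModel n F V) (suBundle 𝒯 B L J ν₀ ν) u) :
    connForm V 𝒯.conn x₀ u ξ ∈ su B := by
  set η := connForm V 𝒯.conn x₀ u ξ
  have hso := connForm_mem_so hu.1 hx (tangentTo_mono _ (suBundle_subset 𝒯 B L J ν₀ ν) u hξ)
  have hI : ∀ v, η (Complex.I • v) = Complex.I • η v := by
    intro v
    obtain ⟨s, hs, rfl⟩ := exists_equivariantFunction_eq (n := n) hu.1.1 v
    have hJs := smoothSection_endo J hs
    have hfs := (contMDiffAt_equivariantFunction hu.1.1 hs).mdifferentiableAt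
      (by simp : (∞ : WithTop ℕ∞) ≠ 0)
    have hfJ := (contMDiffAt_equivariantFunction hu.1.1 hJs).mdifferentiableAt
      (by simp : (∞ : WithTop ℕ∞) ≠ 0)
    have hIf : MDifferentiableAt (frameModel n F V) 𝓘(ℝ, V)
        (fun q => mulI V (equivariantFunction V s q)) u :=
      (mulI V).mdifferentiableAt.comp u hfs
    have key : ∀ q ∈ suBundle 𝒯 B L J ν₀ ν, equivariantFunction V (fun x => J.endo x (s x)) q =
        mulI V (equivariantFunction V s q) := fun q hq => suBundle_inverse_complex hq _
    have h3 := mvfderiv_eq_zero_of_tangentTo (I := frameModel n F V) (hfJ.sub hIf) (c := (0 : V))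
      (Eventually.of_forall fun q hq => sub_eq_zero.mpr (key q hq)) hξ
    have h4 := mvfderiv_sub (I := frameModel n F V) hfJ hIf
    rw [h4] at h3
    have h5 : mvfderiv (frameModel n F V) (equivariantFunction V fun x => J.endo x (s x)) u ξ =
        Complex.I • mvfderiv (frameModel n F V) (equivariantFunction V s) u ξ := by
      have h6 := mvfderiv_clm_comp (I := frameModel n F V) (mulI V) hfs ξ
      rw [mulI_apply] at h6
      rw [← h6]
      exact sub_eq_zero.mp h3
    have h7 := inverse_conn (D := 𝒯.conn) hx hu.1.1 ξ hJs
    rw [hJ s hs, suBundle_inverse_complex hu, inverse_conn hx hu.1.1 ξ hs, h5, key u hu, smul_add]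
      at h7
    exact (add_left_cancel h7).symm
  let ηC : V →ₗ[ℂ] V := complexify (η : V →ₗ[ℝ] V) hI
  refine ⟨fun v w => ?_, ηC, fun v => rfl, ?_⟩
  · have h1 : B (η v) w = (-B) v (η w) := by
      refine eq_of_re_eq fun z => ?_
      have h2 := hso v (z • w)
      have h3 : η (z • w) = z • η w := ηC.map_smul z w
      rw [h3] at h2
      simp only [LinearMap.neg_apply, Complex.neg_re]
      linarith
    rw [h1]
    simp
  · obtain ⟨c₀, hc⟩ := exists_eq_smul_ιMulti b ν₀
    have hc₀ : c₀ ≠ 0 := by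
      rintro rfl
      exact hν₀ (by rw [hc, zero_smul])
    obtain ⟨e, he, hev⟩ := hν u.1
    have hf : ∀ i, MDifferentiableAt (frameModel n F V) 𝓘(ℝ, V) (equivariantFunction V (e i)) u :=
      fun i => (contMDiffAt_equivariantFunction hu.1.1 (he i)).mdifferentiableAt
        (by simp : (∞ : WithTop ℕ∞) ≠ 0)
    obtain ⟨h1, h2⟩ := mvfderiv_multilinear (I := frameModel n F V) (detMultilinear b) hf ξ
    have h3 := mvfderiv_eq_zero_of_tangentTo (I := frameModel n F V) h1 (c := c₀)
      (((FiberBundle.continuous_proj _ _).continuousAt.eventually hev).mono fun q hq hqS =>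
        suBundle_det hc hqS hq.1) hξ
    rw [h2] at h3
    have hdet : b.det (fun i => equivariantFunction V (e i) u) = c₀ :=
      suBundle_det hc hu hev.self_of_nhds.1
    -- the covariant derivative of `ν` vanishes
    have h4 : ∑ i, b.det (Function.update (fun j => equivariantFunction V (e j) u) i
        ((frameMap u).inverse (𝒯.conn (e i) u.1 (frameProj n u ξ)))) = 0 := by
      obtain ⟨U, hU, -⟩ := exists_suEquiv hu
      have h5 := hev.self_of_nhds.2 (frameProj n u ξ)
      have h6 : ∀ i, Function.update
          (fun j => ComplexFiber.of (J.endo u.1) (J.sq u.1) (e j u.1)) i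
          (ComplexFiber.of (J.endo u.1) (J.sq u.1) (𝒯.conn (e i) u.1 (frameProj n u ξ))) =
          fun j => U (Function.update (fun j => equivariantFunction V (e j) u) i
            ((frameMap u).inverse (𝒯.conn (e i) u.1 (frameProj n u ξ))) j) := by
        intro i
        funext j
        rcases eq_or_ne j i with rfl | hji
        · rw [Function.update_self, Function.update_self, hU, frame_apply_inverse hu.1.1]
        · rw [Function.update_of_ne hji, Function.update_of_ne hji, hU, equivariantFunction,
            frame_apply_inverse hu.1.1]
      rw [Finset.sum_congr rfl fun i _ => (congrArg _ (h6 i)).trans (ιMulti_map_eq b U _),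
        ← Finset.sum_smul] at h5
      exact (smul_eq_zero.mp h5).resolve_right (ιMulti_ne_zero_of_equiv b U)
    -- the functions `f_{e_i}(u)` form a basis `b'`, in which `tr η` is computed
    obtain ⟨hli, hsp⟩ := (Module.Basis.is_basis_iff_det b
      (v := fun i => equivariantFunction V (e i) u)).mpr (by rw [hdet]; exact hc₀.isUnit)
    let b' : Module.Basis (Fin m) ℂ V := Module.Basis.mk hli hsp.ge
    have hb' : (b' : Fin m → V) = fun i => equivariantFunction V (e i) u :=
      Module.Basis.coe_mk hli hsp.ge
    have h7 := sum_update_eq_trace b.det b' ηC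
    rw [hb', hdet] at h7
    have h8 : ∀ i, b.det (Function.update (fun j => equivariantFunction V (e j) u) i
        (ηC (b' i))) =
        b.det (Function.update (fun j => equivariantFunction V (e j) u) i
          ((frameMap u).inverse (𝒯.conn (e i) u.1 (frameProj n u ξ)))) -
        detMultilinear b (Function.update (fun j => equivariantFunction V (e j) u) i
          (mvfderiv (frameModel n F V) (equivariantFunction V (e i)) u ξ)) := by
      intro i
      rw [inverse_conn hx hu.1.1 ξ (he i), AlternatingMap.map_update_add, hb']
      exact (add_sub_cancel_left _ _).symm
    have h9 : ∑ i, b.det (Function.update (fun j => equivariantFunction V (e j) u) i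
        (ηC (b' i))) = 0 := by
      simp only [h8]
      rw [Finset.sum_sub_distrib, h4, h3, sub_zero]
    rw [← hb'] at h9
    rw [← hb', h9] at h7
    exact (smul_eq_zero.mp h7.symm).resolve_right hc₀

end Values

/-! ### The canonical Cartan connection -/

section Canonical

variable {n : ℕ} {M : Type*} [TopologicalSpace M] [ChartedSpace (EuclideanSpace ℝ (Fin n)) M]
  {F : Type*} [NormedAddCommGroup F] [NormedSpace ℝ F]
  {T : M → Type*} [TopologicalSpace (TotalSpace F T)]
  [∀ x, AddCommGroup (T x)] [∀ x, Module ℝ (T x)] [∀ x, TopologicalSpace (T x)]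
  [∀ x, IsTopologicalAddGroup (T x)] [∀ x, ContinuousSMul ℝ (T x)]
  [FiberBundle F T] [VectorBundle ℝ F T]
  {V : Type*} [NormedAddCommGroup V] [NormedSpace ℂ V] [FiniteDimensional ℂ V]
  [ContMDiffVectorBundle ∞ F T (𝓡 n)]
  [FiniteDimensional ℝ F] [T2Space M] [IsManifold (𝓡 n) ∞ M]
  {r s : ℕ} {c : ConformalStructure n M r s} {𝒯 : StandardTractorBundle F T c}
  {B : V →ₗ⋆[ℂ] V →ₗ[ℂ] ℂ} {L : Submodule ℝ V}

variable (𝒯 B L) in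
/-- The canonical Cartan connection: at each frame it is the connection form in the preferred
trivialization at the base point. -/
def canonicalForm : OneFormOn (frameModel n F V) (cartanBundle 𝒯 B L) (so B) := fun u =>
  LinearMap.codRestrict (so B)
    ((connForm V 𝒯.conn (u : FrameSpace F T V).1 (u : FrameSpace F T V) :
      TangentSpace (frameModel n F V) (u : FrameSpace F T V) →ₗ[ℝ] (V →L[ℝ] V)).comp
      (tangentTo (frameModel n F V) (cartanBundle 𝒯 B L) (u : FrameSpace F T V)).subtype)
    fun ξ => connForm_mem_so u.2 (self_mem_sectionDomain _) ξ.2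

theorem isCanonicalCartanConnection_canonicalForm :
    IsCanonicalCartanConnection 𝒯 B L (canonicalForm 𝒯 B L) where
  smooth u₀ hu₀ := ⟨frameDomain n F T V u₀.1, isOpen_frameDomain _, mem_frameDomain_self hu₀.1,
    connForm V 𝒯.conn u₀.1, fun _ hY =>
      contMDiffOn_connForm 𝒯.conn_smooth u₀.1 (isOpen_frameDomain _) subset_rfl hY,
    fun u hu ξ => congrArg (fun A : TangentSpace (frameModel n F V) (u : FrameSpace F T V) →L[ℝ]
      (V →L[ℝ] V) => A ξ) (connForm_eq hu (mem_frameDomain_self u.2.1))⟩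
  connection u ξ _ hs := inverse_conn (self_mem_sectionDomain _) u.2.1 ξ hs

/-- A canonical Cartan connection is given by the connection form. -/
theorem IsCanonicalCartanConnection.apply_eq
    {θ : OneFormOn (frameModel n F V) (cartanBundle 𝒯 B L) (so B)}
    (hθ : IsCanonicalCartanConnection 𝒯 B L θ) {x₀ : M} (u : cartanBundle 𝒯 B L)
    (hu : (u : FrameSpace F T V).1 ∈ sectionDomain n F T x₀)
    (ξ : tangentTo (frameModel n F V) (cartanBundle 𝒯 B L) (u : FrameSpace F T V)) :
    (θ u ξ : V →L[ℝ] V) = connForm V 𝒯.conn x₀ (u : FrameSpace F T V) ξ :=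
  eq_connForm ⟨hu, u.2.1⟩ fun s hs => hθ.connection u ξ s hs

variable (𝒯 B L) in
theorem existsUnique_canonicalCartanConnection :
    ∃! θ : OneFormOn (frameModel n F V) (cartanBundle 𝒯 B L) (so B),
      IsCanonicalCartanConnection 𝒯 B L θ := by
  refine ⟨canonicalForm 𝒯 B L, isCanonicalCartanConnection_canonicalForm, fun θ hθ => ?_⟩
  funext u
  ext1 ξ
  apply Subtype.ext
  exact hθ.apply_eq u (self_mem_sectionDomain _) ξ

end Canonical

/-! ### The Hermitian form of a fibre -/

section HermitianForm

variable {W : Type*} [AddCommGroup W] [Module ℝ W] [TopologicalSpace W]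

/-- The Hermitian extension of a symmetric form for which `J` is orthogonal, as a sesquilinear
form on the complex vector space `(W, J)`. -/
def hermitianForm (b : W →L[ℝ] W →L[ℝ] ℝ) (J : W →L[ℝ] W) (hJ : ∀ w, J (J w) = -w)
    (hb : ∀ v w, b (J v) (J w) = b v w) :
    ComplexFiber J hJ →ₗ⋆[ℂ] ComplexFiber J hJ →ₗ[ℂ] ℂ :=
  LinearMap.mk₂'ₛₗ (starRingEnd ℂ) (RingHom.id ℂ)
    (hermitianExtension (W := W) (fun v w => b v w) J)
    ((fun v v' w => by
      simp only [hermitianExtension, map_add, add_apply, Complex.ofReal_add]; ring :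
      ∀ v v' w : W, hermitianExtension (fun v w => b v w) J (v + v') w =
        hermitianExtension (fun v w => b v w) J v w +
        hermitianExtension (fun v w => b v w) J v' w))
    ((fun z v w => by
      have h1 : b (J v) w = - b v (J w) := by
        rw [← hb, hJ, map_neg, neg_apply]
      simp only [hermitianExtension, complexSMul, map_add, map_smul, add_apply, smul_apply, h1, hb,
        smul_eq_mul, Complex.ofReal_add, Complex.ofReal_mul, Complex.ofReal_neg]
      apply Complex.ext <;> simp <;> ring :
      ∀ (z : ℂ) (v w : W), hermitianExtension (fun v w => b v w) J (complexSMul J z v) w =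
        (starRingEnd ℂ) z * hermitianExtension (fun v w => b v w) J v w))
    ((fun v w w' => by
      simp only [hermitianExtension, map_add, Complex.ofReal_add]; ring :
      ∀ v w w' : W, hermitianExtension (fun v w => b v w) J v (w + w') =
        hermitianExtension (fun v w => b v w) J v w +
        hermitianExtension (fun v w => b v w) J v w'))
    ((fun z v w => by
      simp only [hermitianExtension, complexSMul, map_add, map_smul, hJ,
        smul_eq_mul, Complex.ofReal_add, Complex.ofReal_mul, map_neg, Complex.ofReal_neg]
      apply Complex.ext <;> simp <;> ring :
      ∀ (z : ℂ) (v w : W), hermitianExtension (fun v w => b v w) J v (complexSMul J z w) =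
        z * hermitianExtension (fun v w => b v w) J v w))

theorem hermitianExtension_symm {W : Type*} [AddCommGroup W] [Module ℝ W] {b : W →ₗ[ℝ] W →ₗ[ℝ] ℝ}
    {J : W → W} (hJ : ∀ w, J (J w) = -w) (hs : ∀ v w, b v w = b w v)
    (hb : ∀ v w, b (J v) (J w) = b v w) (v w : W) :
    hermitianExtension (fun v w => b v w) J v w =
      starRingEnd ℂ (hermitianExtension (fun v w => b v w) J w v) := by
  have h1 : b v (J w) = - b w (J v) := by
    rw [hs v, ← hb, hJ]; simp
  simp only [hermitianExtension, h1]
  rw [hs v w]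
  apply Complex.ext <;> simp

/-- The identity of `W` as a real linear isomorphism to `(W, J)`. -/
def ComplexFiber.ofEquiv (J : W →L[ℝ] W) (hJ : ∀ w, J (J w) = -w) : W ≃ₗ[ℝ] ComplexFiber J hJ where
  toFun := ComplexFiber.of J hJ
  invFun w := w
  left_inv _ := rfl
  right_inv _ := rfl
  map_add' _ _ := rfl
  map_smul' r w := by
    change r • w = complexSMul J (r : ℂ) w
    simp [complexSMul]

theorem hasSignature_hermitianForm {b : W →L[ℝ] W →L[ℝ] ℝ} {J : W →L[ℝ] W}
    (hJ : ∀ w, J (J w) = -w) (hb : ∀ v w, b (J v) (J w) = b v w) {r s : ℕ}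
    (h : HasSignature (fun v w => b v w) r s) :
    HasSignature (fun v w => (hermitianForm b J hJ hb v w).re) r s := by
  obtain ⟨e, he⟩ := h
  refine ⟨e.map (ComplexFiber.ofEquiv J hJ), fun i j => ?_⟩
  rw [Module.Basis.map_apply, Module.Basis.map_apply, ← he i j]
  change (hermitianExtension (W := W) (fun v w => b v w) J (e i) (e j)).re = _
  simp [hermitianExtension]

theorem HasSignature.eq_zero {W : Type*} [AddCommGroup W] [Module ℝ W] {b : W →ₗ[ℝ] W →ₗ[ℝ] ℝ}
    {r s : ℕ} (h : HasSignature (fun v w => b v w) r s) {v : W} (hv : ∀ w, b v w = 0) : v = 0 := by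
  obtain ⟨e, he⟩ := h
  refine e.ext_elem fun j => ?_
  have h1 : b v (e j) = e.repr v j * Sum.elim (fun _ => 1) (fun _ => -1) j := by
    have h2 : ∀ i, b (e i) (e j) = if i = j then Sum.elim (fun _ => 1) (fun _ => -1) i else 0 :=
      fun i => he i j
    conv_lhs => rw [← e.sum_repr v]
    simp only [map_sum, map_smul, LinearMap.sum_apply, LinearMap.smul_apply, h2, smul_eq_mul,
      mul_ite, mul_zero, Finset.sum_ite_eq', Finset.mem_univ, if_true]
  rw [hv] at h1
  rw [map_zero, Finsupp.zero_apply]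
  refine (mul_eq_zero.mp h1.symm).resolve_right ?_
  rcases j with j | j <;> simp

/-- The Hermitian extension is nondegenerate because its real part is. -/
theorem nondegenerateOn_hermitianForm {b : W →L[ℝ] W →L[ℝ] ℝ} {J : W →L[ℝ] W}
    (hJ : ∀ w, J (J w) = -w) (hb : ∀ v w, b (J v) (J w) = b v w) {r s : ℕ}
    (h : HasSignature (fun v w => b v w) r s) :
    NondegenerateOn (hermitianForm b J hJ hb) ⊤ := by
  intro v _ hv
  refine HasSignature.eq_zero (W := W) (b := ((ContinuousLinearMap.coeLM ℝ).comp b.toLinearMap))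
    h fun w => ?_
  have h1 := congrArg Complex.re (hv w trivial)
  change (hermitianExtension (W := W) (fun v w => b v w) J v w).re = _ at h1
  change b (v : W) w = 0
  simpa [hermitianExtension] using h1

/-- The expansion of `d det (H(w_i, w_j))`: it vanishes if the volume element
`w₁ ∧ ⋯ ∧ w_m` has vanishing derivative. -/
theorem sum_det_gram_update {W : Type*} [AddCommGroup W] [Module ℂ W] {H : W →ₗ⋆[ℂ] W →ₗ[ℂ] ℂ}
    (hH : ∀ x y, H x y = starRingEnd ℂ (H y x)) {m : ℕ} (w d : Fin m → W)
    (h : ∑ i, exteriorPower.ιMulti ℂ m (Function.update w i (d i)) = 0) :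
    ∑ i, ((Matrix.of fun i j => H (w i) (w j)).updateRow i
      fun j => H (d i) (w j) + H (w i) (d j)).det = 0 := by
  let G : Matrix (Fin m) (Fin m) ℂ := Matrix.of fun i j => H (w i) (w j)
  -- `A v = det (H(w_i, v_j))` is an alternating function of `v`
  let A : W [⋀^Fin m]→ₗ[ℂ] ℂ := Matrix.detRowAlternating.compLinearMap
    (LinearMap.pi fun i => H (w i))
  have hA : ∀ v : Fin m → W, A v = (Matrix.of fun i j => H (w i) (v j)).det := fun v => by
    rw [← Matrix.det_transpose]
    rfl
  have hA0 : ∑ i, A (Function.update w i (d i)) = 0 := by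
    have h1 := congrArg (exteriorPower.alternatingMapLinearEquiv A) h
    rw [map_sum, map_zero] at h1
    simpa only [exteriorPower.alternatingMapLinearEquiv_apply_ιMulti] using h1
  have h2 : ∀ i, (G.updateRow i fun j => H (d i) (w j)).det =
      starRingEnd ℂ (A (Function.update w i (d i))) := by
    intro i
    rw [hA, RingHom.map_det, ← Matrix.det_transpose]
    congr 1
    ext k j
    simp only [Matrix.transpose_apply, RingHom.mapMatrix_apply, Matrix.map_apply, Matrix.of_apply,
      ← hH]
    rcases eq_or_ne j i with rfl | hji
    · simp
    · simp [Matrix.updateRow_ne hji, Function.update_of_ne hji, G]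
  -- both sides are the trace of the product of the adjugate of `G` with `(H (w_i, d_j))`
  have h3 : ∑ i, (G.updateRow i fun j => H (w i) (d j)).det =
      ∑ j, (G.updateCol j fun i => H (w i) (d j)).det := by
    have h4 : ∀ (A : Matrix (Fin m) (Fin m) ℂ) v i, A.cramer v i = ∑ j, A.adjugate i j * v j :=
      fun A v i => by rw [Matrix.cramer_eq_adjugate_mulVec]; rfl
    simp only [← Matrix.cramer_transpose_apply, ← Matrix.cramer_apply, h4,
      ← Matrix.adjugate_transpose, Matrix.transpose_apply]
    exact Finset.sum_comm
  have h4 : ∀ j, (G.updateCol j fun i => H (w i) (d j)).det = A (Function.update w j (d j)) := by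
    intro j
    rw [hA]
    congr 1
    ext i k
    rcases eq_or_ne k j with rfl | hkj
    · simp
    · simp [Matrix.updateCol_ne hkj, Function.update_of_ne hkj, G]
  have h5 : ∀ i, (G.updateRow i fun j => H (d i) (w j) + H (w i) (d j)).det =
      (G.updateRow i fun j => H (d i) (w j)).det + (G.updateRow i fun j => H (w i) (d j)).det :=
    fun i => Matrix.det_updateRow_add G i _ _
  change ∑ i, (G.updateRow i _).det = 0
  simp only [h5, Finset.sum_add_distrib, h3, h4, h2, hA0, ← map_sum, map_zero, add_zero]

end HermitianForm

/-! ### The squared length of the volume form is locally constant -/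

section VolumeNorm

variable {n : ℕ} {M : Type*} [TopologicalSpace M] [ChartedSpace (EuclideanSpace ℝ (Fin n)) M]
  {F : Type*} [NormedAddCommGroup F] [NormedSpace ℝ F]
  {T : M → Type*} [TopologicalSpace (TotalSpace F T)]
  [∀ x, AddCommGroup (T x)] [∀ x, Module ℝ (T x)] [∀ x, TopologicalSpace (T x)]
  [∀ x, IsTopologicalAddGroup (T x)] [∀ x, ContinuousSMul ℝ (T x)]
  [FiberBundle F T] [VectorBundle ℝ F T]
  {V : Type*} [NormedAddCommGroup V] [NormedSpace ℂ V] [FiniteDimensional ℂ V]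
  [ContMDiffVectorBundle ∞ F T (𝓡 n)]
  [FiniteDimensional ℝ F] [T2Space M] [IsManifold (𝓡 n) ∞ M]
  {r s : ℕ} {c : ConformalStructure n M r s} {𝒯 : StandardTractorBundle F T c}
  {B : V →ₗ⋆[ℂ] V →ₗ[ℂ] ℂ}

theorem eventually_eq_of_mvfderiv_eq_zero {G : Type*} [NormedAddCommGroup G] [NormedSpace ℝ G]
    {g : M → G} {x₁ : M} (hg : ∀ᶠ y in 𝓝 x₁, MDifferentiableAt (𝓡 n) 𝓘(ℝ, G) g y ∧
      ∀ ξ : TangentSpace (𝓡 n) y, mvfderiv (𝓡 n) g y ξ = 0) : ∀ᶠ y in 𝓝 x₁, g y = g x₁ := by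
  let φ := extChartAt (𝓡 n) x₁
  have hφs : ContinuousAt φ.symm (φ x₁) := continuousAt_extChartAt_symm x₁
  have h1 : ∀ᶠ z in 𝓝 (φ x₁), z ∈ φ.target ∧ (MDifferentiableAt (𝓡 n) 𝓘(ℝ, G) g (φ.symm z) ∧
      ∀ ξ : TangentSpace (𝓡 n) (φ.symm z), mvfderiv (𝓡 n) g (φ.symm z) ξ = 0) := by
    have h2 : φ.symm (φ x₁) = x₁ := extChartAt_to_inv x₁
    rw [← h2] at hg
    exact Filter.Eventually.and (extChartAt_target_mem_nhds (I := 𝓡 n) x₁) (hφs.eventually hg)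
  obtain ⟨ε, hε, hball⟩ := Metric.eventually_nhds_iff_ball.mp h1
  have h3 : ∀ z ∈ Metric.ball (φ x₁) ε, HasFDerivAt (𝕜 := ℝ) (g ∘ φ.symm)
      (0 : EuclideanSpace ℝ (Fin n) →L[ℝ] G) z := by
    intro z hz
    obtain ⟨hzt, hd, h0⟩ := hball z hz
    have h4 : MDifferentiableAt 𝓘(ℝ, EuclideanSpace ℝ (Fin n)) (𝓡 n) φ.symm z :=
      ((contMDiffOn_extChartAt_symm (n := 1) x₁).contMDiffAt
        ((isOpen_extChartAt_target x₁).mem_nhds hzt)).mdifferentiableAt (by simp)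
    have h5 := mfderiv_comp z hd h4
    have h6 := mdifferentiableAt_iff_differentiableAt.mp (hd.comp z h4)
    rw [mfderiv_eq_fderiv] at h5
    have h7 : fderiv ℝ (g ∘ φ.symm) z = 0 := by
      rw [h5]
      ext v
      exact h0 _
    rw [← h7]
    exact h6.hasFDerivAt
  have h8 : ∀ z ∈ Metric.ball (φ x₁) ε, (g ∘ φ.symm) z = (g ∘ φ.symm) (φ x₁) := fun z hz =>
    (convex_ball _ _).is_const_of_fderivWithin_eq_zero (𝕜 := ℝ)
      (fun z hz => (h3 z hz).differentiableAt.differentiableWithinAt)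
      (fun z hz => (h3 z hz).hasFDerivWithinAt.fderivWithin
        (Metric.isOpen_ball.uniqueDiffWithinAt hz)) hz (Metric.mem_ball_self hε)
  have h9 : ∀ᶠ y in 𝓝 x₁, φ y ∈ Metric.ball (φ x₁) ε :=
    (continuousAt_extChartAt x₁).preimage_mem_nhds (Metric.ball_mem_nhds _ hε)
  filter_upwards [h9, extChartAt_source_mem_nhds (I := 𝓡 n) x₁] with y hy hys
  have := h8 _ hy
  simp only [Function.comp] at this
  rwa [φ.left_inv hys, extChartAt_to_inv] at this

/-- The Hermitian bundle metric as a sesquilinear form on each fibre. -/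
def OrthogonalComplexStructure.hermForm (J : OrthogonalComplexStructure 𝒯.metric) (x : M) :
    J.Fiber x →ₗ⋆[ℂ] J.Fiber x →ₗ[ℂ] ℂ :=
  hermitianForm (𝒯.metric.form x) (J.endo x) (J.sq x) (J.orthogonal x)

theorem OrthogonalComplexStructure.hermForm_symm (J : OrthogonalComplexStructure 𝒯.metric) (x : M)
    (v w : J.Fiber x) : J.hermForm x v w = starRingEnd ℂ (J.hermForm x w v) :=
  hermitianExtension_symm (W := T x)
    (b := ((ContinuousLinearMap.coeLM ℝ).comp (𝒯.metric.form x).toLinearMap))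
    (J.sq x) (𝒯.metric.symm x) (J.orthogonal x) v w

variable {J : OrthogonalComplexStructure 𝒯.metric}

/-- The Hermitian bundle metric is parallel. -/
theorem mvfderiv_hermitian (hJ : J.IsParallel 𝒯.conn) {s t : (x : M) → T x}
    (hs : SmoothSection n F s) (ht : SmoothSection n F t) (x : M) :
    MDifferentiableAt (𝓡 n) 𝓘(ℝ, ℂ) (fun y => J.hermitian y (s y) (t y)) x ∧
    ∀ ξ : TangentSpace (𝓡 n) x, mvfderiv (𝓡 n) (fun y => J.hermitian y (s y) (t y)) x ξ =
      J.hermitian x (𝒯.conn s x ξ) (t x) + J.hermitian x (s x) (𝒯.conn t x ξ) := by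
  have hJt := smoothSection_endo J ht
  have h1 := (contMDiff_form 𝒯.metric hs ht x).mdifferentiableAt (by simp : (∞ : WithTop ℕ∞) ≠ 0)
  have h2 := (contMDiff_form 𝒯.metric hs hJt x).mdifferentiableAt (by simp : (∞ : WithTop ℕ∞) ≠ 0)
  let Φ : ℝ →L[ℝ] ℂ := Complex.ofRealCLM
  let Ψ : ℝ →L[ℝ] ℂ := (ContinuousLinearMap.mul ℝ ℂ (-Complex.I)).comp Complex.ofRealCLM
  have h3 : MDifferentiableAt (𝓡 n) 𝓘(ℝ, ℂ) (fun y => Φ (𝒯.metric.form y (s y) (t y))) x :=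
    Φ.mdifferentiableAt.comp x h1
  have h4 : MDifferentiableAt (𝓡 n) 𝓘(ℝ, ℂ)
      (fun y => Ψ (𝒯.metric.form y (s y) (J.endo y (t y)))) x :=
    Ψ.mdifferentiableAt.comp x h2
  have h5 : (fun y => J.hermitian y (s y) (t y)) = fun y => Φ (𝒯.metric.form y (s y) (t y)) +
      Ψ (𝒯.metric.form y (s y) (J.endo y (t y))) := by
    funext y
    exact (sub_eq_add_neg _ _).trans (congrArg _ (neg_mul _ _).symm)
  rw [h5]
  refine ⟨h3.add h4, fun ξ => ?_⟩
  have h6 := congrArg (fun A : TangentSpace (𝓡 n) x →L[ℝ] ℂ => A ξ) (mvfderiv_add h3 h4)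
  have h7 : mvfderiv (𝓡 n) (fun y => 𝒯.metric.form y (s y) (t y)) x ξ = _ :=
    𝒯.conn_metric s t hs ht x ξ
  have h8 : mvfderiv (𝓡 n) (fun y => 𝒯.metric.form y (s y) (J.endo y (t y))) x ξ = _ :=
    𝒯.conn_metric s _ hs hJt x ξ
  refine h6.trans ?_
  change mvfderiv (𝓡 n) (fun y => Φ (𝒯.metric.form y (s y) (t y))) x ξ +
    mvfderiv (𝓡 n) (fun y => Ψ (𝒯.metric.form y (s y) (J.endo y (t y)))) x ξ = _
  rw [mvfderiv_clm_comp Φ h1, mvfderiv_clm_comp Ψ h2, h7, h8, hJ t ht]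
  change ((_ + _ : ℝ) : ℂ) + -Complex.I * ((_ + _ : ℝ) : ℂ) = ((_ : ℝ) - _ * ((_ : ℝ) : ℂ)) +
    ((_ : ℝ) - _ * ((_ : ℝ) : ℂ))
  push_cast
  ring

variable {m : ℕ} {ν : (x : M) → ⋀[ℂ]^m (J.Fiber x)}

/-- The determinant of complex matrices as a real multilinear function of the rows. -/
def detRows (m : ℕ) : ContinuousMultilinearMap ℝ (fun _ : Fin m => Fin m → ℂ) ℂ :=
  { (Matrix.detRowAlternating (n := Fin m) (R := ℂ)).toMultilinearMap.restrictScalars ℝ with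
    cont := Continuous.matrix_det continuous_id }

/-- The squared length of a parallel section of the top exterior power is locally constant. -/
theorem eventually_isTopSqNorm (hJ : J.IsParallel 𝒯.conn) (hν : IsParallelTop J 𝒯.conn ν)
    (x₁ : M) : ∃ a, ∀ᶠ y in 𝓝 x₁, IsTopSqNorm (J.hermitian y) (ν y) a := by
  obtain ⟨e, he, hev⟩ := hν x₁
  let g : M → ℂ := fun y => detRows m fun i j => J.hermitian y (e i y) (e j y)
  have hij := fun i j y => mvfderiv_hermitian hJ (he i) (he j) y
  have hrow : ∀ i y, MDifferentiableAt (𝓡 n) 𝓘(ℝ, Fin m → ℂ)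
      (fun y j => J.hermitian y (e i y) (e j y)) y := fun i y =>
    (mdifferentiableAt_iff ..).mpr ⟨continuousAt_pi.mpr fun j => (hij i j y).1.continuousAt,
      differentiableWithinAt_pi.mpr fun j => ((mdifferentiableAt_iff ..).mp (hij i j y).1).2⟩
  have hg : ∀ᶠ y in 𝓝 x₁, g y = g x₁ := by
    refine eventually_eq_of_mvfderiv_eq_zero (n := n) (hev.mono fun y hy => ?_)
    refine ⟨(mvfderiv_multilinear (detRows m) (fun i => hrow i y) 0).1, fun ξ => ?_⟩
    refine (mvfderiv_multilinear (detRows m) (fun i => hrow i y) ξ).2.trans ?_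
    refine Eq.trans (Finset.sum_congr rfl fun i _ => ?_)
      (sum_det_gram_update (J.hermForm_symm y) _ _ (hy.2 ξ))
    change Matrix.det _ = _
    congr 1
    ext k j
    rcases eq_or_ne k i with rfl | hki
    · rw [Matrix.updateRow_self]
      refine (congrFun (Function.update_self ..) j).trans ?_
      refine Eq.trans ?_ ((hij k j y).2 ξ)
      exact (mvfderiv_clm_comp (ContinuousLinearMap.proj (R := ℝ) (φ := fun _ : Fin m => ℂ) j)
        (hrow k y) ξ).symm
    · rw [Matrix.updateRow_ne hki]
      exact congrFun (Function.update_of_ne hki ..) j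
  refine ⟨g x₁, ?_⟩
  filter_upwards [hg, hev] with y h1 h2
  rw [← h1]
  exact ⟨_, h2.1.symm, rfl⟩

theorem finiteDimensional_fiber (J : OrthogonalComplexStructure 𝒯.metric) (x : M) :
    FiniteDimensional ℂ (J.Fiber x) := by
  have h1 : Module.Finite ℝ (T x) :=
    Module.Finite.equiv (coordEquiv (self_mem_coordDomain (F := F) x)).symm.toLinearEquiv
  have h2 : Module.Finite ℝ (J.Fiber x) :=
    Module.Finite.equiv (ComplexFiber.ofEquiv (J.endo x) (J.sq x))
  exact Module.Finite.of_restrictScalars_finite ℝ ℂ _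

variable {r' s' : ℕ}

/-- Each fibre of the tractor bundle is isometric to `V`, and any two null vectors correspond to
each other under some isometry. -/
theorem exists_fiber_isometry (hB : HasHermitianSignature B r' s') (hr : r + 1 = 2 * r')
    (hs : s + 1 = 2 * s') {v₀ : V} (hv₀ : v₀ ≠ 0) (hvv : B v₀ v₀ = 0) {x : M} {w : T x}
    (hw : w ≠ 0) (hww : 𝒯.metric.form x w w = 0) :
    ∃ U : V ≃ₗ[ℂ] J.Fiber x, (∀ v v', J.hermForm x (U v) (U v') = B v v') ∧
      U v₀ = ComplexFiber.of (J.endo x) (J.sq x) w := by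
  have sig := 𝒯.metric.signature x
  have hfd := finiteDimensional_fiber J x
  refine exists_isometry hB.symm (J.hermForm_symm x) (fun v _ h => hB.nondegenerate v trivial h)
    (nondegenerateOn_hermitianForm _ _ sig) hB.real ?_ hv₀ hvv hw ?_
  · have := hasSignature_hermitianForm (J.sq x) (J.orthogonal x) sig
    rw [← hr, ← hs]
    exact this
  · have h1 : 𝒯.metric.form x w (J.endo x w) = 0 := by
      have h2 := J.orthogonal x w (J.endo x w)
      rw [J.sq, map_neg, 𝒯.metric.symm x _ w] at h2
      linarith
    change hermitianExtension (W := T x) (fun v w => 𝒯.metric.form x v w) (J.endo x) w w = 0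
    simp [hermitianExtension, hww, h1]

variable (𝒯) in
/-- The line subbundle is spanned by a smooth nowhere vanishing null section. -/
theorem exists_null_section : ∃ σ : (x : M) → T x, SmoothSection n F σ ∧
    (∀ x, σ x ≠ 0 ∧ 𝒯.line x = Submodule.span ℝ {σ x}) ∧
    (∀ x, 𝒯.metric.form x (σ x) (σ x) = 0) ∧
    ∃ g : PseudoRiemannianMetric n M r s, ∀ (x : M) (ξ η : TangentSpace (𝓡 n) x),
      𝒯.metric.form x (𝒯.conn σ x ξ) (𝒯.conn σ x η) = g.form x ξ η := by
  obtain ⟨g, hg⟩ := c.isClass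
  obtain ⟨σ, h1, h2, h3⟩ := 𝒯.exists_scale g
    ((hg g).mpr ⟨fun _ => 1, contMDiff_const, fun _ => one_pos, fun _ _ _ => (one_mul _).symm⟩)
  refine ⟨σ, h1, h2, fun x => 𝒯.line_isotropic x _ ?_, g, h3⟩
  rw [(h2 x).2]
  exact Submodule.mem_span_singleton_self _

/-- If the squared lengths of `ν` and `ν₀` agree at one point of each connected component, then
they agree everywhere. -/
theorem isTopSqNorm_of_connectedComponent (hJ : J.IsParallel 𝒯.conn)
    (hν : IsParallelTop J 𝒯.conn ν) (hB : HasHermitianSignature B r' s') (hr : r + 1 = 2 * r')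
    (hs : s + 1 = 2 * s') {v₀ : V} (hv₀ : v₀ ≠ 0) (hvv : B v₀ v₀ = 0)
    (b : Module.Basis (Fin m) ℂ V) {ν₀ : ⋀[ℂ]^m V}
    (hnorm : ∀ x : M, ∃ y ∈ connectedComponent x, ∃ a : ℂ,
      IsTopSqNorm (fun v w => B v w) ν₀ a ∧ IsTopSqNorm (J.hermitian y) (ν y) a)
    (x : M) {a : ℂ} (ha : IsTopSqNorm (fun v w => B v w) ν₀ a) :
    IsTopSqNorm (J.hermitian x) (ν x) a := by
  obtain ⟨σ, -, hσ, hσσ, -⟩ := exists_null_section 𝒯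
  -- an isometry with `V` provides a basis of the fibre
  have huniq : ∀ y a a', IsTopSqNorm (J.hermitian y) (ν y) a →
      IsTopSqNorm (J.hermitian y) (ν y) a' → a = a' := by
    intro y a a' h h'
    obtain ⟨U, -, -⟩ := exists_fiber_isometry (J := J) hB hr hs hv₀ hvv (hσ y).1 (hσσ y)
    exact IsTopSqNorm.unique (H := J.hermForm y) (b.map U) h h'
  let S : Set M := {y | IsTopSqNorm (J.hermitian y) (ν y) a}
  have hS : IsClopen S := by
    constructor
    · rw [← isOpen_compl_iff, isOpen_iff_mem_nhds]
      intro y hy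
      obtain ⟨a', h⟩ := eventually_isTopSqNorm hJ hν y
      filter_upwards [h] with z hz hza
      apply hy
      rw [mem_ofPred_eq, huniq z a a' hza hz]
      exact h.self_of_nhds
    · rw [isOpen_iff_mem_nhds]
      intro y hy
      obtain ⟨a', h⟩ := eventually_isTopSqNorm hJ hν y
      filter_upwards [h] with z hz
      rwa [mem_ofPred_eq, huniq y a a' hy h.self_of_nhds]
  obtain ⟨y, hy, a', h1, h2⟩ := hnorm x
  rw [h1.unique b ha] at h2
  refine hS.connectedComponent_subset (x := y) h2 ?_
  rw [← connectedComponent_eq hy]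
  exact mem_connectedComponent

end VolumeNorm

/-! ### Smooth local sections of the reduced bundle -/

section LocalSection

variable {n : ℕ} {M : Type*} [TopologicalSpace M] [ChartedSpace (EuclideanSpace ℝ (Fin n)) M]
  {F : Type*} [NormedAddCommGroup F] [NormedSpace ℝ F]
  {T : M → Type*} [TopologicalSpace (TotalSpace F T)]
  [∀ x, AddCommGroup (T x)] [∀ x, Module ℝ (T x)] [∀ x, TopologicalSpace (T x)]
  [∀ x, IsTopologicalAddGroup (T x)] [∀ x, ContinuousSMul ℝ (T x)]
  [FiberBundle F T] [VectorBundle ℝ F T]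
  {V : Type*} [NormedAddCommGroup V] [NormedSpace ℂ V] [FiniteDimensional ℂ V]
  [ContMDiffVectorBundle ∞ F T (𝓡 n)]
  [FiniteDimensional ℝ F] [T2Space M] [IsManifold (𝓡 n) ∞ M]
  {r s : ℕ} {c : ConformalStructure n M r s} {𝒯 : StandardTractorBundle F T c}
  {B : V →ₗ⋆[ℂ] V →ₗ[ℂ] ℂ} {L : Submodule ℝ V} {J : OrthogonalComplexStructure 𝒯.metric}
  {m : ℕ} {ν₀ : ⋀[ℂ]^m V} {ν : (x : M) → ⋀[ℂ]^m (J.Fiber x)}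

theorem mem_suBundle_of_adapted {b : Module.Basis (Fin m) ℂ V} {c₀ : ℂ}
    (hc : ν₀ = c₀ • exteriorPower.ιMulti ℂ m b) {v₀ : V} (hL : L = Submodule.span ℝ {v₀})
    {u : FrameSpace F T V} {σ : T u.1} (hσ : 𝒯.line u.1 = Submodule.span ℝ {σ})
    {e : Fin m → T u.1}
    (he : ν u.1 = exteriorPower.ιMulti ℂ m
      (fun i => ComplexFiber.of (J.endo u.1) (J.sq u.1) (e i)))
    (ha : Adapted B b c₀ v₀ (fun v w => 𝒯.metric.form u.1 v w) (J.endo u.1) σ e (frameMap u)) :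
    u ∈ suBundle 𝒯 B L J ν₀ ν := by
  let uC : V →ₗ[ℂ] J.Fiber u.1 := complexify
    ((ComplexFiber.ofEquiv (J.endo u.1) (J.sq u.1)).toLinearMap.comp
      (frameMap u : V →ₗ[ℝ] T u.1)) fun v => by
    change ComplexFiber.of (J.endo u.1) (J.sq u.1) (frameMap u (Complex.I • v)) = _
    rw [ha.complex, ← ComplexFiber.I_smul]
    rfl
  let U : V ≃ₗ[ℂ] J.Fiber u.1 := LinearEquiv.ofBijective uC ha.bijective
  refine ⟨⟨ha.bijective, ha.isometry, ?_⟩, uC, fun v => rfl, ?_⟩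
  · rw [hL, Submodule.map_span, Set.image_singleton, hσ]
    congr 2
    exact ha.line
  · choose w hw using fun i => ha.bijective.2 (e i)
    have h1 := ιMulti_map_eq b U w
    rw [ha.det w hw] at h1
    rw [he, hc, map_smul, exteriorPower.map_apply_ιMulti]
    refine h1.symm.trans (congrArg _ (funext hw))

theorem admissible_coord {b : Module.Basis (Fin m) ℂ V} {c₀ : ℂ} {x₀ x : M}
    (hx : x ∈ coordDomain F T x₀) {σ : T x} (hσ : 𝒯.metric.form x σ σ = 0) {e : Fin m → T x}
    (hdet : (Matrix.of fun i j => J.hermitian x (e i) (e j)).det =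
      starRingEnd ℂ c₀ * c₀ * (Matrix.of fun i j => B (b i) (b j)).det) :
    Admissible B b c₀ (fun v w => formCoord 𝒯.metric x₀ x v w) (endoCoord J x₀ x)
      (toCoord F x₀ x σ) (fun i => toCoord F x₀ x (e i)) where
  sq v := by
    obtain ⟨w, rfl⟩ := (coordEquiv hx).surjective v
    change endoCoord J x₀ x (endoCoord J x₀ x (toCoord F x₀ x w)) = -toCoord F x₀ x w
    rw [endoCoord_toCoord J hx, endoCoord_toCoord J hx, J.sq, map_neg]
  symm v w := by
    simp only [formCoord_apply]
    exact 𝒯.metric.symm x _ _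
  orthogonal v w := by
    obtain ⟨v, rfl⟩ := (coordEquiv hx).surjective v
    obtain ⟨w, rfl⟩ := (coordEquiv hx).surjective w
    change formCoord 𝒯.metric x₀ x (endoCoord J x₀ x (toCoord F x₀ x v))
      (endoCoord J x₀ x (toCoord F x₀ x w)) =
      formCoord 𝒯.metric x₀ x (toCoord F x₀ x v) (toCoord F x₀ x w)
    simp only [formCoord_apply, endoCoord_toCoord J hx, ofCoord_toCoord hx, J.orthogonal]
  null := by simp only [formCoord_apply, ofCoord_toCoord hx, hσ]
  det := by
    rw [← hdet]
    congr 1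
    ext i j
    simp only [Matrix.of_apply, hermitianExtension, formCoord_apply, endoCoord_toCoord J hx,
      ofCoord_toCoord hx]
    rfl

theorem adapted_of_coord {b : Module.Basis (Fin m) ℂ V} {c₀ : ℂ} {v₀ : V} {x₀ x : M}
    (hx : x ∈ coordDomain F T x₀) {σ : T x} {e : Fin m → T x} {Û : V →L[ℝ] F}
    (h : Adapted B b c₀ v₀ (fun v w => formCoord 𝒯.metric x₀ x v w) (endoCoord J x₀ x)
      (toCoord F x₀ x σ) (fun i => toCoord F x₀ x (e i)) Û) :
    Adapted B b c₀ v₀ (fun v w => 𝒯.metric.form x v w) (J.endo x) σ e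
      (frameMap (frameOf x₀ x Û : FrameSpace F T V)) where
  bijective := (coordEquiv hx).symm.bijective.comp h.bijective
  complex v := by
    change ofCoord F x₀ x (Û (Complex.I • v)) = J.endo x (ofCoord F x₀ x (Û v))
    rw [h.complex]
    exact ofCoord_toCoord hx _
  isometry v w := h.isometry v w
  line := by
    change ofCoord F x₀ x (Û v₀) = σ
    rw [h.line, ofCoord_toCoord hx]
  det w hw := h.det w fun i => by
    rw [← hw i]
    exact (toCoord_ofCoord (T := T) hx _).symm

theorem eventually_contDiffAt_chart {G : Type*} [NormedAddCommGroup G] [NormedSpace ℝ G]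
    {f : M → G} {x₀ : M} (hf : ∀ᶠ x in 𝓝 x₀, ContMDiffAt (𝓡 n) 𝓘(ℝ, G) ∞ f x) :
    ∀ᶠ y in 𝓝 (extChartAt (𝓡 n) x₀ x₀),
      ContDiffAt ℝ ∞ (fun y => f ((extChartAt (𝓡 n) x₀).symm y)) y := by
  have hφs : ContinuousAt (extChartAt (𝓡 n) x₀).symm (extChartAt (𝓡 n) x₀ x₀) :=
    continuousAt_extChartAt_symm x₀
  rw [← extChartAt_to_inv (I := 𝓡 n) x₀] at hf
  filter_upwards [extChartAt_target_mem_nhds (I := 𝓡 n) x₀, hφs.eventually hf] with y hy hfy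
  have h4 : ContMDiffAt 𝓘(ℝ, EuclideanSpace ℝ (Fin n)) (𝓡 n) ∞ (extChartAt (𝓡 n) x₀).symm y :=
    (contMDiffOn_extChartAt_symm (n := ∞) x₀).contMDiffAt
      ((isOpen_extChartAt_target x₀).mem_nhds hy)
  exact (hfy.comp y h4).contDiffAt

theorem eventually_chart {P : M → Prop} {x₀ : M} (h : ∀ᶠ x in 𝓝 x₀, P x) :
    ∀ᶠ y in 𝓝 (extChartAt (𝓡 n) x₀ x₀), P ((extChartAt (𝓡 n) x₀).symm y) := by
  rw [← extChartAt_to_inv (I := 𝓡 n) x₀] at h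
  exact (continuousAt_extChartAt_symm x₀).eventually h

/-- The reduced bundle has smooth local sections. -/
theorem exists_local_section (hJ : J.IsParallel 𝒯.conn) (hν : IsParallelTop J 𝒯.conn ν)
    {r' s' : ℕ} (hB : HasHermitianSignature B r' s') (h3 : 3 ≤ r' + s') (hr : r + 1 = 2 * r')
    (hs : s + 1 = 2 * s') (b : Module.Basis (Fin m) ℂ V)
    (hL : Module.finrank ℝ L = 1) (hL_isotropic : ∀ v ∈ L, B v v = 0) (hν₀ : ν₀ ≠ 0)
    (hnorm : ∀ x : M, ∃ y ∈ connectedComponent x, ∃ a : ℂ,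
      IsTopSqNorm (fun v w => B v w) ν₀ a ∧ IsTopSqNorm (J.hermitian y) (ν y) a) (x₀ : M) :
    ∃ W : Set M, IsOpen W ∧ x₀ ∈ W ∧ W ⊆ coordDomain F T x₀ ∧ ∃ Û : M → V →L[ℝ] F,
      ContMDiffOn (𝓡 n) 𝓘(ℝ, V →L[ℝ] F) ∞ Û W ∧
      ∀ x ∈ W, frameOf x₀ x (Û x) ∈ suBundle 𝒯 B L J ν₀ ν := by
  obtain ⟨⟨v₀, hv₀L⟩, hv₀, hv₀'⟩ := finrank_eq_one_iff'.mp hL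
  have hv₀0 : v₀ ≠ 0 := fun h => hv₀ (Subtype.ext h)
  have hLs : L = Submodule.span ℝ {v₀} := by
    refine le_antisymm (fun w hw => ?_) ((Submodule.span_singleton_le_iff_mem ..).mpr hv₀L)
    obtain ⟨a, ha⟩ := hv₀' ⟨w, hw⟩
    exact Submodule.mem_span_singleton.mpr ⟨a, congrArg Subtype.val ha⟩
  obtain ⟨c₀, hc⟩ := exists_eq_smul_ιMulti b ν₀
  have hc₀ : c₀ ≠ 0 := by
    rintro rfl
    exact hν₀ (by rw [hc, zero_smul])
  have hvv := hL_isotropic v₀ hv₀L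
  obtain ⟨σ, hσs, hσ, hσσ, -⟩ := exists_null_section 𝒯
  obtain ⟨e, he, hev⟩ := hν x₀
  have hsq : ∀ x, IsTopSqNorm (J.hermitian x) (ν x)
      (starRingEnd ℂ c₀ * c₀ * (Matrix.of fun i j => B (b i) (b j)).det) := fun x => by
    obtain ⟨-, -, a, ha, -⟩ := hnorm x
    have h1 := ha
    rw [hc] at h1
    rw [← h1.eq_of_smul b]
    exact isTopSqNorm_of_connectedComponent hJ hν hB hr hs hv₀0 hvv b hnorm x ha
  have hdet : ∀ᶠ x in 𝓝 x₀, (Matrix.of fun i j => J.hermitian x (e i x) (e j x)).det =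
      starRingEnd ℂ c₀ * c₀ * (Matrix.of fun i j => B (b i) (b j)).det := by
    filter_upwards [hev] with x hx
    obtain ⟨U, -, -⟩ := exists_fiber_isometry (J := J) hB hr hs hv₀0 hvv (hσ x).1 (hσσ x)
    exact IsTopSqNorm.unique (H := J.hermForm x) (b.map U) ⟨_, hx.1.symm, rfl⟩ (hsq x)
  have hdom : ∀ᶠ x in 𝓝 x₀, x ∈ sectionDomain n F T x₀ :=
    (isOpen_sectionDomain x₀).mem_nhds (self_mem_sectionDomain x₀)
  have hx₀ := self_mem_coordDomain (F := F) (T := T) x₀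
  obtain ⟨U₀, hU₀, hU₀v⟩ := exists_fiber_isometry (J := J) hB hr hs hv₀0 hvv (hσ x₀).1 (hσσ x₀)
  let U₀' : V →ₗ[ℝ] T x₀ := (ComplexFiber.ofEquiv (J.endo x₀) (J.sq x₀)).symm.toLinearMap.comp
    (U₀.toLinearMap.restrictScalars ℝ)
  let Û₀ : V →L[ℝ] F := LinearMap.toContinuousLinearMap ((toCoord F x₀ x₀).toLinearMap.comp U₀')
  let φ := extChartAt (𝓡 n) x₀
  -- the isometry at `x₀` is extended in a chart of `M` and the preferred trivialization at `x₀`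
  have hφ : φ.symm (φ x₀) = x₀ := extChartAt_to_inv x₀
  obtain ⟨Û, hÛ⟩ := exists_adapted_extension (E := EuclideanSpace ℝ (Fin n)) (F := F) hB h3 b hc₀
    hv₀0 hvv
    (h := fun y => formCoord 𝒯.metric x₀ (φ.symm y)) (J := fun y => endoCoord J x₀ (φ.symm y))
    (σ := fun y => toCoord F x₀ (φ.symm y) (σ (φ.symm y)))
    (e := fun i y => toCoord F x₀ (φ.symm y) (e i (φ.symm y))) (y₀ := φ x₀) (U₀ := Û₀)
    (eventually_contDiffAt_chart (hdom.mono fun x hx => contMDiffAt_formCoord 𝒯.metric hx))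
    (eventually_contDiffAt_chart (hdom.mono fun x hx => contMDiffAt_endoCoord J hx))
    (eventually_contDiffAt_chart (hdom.mono fun x hx =>
      contMDiffAt_sectionCoord (sectionDomain_subset x₀ hx) hσs))
    (fun i => eventually_contDiffAt_chart (hdom.mono fun x hx =>
      contMDiffAt_sectionCoord (sectionDomain_subset x₀ hx) (he i)))
    (by
      filter_upwards [eventually_chart (n := n) (hdom.and hdet)] with y hy
      exact admissible_coord (sectionDomain_subset x₀ hy.1) (hσσ _) hy.2)
    ((coordEquiv hx₀).bijective.comp U₀.bijective)
    (fun v => by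
      rw [hφ]
      change toCoord F x₀ x₀ (U₀' (Complex.I • v)) =
        endoCoord J x₀ x₀ (toCoord F x₀ x₀ (U₀' v))
      rw [endoCoord_toCoord J hx₀]
      congr 1
      exact (U₀.map_smul Complex.I v).trans
        (ComplexFiber.I_smul (W := T x₀) (hJ := J.sq x₀) (U₀' v)))
    (fun v w => by
      simp only [hφ]
      change formCoord 𝒯.metric x₀ x₀ (toCoord F x₀ x₀ (U₀' v)) (toCoord F x₀ x₀ (U₀' w)) = _
      rw [formCoord_apply, ofCoord_toCoord hx₀, ofCoord_toCoord hx₀, ← hU₀ v w]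
      change _ = (hermitianExtension (W := T x₀) (fun v w => 𝒯.metric.form x₀ v w) (J.endo x₀)
        (U₀' v) (U₀' w)).re
      simp [hermitianExtension])
    (by
      rw [hφ]
      exact congrArg (toCoord F x₀ x₀) hU₀v)
  have hfin : ∀ᶠ x in 𝓝 x₀, x ∈ coordDomain F T x₀ ∧
      ContMDiffAt (𝓡 n) 𝓘(ℝ, V →L[ℝ] F) ∞ (fun x => Û (φ x)) x ∧
      frameOf x₀ x (Û (φ x)) ∈ suBundle 𝒯 B L J ν₀ ν := by
    filter_upwards [(continuousAt_extChartAt (I := 𝓡 n) x₀).eventually hÛ,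
      extChartAt_source_mem_nhds (I := 𝓡 n) x₀, hdom, hev] with x h1 h2 h3 h4
    have hx := sectionDomain_subset x₀ h3
    have h5 : φ.symm (φ x) = x := φ.left_inv h2
    refine ⟨hx, h1.1.contMDiffAt.comp x (contMDiffAt_extChartAt' ?_), ?_⟩
    · rwa [extChartAt_source] at h2
    · have h6 := h1.2
      change Adapted B b c₀ v₀ (fun v w => formCoord 𝒯.metric x₀ (φ.symm (φ x)) v w)
        (endoCoord J x₀ (φ.symm (φ x))) (toCoord F x₀ (φ.symm (φ x)) (σ (φ.symm (φ x))))
        (fun i => toCoord F x₀ (φ.symm (φ x)) (e i (φ.symm (φ x)))) (Û (φ x)) at h6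
      rw [h5] at h6
      exact mem_suBundle_of_adapted (u := frameOf x₀ x (Û (φ x))) hc hLs (hσ x).2 h4.1
        (adapted_of_coord hx h6)
  obtain ⟨W, hW, hWo, hxW⟩ := eventually_nhds_iff.mp hfin
  exact ⟨W, hWo, hxW, fun x hx => (hW x hx).1, fun x => Û (φ x),
    fun x hx => (hW x hx).2.1.contMDiffWithinAt, fun x hx => (hW x hx).2.2⟩

end LocalSection

/-! ### Submanifolds given by parametrizations -/

section Parametrization

variable {E : Type*} [NormedAddCommGroup E] [NormedSpace ℝ E] [CompleteSpace E]
  {H : Type*} [TopologicalSpace H] {I : ModelWithCorners ℝ E H} [I.Boundaryless]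
  {X : Type*} [TopologicalSpace X] [ChartedSpace H X] [IsManifold I ∞ X]

/-- A subset `S` is a submanifold if around each of its points there is a local parametrization of
the ambient manifold in which `S` corresponds to a linear subspace. -/
theorem isEmbeddedSubmanifold_of_parametrization {S : Set X} (k : ℕ)
    (h : ∀ p ∈ S, ∃ (a : E) (f : E → X) (f' : E ≃L[ℝ] E) (W : Submodule ℝ E), f a = p ∧
      (∀ᶠ z in 𝓝 a, ContMDiffAt 𝓘(ℝ, E) I ∞ f z ∧ (f z ∈ S ↔ z ∈ W)) ∧
      HasFDerivAt (fun z => extChartAt I p (f z)) (f' : E →L[ℝ] E) a ∧ Module.finrank ℝ W = k) :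
    IsEmbeddedSubmanifold I S := by
  refine ⟨k, fun p hp => ?_⟩
  obtain ⟨a, f, f', W, hfa, hf, hf', hW⟩ := h p hp
  let c : OpenPartialHomeomorph X E :=
    (chartAt H p).trans I.toHomeomorph.toOpenPartialHomeomorph
  have hc : ⇑c = extChartAt I p := rfl
  have hcs : ⇑c.symm = (extChartAt I p).symm := rfl
  have hcsrc : c.source = (chartAt H p).source := by simp [c]
  have hctgt : c.target = (extChartAt I p).target := by
    ext z
    simp [c, extChartAt, OpenPartialHomeomorph.extend, ModelWithCorners.toHomeomorph]
    exact fun _ => by rw [← mem_range, I.range_eq_univ]; trivial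
  have hc1 : ContMDiffOn I 𝓘(ℝ, E) ∞ c c.source := by
    rw [hc, hcsrc]; exact contMDiffOn_extChartAt
  have hc2 : ContMDiffOn 𝓘(ℝ, E) I ∞ c.symm c.target := by
    rw [hcs, hctgt]; exact contMDiffOn_extChartAt_symm p
  have hsrc : ∀ᶠ z in 𝓝 a, f z ∈ c.source := by
    refine (hf.self_of_nhds.1.continuousAt).preimage_mem_nhds (c.open_source.mem_nhds ?_)
    rw [hfa, hcsrc]
    exact mem_chart_source H p
  obtain ⟨ψ, haψ, hψN, hψ, hψ1, hψ2⟩ := exists_local_diffeo (f := fun z => c (f z))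
    (hf.and hsrc) ((hf.and hsrc).mono fun z hz =>
      ((hc1.contMDiffAt (c.open_source.mem_nhds hz.2)).comp z hz.1.1).contDiffAt) f' hf'
  have hleft : ∀ z ∈ ψ.source, f z = c.symm (ψ z) := fun z hz => by
    rw [hψ]
    exact (c.left_inv (hψN hz).2).symm
  -- the chart is the inverse of the parametrization
  refine ⟨c.trans ψ.symm, ?_, ?_, ?_, W, hW, ?_⟩
  · rw [OpenPartialHomeomorph.trans_source]
    refine ⟨?_, ?_⟩
    · rw [hcsrc]; exact mem_chart_source H p
    · have h1 := ψ.map_source haψ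
      rw [hψ] at h1
      simp only [hfa] at h1
      exact h1
  · rw [OpenPartialHomeomorph.trans_source]
    exact hψ2.contMDiffOn.comp (hc1.mono inter_subset_left) fun q hq => hq.2
  · rw [OpenPartialHomeomorph.trans_target]
    exact hc2.comp (hψ1.contMDiffOn.mono inter_subset_left) fun q hq => hq.2
  · intro q hq
    rw [OpenPartialHomeomorph.trans_source] at hq
    have h1 : ψ.symm (c q) ∈ ψ.source := ψ.map_target hq.2
    have h2 : f (ψ.symm (c q)) = q := by
      rw [hleft _ h1, ψ.right_inv hq.2, c.left_inv hq.1]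
    have h3 := (hψN h1).1.2
    rw [h2] at h3
    exact h3

end Parametrization

/-! ### The structure group is a submanifold -/

section StructureGroup

variable {V : Type*} [NormedAddCommGroup V] [NormedSpace ℂ V] [FiniteDimensional ℂ V]
  {B : V →ₗ⋆[ℂ] V →ₗ[ℂ] ℂ} {r s : ℕ}

/-- Near `0`, the exponential map identifies `P^{SU}` with its Lie algebra. -/
theorem eventually_exp_mem_iff (hB : HasHermitianSignature B r s) (L : Submodule ℝ V) :
    ∀ᶠ A in 𝓝 (0 : V →L[ℝ] V),
      NormedSpace.exp A ∈ endSet (suStabilizer B L) ↔ A ∈ suStabilizerAlgebra B L :=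
  (eventually_mem_suStabilizerAlgebra hB L).mono fun _ h => ⟨h, exp_mem_suStabilizer hB⟩

theorem comp_mem_endSet_iff {K : Subgroup (V ≃L[ℝ] V)} {g : V ≃L[ℝ] V} (hg : g ∈ K)
    {a : V →L[ℝ] V} : (g : V →L[ℝ] V).comp a ∈ endSet K ↔ a ∈ endSet K := by
  constructor
  · rintro ⟨h, hh, hga⟩
    refine ⟨g⁻¹ * h, K.mul_mem (K.inv_mem hg) hh, ?_⟩
    ext v
    have h1 : h v = g (a v) := congrArg (fun A : V →L[ℝ] V => A v) hga
    change g.symm (h v) = a v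
    rw [h1, g.symm_apply_apply]
  · rintro ⟨h, hh, rfl⟩
    exact ⟨g * h, K.mul_mem hg hh, rfl⟩

/-- Near `g`, the group is parametrized by `A ↦ g exp A` with `A` in its Lie algebra. -/
theorem isEmbeddedSubmanifold_suStabilizer (hB : HasHermitianSignature B r s) (L : Submodule ℝ V) :
    IsEmbeddedSubmanifold 𝓘(ℝ, V →L[ℝ] V) (endSet (suStabilizer B L)) := by
  have hcV : CompleteSpace V := FiniteDimensional.complete ℝ V
  refine isEmbeddedSubmanifold_of_parametrization
    (Module.finrank ℝ (suStabilizerAlgebra B L)) ?_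
  rintro _ ⟨g, hg, rfl⟩
  let P : (V →L[ℝ] V) ≃L[ℝ] (V →L[ℝ] V) :=
    (ContinuousLinearEquiv.refl ℝ V).arrowCongr g
  have hP : ∀ A, P A = (g : V →L[ℝ] V).comp A := fun A => by
    ext v; simp [P]
  refine ⟨0, fun A => P (NormedSpace.exp A), P, suStabilizerAlgebra B L, ?_, ?_, ?_, rfl⟩
  · change P _ = _
    rw [NormedSpace.exp_zero, hP]
    rfl
  · filter_upwards [eventually_exp_mem_iff hB L] with A hA
    refine ⟨((P.contDiff.comp contDiff_exp).contDiffAt).contMDiffAt, ?_⟩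
    rw [hP]
    exact (comp_mem_endSet_iff hg).trans hA
  · have h1 : HasFDerivAt (NormedSpace.exp : (V →L[ℝ] V) → (V →L[ℝ] V))
        (1 : (V →L[ℝ] V) →L[ℝ] (V →L[ℝ] V)) 0 := hasFDerivAt_exp_zero
    have h2 := P.hasFDerivAt (x := NormedSpace.exp 0) |>.comp 0 h1
    have h3 : (P : (V →L[ℝ] V) →L[ℝ] (V →L[ℝ] V)).comp (1 : (V →L[ℝ] V) →L[ℝ] (V →L[ℝ] V)) =
        (P : (V →L[ℝ] V) →L[ℝ] (V →L[ℝ] V)) := by ext; rfl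
    rw [h3] at h2
    exact h2

end StructureGroup

/-! ### The action of the structure group on the reduced bundle -/

section ReducedBundle

variable {n : ℕ} {M : Type*} [TopologicalSpace M] [ChartedSpace (EuclideanSpace ℝ (Fin n)) M]
  {F : Type*} [NormedAddCommGroup F] [NormedSpace ℝ F]
  {T : M → Type*} [TopologicalSpace (TotalSpace F T)]
  [∀ x, AddCommGroup (T x)] [∀ x, Module ℝ (T x)] [∀ x, TopologicalSpace (T x)]
  [∀ x, IsTopologicalAddGroup (T x)] [∀ x, ContinuousSMul ℝ (T x)]
  [FiberBundle F T] [VectorBundle ℝ F T]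
  {V : Type*} [NormedAddCommGroup V] [NormedSpace ℂ V] [FiniteDimensional ℂ V]
  [ContMDiffVectorBundle ∞ F T (𝓡 n)]
  [FiniteDimensional ℝ F] [T2Space M] [IsManifold (𝓡 n) ∞ M]
  {r s : ℕ} {c : ConformalStructure n M r s} {𝒯 : StandardTractorBundle F T c}
  {B : V →ₗ⋆[ℂ] V →ₗ[ℂ] ℂ} {L : Submodule ℝ V} {J : OrthogonalComplexStructure 𝒯.metric}
  {m : ℕ} {ν₀ : ⋀[ℂ]^m V} {ν : (x : M) → ⋀[ℂ]^m (J.Fiber x)}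

theorem frameComp_mem_suBundle (b : Module.Basis (Fin m) ℂ V) {u : FrameSpace F T V}
    (hu : u ∈ suBundle 𝒯 B L J ν₀ ν) {g : V ≃L[ℝ] V} (hg : g ∈ suStabilizer B L) :
    frameComp (g : V →L[ℝ] V) u ∈ suBundle 𝒯 B L J ν₀ ν := by
  obtain ⟨⟨hbij, hiso, hline⟩, uC, huC, hν⟩ := hu
  obtain ⟨⟨hgB, gC, hgC, hdet⟩, hgL⟩ := hg
  refine ⟨⟨hbij.comp g.bijective, fun v w => ?_, ?_⟩, uC.comp gC, fun v => ?_, ?_⟩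
  · change 𝒯.metric.form u.1 (frameMap u (g v)) (frameMap u (g w)) = _
    rw [hiso, hgB]
  · change L.map ((frameMap u : V →ₗ[ℝ] T u.1).comp (g : V →ₗ[ℝ] V)) = 𝒯.line u.1
    rw [Submodule.map_comp, ← hline]
    congr 1
    ext v
    constructor
    · rintro ⟨w, hw, rfl⟩
      exact (hgL w).mpr hw
    · intro hv
      refine ⟨g.symm v, (hgL _).mp ?_, g.apply_symm_apply v⟩
      rwa [g.apply_symm_apply]
  · change uC (gC v) = ComplexFiber.of (J.endo u.1) (J.sq u.1) (frameMap u (g v))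
    rw [huC, hgC]
  · obtain ⟨c₀, hc⟩ := exists_eq_smul_ιMulti b ν₀
    -- the determinant of `g` is the factor by which it acts on the top exterior power
    have h1 : exteriorPower.map m gC ν₀ = ν₀ := by
      rw [hc, map_smul, exteriorPower.map_apply_ιMulti]
      have h2 := ιMulti_eq_det_smul b (gC ∘ b)
      have h3 := b.det_comp gC b
      rw [b.det_self, hdet, mul_one] at h3
      rw [h2, h3, one_smul]
    have h2 : exteriorPower.map m (uC.comp gC) ν₀ = ν u.1 := by
      rw [exteriorPower.map_comp, LinearMap.comp_apply, h1, hν]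
    exact h2

/-- Two frames of the reduced bundle at the same point differ by an element of `P^{SU}`. -/
theorem exists_frameComp_eq (b : Module.Basis (Fin m) ℂ V) (hν₀ : ν₀ ≠ 0)
    {u u' : FrameSpace F T V} (hu : u ∈ suBundle 𝒯 B L J ν₀ ν) (hu' : u' ∈ suBundle 𝒯 B L J ν₀ ν)
    (h : u.1 = u'.1) :
    ∃ g : V ≃L[ℝ] V, g ∈ suStabilizer B L ∧ u' = frameComp (g : V →L[ℝ] V) u := by
  obtain ⟨c₀, hc⟩ := exists_eq_smul_ιMulti b ν₀
  have hc₀ : c₀ ≠ 0 := by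
    rintro rfl
    exact hν₀ (by rw [hc, zero_smul])
  obtain ⟨x, f'⟩ := u'
  obtain ⟨x', f⟩ := u
  change x' = x at h
  subst h
  let u : FrameSpace F T V := ⟨x', f⟩
  let u' : FrameSpace F T V := ⟨x', f'⟩
  change u ∈ _ at hu
  change u' ∈ _ at hu'
  obtain ⟨U, hU, hUν⟩ := exists_suEquiv hu
  obtain ⟨U', hU', hUν'⟩ := exists_suEquiv hu'
  have hbij := hu.1.1
  have hsurj : ∀ v, frameMap u ((frameMap u).inverse v) = v := frame_apply_inverse hbij
  let aC : V ≃ₗ[ℂ] V := U'.trans U.symm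
  let a : V →L[ℝ] V := LinearMap.toContinuousLinearMap ((aC : V →ₗ[ℂ] V).restrictScalars ℝ)
  have ha : ∀ v, a v = aC v := fun v => rfl
  have hUa : ∀ v, U (aC v) = U' v := fun v => U.apply_symm_apply _
  have hua : ∀ v, frameMap u (a v) = frameMap u' v := fun v => by
    have h1 := hUa v
    rw [hU, hU'] at h1
    exact h1
  have hdet : LinearMap.det (aC : V →ₗ[ℂ] V) = 1 := by
    have h1 := b.det_comp (aC : V →ₗ[ℂ] V) b
    rw [b.det_self, mul_one] at h1
    have h2 := ιMulti_map_eq b U ((aC : V →ₗ[ℂ] V) ∘ b)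
    rw [h1] at h2
    have h3 : (fun i => U (((aC : V →ₗ[ℂ] V) ∘ b) i)) = fun i => U' (b i) :=
      funext fun i => hUa (b i)
    rw [h3] at h2
    have h4 := hUν'.trans hUν.symm
    rw [hc, map_smul, map_smul, exteriorPower.map_apply_ιMulti,
      exteriorPower.map_apply_ιMulti] at h4
    have h5 : exteriorPower.ιMulti ℂ m (fun i => U' (b i)) =
      exteriorPower.ιMulti ℂ m (fun i => U (b i)) := smul_right_injective _ hc₀ h4
    rw [h5] at h2
    refine smul_left_injective ℂ (ιMulti_ne_zero_of_equiv b U) ?_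
    change _ • _ = (1 : ℂ) • _
    rw [one_smul]
    exact h2.symm
  have hBa : ∀ v w, B (a v) (a w) = B v w := by
    intro v w
    have h1 := hermitianExtension_map (h := fun v w => 𝒯.metric.form x' v w) (J := J.endo x')
      (U := frameMap u) (suBundle_complex hu) hu.1.2.1 (a v) (a w)
    have h2 := hermitianExtension_map (h := fun v w => 𝒯.metric.form x' v w) (J := J.endo x')
      (U := frameMap u') (suBundle_complex hu') hu'.1.2.1 v w
    rw [← h1, ← h2, hua, hua]
  have hLa : ∀ v ∈ L, a v ∈ L := by
    intro v hv
    have h1 : frameMap u' v ∈ 𝒯.line x' := by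
      have := hu'.1.2.2
      change L.map (frameMap u' : V →ₗ[ℝ] T x') = 𝒯.line x' at this
      rw [← this]
      exact ⟨v, hv, rfl⟩
    have h2 : L.map (frameMap u : V →ₗ[ℝ] T x') = 𝒯.line x' := hu.1.2.2
    rw [← h2] at h1
    obtain ⟨w, hw, hwv⟩ := h1
    have h3 : w = a v := hbij.1 (hwv.trans (hua v).symm)
    rwa [← h3]
  obtain ⟨g, hg, hga⟩ := mem_endSet_suStabilizer hBa (fun v => (ha v).symm) hdet hLa
  refine ⟨g, hg, ?_⟩
  refine congrArg (TotalSpace.mk x') (ContinuousLinearMap.ext fun v => ?_)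
  change frameMap u' v = frameMap u ((g : V →L[ℝ] V) v)
  have hga' : (g : V →L[ℝ] V) = a := hga
  rw [hga', hua]

theorem frameComp_injective {u : FrameSpace F T V} (hu : Function.Bijective (frameMap u))
    {a a' : V →L[ℝ] V} (h : frameComp a u = frameComp a' u) : a = a' := by
  obtain ⟨x, f⟩ := u
  have h1 := eq_of_heq (TotalSpace.mk.injEq .. ▸ h : _ ∧ _).2
  ext v
  exact hu.1 (congrArg (fun A : V →L[ℝ] T x => A v) h1)

theorem frameComp_mem_suBundle_iff (b : Module.Basis (Fin m) ℂ V) (hν₀ : ν₀ ≠ 0)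
    {u : FrameSpace F T V} (hu : u ∈ suBundle 𝒯 B L J ν₀ ν) (a : V →L[ℝ] V) :
    frameComp a u ∈ suBundle 𝒯 B L J ν₀ ν ↔ a ∈ endSet (suStabilizer B L) := by
  constructor
  · intro h
    obtain ⟨g, hg, h1⟩ := exists_frameComp_eq b hν₀ hu h rfl
    exact ⟨g, hg, (frameComp_injective hu.1.1 h1).symm⟩
  · rintro ⟨g, hg, rfl⟩
    exact frameComp_mem_suBundle b hu hg

end ReducedBundle

/-! ### The reduced bundle is a principal bundle -/

section Principal

variable {n : ℕ} {M : Type*} [TopologicalSpace M] [ChartedSpace (EuclideanSpace ℝ (Fin n)) M]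
  {F : Type*} [NormedAddCommGroup F] [NormedSpace ℝ F]
  {T : M → Type*} [TopologicalSpace (TotalSpace F T)]
  [∀ x, AddCommGroup (T x)] [∀ x, Module ℝ (T x)] [∀ x, TopologicalSpace (T x)]
  [∀ x, IsTopologicalAddGroup (T x)] [∀ x, ContinuousSMul ℝ (T x)]
  [FiberBundle F T] [VectorBundle ℝ F T]
  {V : Type*} [NormedAddCommGroup V] [NormedSpace ℂ V] [FiniteDimensional ℂ V]
  [ContMDiffVectorBundle ∞ F T (𝓡 n)]
  [FiniteDimensional ℝ F] [T2Space M] [IsManifold (𝓡 n) ∞ M]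
  {r s : ℕ} {c : ConformalStructure n M r s} {𝒯 : StandardTractorBundle F T c}
  {B : V →ₗ⋆[ℂ] V →ₗ[ℂ] ℂ} {L : Submodule ℝ V} {J : OrthogonalComplexStructure 𝒯.metric}
  {m : ℕ} {ν₀ : ⋀[ℂ]^m V} {ν : (x : M) → ⋀[ℂ]^m (J.Fiber x)}

/-- Local sections of the reduced bundle, in the coordinates of the preferred trivializations. -/
def HasLocalSections (S : Set (FrameSpace F T V)) : Prop :=
  ∀ x₀ : M, ∃ W : Set M, IsOpen W ∧ x₀ ∈ W ∧ W ⊆ coordDomain F T x₀ ∧ ∃ Û : M → V →L[ℝ] F,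
    ContMDiffOn (𝓡 n) 𝓘(ℝ, V →L[ℝ] F) ∞ Û W ∧ ∀ x ∈ W, frameOf x₀ x (Û x) ∈ S

theorem frameOf_bijective_iff {x₀ x : M} (hx : x ∈ coordDomain F T x₀) {A : V →L[ℝ] F} :
    Function.Bijective (frameMap (frameOf x₀ x A : FrameSpace F T V)) ↔ Function.Bijective A := by
  rw [← frameCoord_bijective_iff (u := frameOf x₀ x A) hx, frameCoord_frameOf hx]

theorem contMDiffWithinAt_frameOf {E' : Type*} [NormedAddCommGroup E'] [NormedSpace ℝ E']
    {H' : Type*} [TopologicalSpace H'] {I' : ModelWithCorners ℝ E' H'} {X : Type*}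
    [TopologicalSpace X] [ChartedSpace H' X] {x₀ : M} {f : X → M} {A : X → V →L[ℝ] F} {S : Set X}
    {a : X} (ha : f a ∈ coordDomain F T x₀) (hf : ContMDiffWithinAt I' (𝓡 n) ∞ f S a)
    (hA : ContMDiffWithinAt I' 𝓘(ℝ, V →L[ℝ] F) ∞ A S a) :
    ContMDiffWithinAt I' (frameModel n F V) ∞
      (fun y => (frameOf x₀ (f y) (A y) : FrameSpace F T V)) S a := by
  refine (contMDiffWithinAt_frame_iff (x₀ := x₀) ha).mpr ⟨hf, ?_⟩
  refine hA.congr_of_eventuallyEq ?_ (frameCoord_frameOf ha _)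
  filter_upwards [hf.continuousWithinAt.preimage_mem_nhdsWithin (coordDomain_mem_nhds ha)]
    with y hy using frameCoord_frameOf hy _

variable (n) in
theorem extChartAt_frame (u q : FrameSpace F T V) :
    extChartAt (frameModel n F V) u q = (extChartAt (𝓡 n) u.1 q.1, frameCoord u.1 q) := by
  rw [FiberBundle.extChartAt]
  have key : (trivializationAt (V →L[ℝ] F) (fun x : M => Trivial M V x →L[ℝ] T x) u.1 q).2 =
      frameCoord u.1 q := by
    rw [hom_trivializationAt_apply]
    ext v
    simp [ContinuousLinearMap.inCoordinates, frameCoord, toCoord]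
  have key' : (trivializationAt (V →L[ℝ] F) (fun x : M => Trivial M V x →L[ℝ] T x) u.1 q).1 =
      q.1 := by
    rw [hom_trivializationAt_apply]
  refine Prod.ext ?_ key
  exact congrArg (extChartAt (𝓡 n) u.1) key'

/-- A local section of the reduced bundle through a given point. -/
theorem exists_section_through (b : Module.Basis (Fin m) ℂ V) (hν₀ : ν₀ ≠ 0)
    (hsec : HasLocalSections (n := n) (suBundle 𝒯 B L J ν₀ ν)) {u : FrameSpace F T V}
    (hu : u ∈ suBundle 𝒯 B L J ν₀ ν) :
    ∃ W : Set M, IsOpen W ∧ u.1 ∈ W ∧ W ⊆ coordDomain F T u.1 ∧ ∃ Û : M → V →L[ℝ] F,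
      ContMDiffOn (𝓡 n) 𝓘(ℝ, V →L[ℝ] F) ∞ Û W ∧ Û u.1 = frameCoord u.1 u ∧
      ∀ x ∈ W, frameOf u.1 x (Û x) ∈ suBundle 𝒯 B L J ν₀ ν := by
  obtain ⟨W, hW, huW, hWc, Û, hÛ, hS⟩ := hsec u.1
  obtain ⟨g, hg, hug⟩ := exists_frameComp_eq b hν₀ (hS u.1 huW) hu rfl
  refine ⟨W, hW, huW, hWc, fun x => (Û x).comp (g : V →L[ℝ] V), ?_, ?_, fun x hx => ?_⟩
  · exact hÛ.clm_comp contMDiffOn_const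
  · have h1 : u = frameOf u.1 u.1 ((Û u.1).comp (g : V →L[ℝ] V)) := hug
    have h2 := congrArg (frameCoord u.1) h1
    rw [h2, frameCoord_frameOf (hWc huW)]
  · exact frameComp_mem_suBundle b (hS x hx) hg

theorem finrank_top_prod {E G : Type*} [NormedAddCommGroup E] [NormedSpace ℝ E]
    [FiniteDimensional ℝ E] [NormedAddCommGroup G] [NormedSpace ℝ G] [FiniteDimensional ℝ G]
    (W : Submodule ℝ G) :
    Module.finrank ℝ ((⊤ : Submodule ℝ E).prod W) =
      Module.finrank ℝ E + Module.finrank ℝ W := by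
  let e : ((⊤ : Submodule ℝ E).prod W) ≃ₗ[ℝ] E × W :=
    { toFun := fun z => (z.1.1, ⟨z.1.2, z.2.2⟩)
      invFun := fun z => ⟨(z.1, z.2), trivial, z.2.2⟩
      left_inv := fun _ => rfl
      right_inv := fun _ => rfl
      map_add' := fun _ _ => rfl
      map_smul' := fun _ _ => rfl }
  rw [e.finrank_eq, Module.finrank_prod]

/-- If `Û` is a local section through `u`, then `(x, A) ↦ Û(x) exp A` is a local parametrization of
the frame space, and the reduced bundle corresponds to the `A` in the Lie algebra of its structure
group. -/
theorem isEmbeddedSubmanifold_suBundle {r' s' : ℕ} (hB : HasHermitianSignature B r' s')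
    (b : Module.Basis (Fin m) ℂ V) (hν₀ : ν₀ ≠ 0)
    (hsec : HasLocalSections (n := n) (suBundle 𝒯 B L J ν₀ ν)) :
    IsEmbeddedSubmanifold (frameModel n F V) (suBundle 𝒯 B L J ν₀ ν) := by
  have hcV : CompleteSpace V := FiniteDimensional.complete ℝ V
  have hcF : CompleteSpace F := FiniteDimensional.complete ℝ F
  refine isEmbeddedSubmanifold_of_parametrization
    (n + Module.finrank ℝ (suStabilizerAlgebra B L)) fun u hu => ?_
  obtain ⟨W, hW, huW, hWc, Û, hÛ, hÛu, hS⟩ := exists_section_through b hν₀ hsec hu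
  obtain ⟨A, hA⟩ := exists_equiv_of_bijective ((frameCoord_bijective_iff (hWc huW)).mpr hu.1.1)
  let P : (V →L[ℝ] F) ≃L[ℝ] (V →L[ℝ] V) := (ContinuousLinearEquiv.refl ℝ V).arrowCongr A.symm
  have hP : ∀ C v, A (P C v) = C v := fun C v => by simp [P]
  let φ := extChartAt (𝓡 n) u.1
  let y₀ := φ u.1
  have hy₀ : φ.symm y₀ = u.1 := extChartAt_to_inv u.1
  let Ψ : EuclideanSpace ℝ (Fin n) × (V →L[ℝ] F) → V →L[ℝ] F := fun z =>
    (Û (φ.symm z.1)).comp (NormedSpace.exp (P z.2))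
  have hpre : ∀ᶠ z : EuclideanSpace ℝ (Fin n) × (V →L[ℝ] F) in 𝓝 (y₀, 0),
      z.1 ∈ φ.target ∧ φ.symm z.1 ∈ W ∧ (NormedSpace.exp (P z.2) ∈ endSet (suStabilizer B L) ↔
        P z.2 ∈ suStabilizerAlgebra B L) := by
    have h1 : ∀ᶠ y in 𝓝 y₀, y ∈ φ.target ∧ φ.symm y ∈ W :=
      Filter.Eventually.and (extChartAt_target_mem_nhds (I := 𝓡 n) u.1)
        (eventually_chart (n := n) (hW.mem_nhds huW))
    have h2 : ∀ᶠ C in 𝓝 (0 : V →L[ℝ] F), NormedSpace.exp (P C) ∈ endSet (suStabilizer B L) ↔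
        P C ∈ suStabilizerAlgebra B L := by
      have h3 := eventually_exp_mem_iff hB L
      rw [← P.map_zero] at h3
      exact P.continuous.continuousAt.eventually h3
    filter_upwards [(h1.prod_nhds h2 :)] with z hz using ⟨hz.1.1, hz.1.2, hz.2⟩
  have hΦ : ∀ y ∈ φ.target, ContMDiffAt 𝓘(ℝ, EuclideanSpace ℝ (Fin n)) (𝓡 n) ∞ φ.symm y :=
    fun y hy => (contMDiffOn_extChartAt_symm (n := ∞) u.1).contMDiffAt
      ((isOpen_extChartAt_target u.1).mem_nhds hy)
  have hsecC : ∀ y ∈ φ.target, φ.symm y ∈ W → ContDiffAt ℝ ∞ (fun y => Û (φ.symm y)) y :=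
    fun y hy hyW => ((hÛ.contMDiffAt (hW.mem_nhds hyW)).comp y (hΦ y hy)).contDiffAt
  have hexp : ContDiff ℝ ∞ fun C : V →L[ℝ] F => NormedSpace.exp (P C) :=
    contDiff_exp.comp P.contDiff
  have hΨ : ∀ z : EuclideanSpace ℝ (Fin n) × (V →L[ℝ] F), z.1 ∈ φ.target → φ.symm z.1 ∈ W →
      ContDiffAt ℝ ∞ Ψ z := fun z h1 h2 =>
    ((hsecC z.1 h1 h2).comp z contDiffAt_fst).clm_comp (hexp.contDiffAt.comp z contDiffAt_snd)
  have hy₀t : y₀ ∈ φ.target := mem_extChartAt_target u.1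
  let D := fderiv ℝ (fun y => Û (φ.symm y)) y₀
  have hD : HasFDerivAt (fun y => Û (φ.symm y)) D y₀ :=
    ((hsecC y₀ hy₀t (by rw [hy₀]; exact huW)).differentiableAt (by simp)).hasFDerivAt
  let f' : (EuclideanSpace ℝ (Fin n) × (V →L[ℝ] F)) ≃L[ℝ] EuclideanSpace ℝ (Fin n) × (V →L[ℝ] F) :=
    (ContinuousLinearEquiv.refl ℝ _).skewProd (ContinuousLinearEquiv.refl ℝ _) D
  have hÛ₀ : Û (φ.symm y₀) = A := by rw [hy₀, hÛu, hA]
  have hΨ' : HasFDerivAt Ψ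
      (D.comp (ContinuousLinearMap.fst ℝ _ _) + ContinuousLinearMap.snd ℝ _ _) (y₀, 0) := by
    have h1 : HasFDerivAt (fun z : EuclideanSpace ℝ (Fin n) × (V →L[ℝ] F) => Û (φ.symm z.1))
        (D.comp (ContinuousLinearMap.fst ℝ _ _)) (y₀, 0) :=
      HasFDerivAt.comp (g := fun y => Û (φ.symm y))
        (f := fun z : EuclideanSpace ℝ (Fin n) × (V →L[ℝ] F) => z.1) (y₀, (0 : V →L[ℝ] F)) hD
        hasFDerivAt_fst
    have h2 : HasFDerivAt (fun z : EuclideanSpace ℝ (Fin n) × (V →L[ℝ] F) =>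
        NormedSpace.exp (P z.2))
        ((P : (V →L[ℝ] F) →L[ℝ] (V →L[ℝ] V)).comp (ContinuousLinearMap.snd ℝ _ _)) (y₀, 0) := by
      have h3 : HasFDerivAt (NormedSpace.exp : (V →L[ℝ] V) → (V →L[ℝ] V))
          (1 : (V →L[ℝ] V) →L[ℝ] (V →L[ℝ] V)) (P 0) := by
        rw [map_zero]; exact hasFDerivAt_exp_zero
      exact HasFDerivAt.comp (y₀, 0) h3 (P.hasFDerivAt.comp (y₀, (0 : V →L[ℝ] F)) hasFDerivAt_snd)
    refine (h1.clm_comp h2).congr_fderiv ?_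
    refine ContinuousLinearMap.ext fun z => ContinuousLinearMap.ext fun v => ?_
    change Û (φ.symm y₀) (P z.2 v) + D z.1 (NormedSpace.exp (P 0) v) = D z.1 v + z.2 v
    rw [hÛ₀, map_zero, NormedSpace.exp_zero, add_comm]
    exact congrArg _ (hP z.2 v)
  refine ⟨(y₀, 0), fun z => frameOf u.1 (φ.symm z.1) (Ψ z), f',
    (⊤ : Submodule ℝ (EuclideanSpace ℝ (Fin n))).prod
      ((suStabilizerAlgebra B L).comap (P : (V →L[ℝ] F) →ₗ[ℝ] (V →L[ℝ] V))), ?_, ?_, ?_, ?_⟩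
  · have h1 : Ψ (y₀, 0) = frameCoord u.1 u := by
      change (Û (φ.symm y₀)).comp (NormedSpace.exp (P 0)) = _
      rw [map_zero, NormedSpace.exp_zero, hy₀, hÛu]
      rfl
    change frameOf u.1 (φ.symm y₀) (Ψ (y₀, 0)) = u
    rw [h1, hy₀]
    exact frameOf_frameCoord (hWc huW)
  · filter_upwards [hpre] with z hz
    refine ⟨(contMDiffWithinAt_frameOf (S := univ) (a := z) (f := fun z => φ.symm z.1) (A := Ψ)
      (hWc hz.2.1) ?_ ?_).contMDiffAt univ_mem, ?_⟩
    · exact ((hΦ z.1 hz.1).comp z contDiffAt_fst.contMDiffAt).contMDiffWithinAt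
    · exact (hΨ z hz.1 hz.2.1).contMDiffAt.contMDiffWithinAt
    · refine (frameComp_mem_suBundle_iff b hν₀ (hS _ hz.2.1) _).trans (hz.2.2.trans ?_)
      simp [Submodule.mem_prod]
  · have h1 : HasFDerivAt (fun z : EuclideanSpace ℝ (Fin n) × (V →L[ℝ] F) => (z.1, Ψ z))
        (f' : (EuclideanSpace ℝ (Fin n) × (V →L[ℝ] F)) →L[ℝ] _) (y₀, 0) := by
      refine (hasFDerivAt_fst.prodMk hΨ').congr_fderiv ?_
      ext z
      · simp [f']
      · simp [f']
      · simp [f']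
      · simp [f']
    refine h1.congr_of_eventuallyEq ?_
    filter_upwards [hpre] with z hz
    rw [extChartAt_frame n u, frameCoord_frameOf (hWc hz.2.1)]
    refine Prod.ext ?_ rfl
    exact φ.right_inv hz.1
  · rw [finrank_top_prod]
    congr 1
    · simp
    · exact (P.toLinearEquiv.submoduleMap _).finrank_eq.trans
        (by rw [Submodule.map_comap_eq_of_surjective P.surjective])

/-- The reduced bundle is a principal bundle. -/
theorem isPrincipalFrameBundle_suBundle {r' s' : ℕ} (hB : HasHermitianSignature B r' s')
    (b : Module.Basis (Fin m) ℂ V) (hν₀ : ν₀ ≠ 0)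
    (hsec : HasLocalSections (n := n) (suBundle 𝒯 B L J ν₀ ν)) :
    IsPrincipalFrameBundle n (suBundle 𝒯 B L J ν₀ ν) (suStabilizer B L) where
  frames u hu := hu.1.1
  group_submanifold := isEmbeddedSubmanifold_suStabilizer hB L
  total_submanifold := isEmbeddedSubmanifold_suBundle hB b hν₀ hsec
  action_mem u hu g hg := frameComp_mem_suBundle b hu hg
  simply_transitive u hu u' hu' h := by
    obtain ⟨g, hg, hug⟩ := exists_frameComp_eq b hν₀ hu hu' h
    refine ⟨g, ⟨hg, hug⟩, fun g' hg' => ?_⟩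
    have h1 := frameComp_injective hu.1.1 (hug.symm.trans hg'.2)
    ext v
    exact congrArg (fun A : V →L[ℝ] V => A v) h1.symm
  locally_trivial x₀ := by
    have hcV : CompleteSpace V := FiniteDimensional.complete ℝ V
    obtain ⟨W, hW, hxW, hWc, Û, hÛ, hS⟩ := hsec x₀
    have hbij : ∀ x ∈ W, Function.Bijective (Û x) := fun x hx =>
      (frameOf_bijective_iff (hWc hx)).mp (hS x hx).1.1
    have hinv : ∀ x ∈ W, ∀ a : V →L[ℝ] V, (Û x).inverse.comp ((Û x).comp a) = a := by
      intro x hx a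
      obtain ⟨A, hA⟩ := exists_equiv_of_bijective (hbij x hx)
      rw [← hA, ContinuousLinearMap.inverse_equiv]
      ext v
      exact A.symm_apply_apply _
    have hinvs : ∀ x ∈ W, ContMDiffAt (𝓡 n) 𝓘(ℝ, F →L[ℝ] V) ∞ (fun x => (Û x).inverse) x := by
      intro x hx
      obtain ⟨A, hA⟩ := exists_equiv_of_bijective (hbij x hx)
      have h1 := (contDiffAt_map_inverse (n := ∞) A).contMDiffAt
      rw [hA] at h1
      exact h1.comp x (hÛ.contMDiffAt (hW.mem_nhds hx))
    have hτ : ∀ x ∈ W, ∀ a : V →L[ℝ] V, (Û x).inverse.comp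
        (frameCoord x₀ (frameOf x₀ x ((Û x).comp a) : FrameSpace F T V)) = a := by
      intro x hx a
      rw [frameCoord_frameOf (hWc hx), hinv x hx]
    refine ⟨W, hW, hxW, fun u => (Û u.1).inverse.comp (frameCoord x₀ u),
      fun z => frameOf x₀ z.1 ((Û z.1).comp z.2), ?_, ?_, ?_, ?_, ?_⟩
    · rintro u ⟨-, huW⟩
      exact (((hinvs u.1 huW).comp u (contMDiff_frameProj u)).clm_comp
        (contMDiffAt_frameCoord (hWc huW))).contMDiffWithinAt
    · rintro ⟨x, a⟩ ⟨hx, -⟩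
      refine contMDiffWithinAt_frameOf (hWc hx) contMDiff_fst.contMDiffAt.contMDiffWithinAt ?_
      refine ContMDiffAt.contMDiffWithinAt ?_
      exact ((hÛ.contMDiffAt (hW.mem_nhds hx)).comp (x, a) contMDiffAt_fst).clm_comp
        contMDiffAt_snd
    · intro u hu huW
      obtain ⟨g, hg, hug⟩ := exists_frameComp_eq b hν₀ (hS u.1 huW) hu rfl
      have h1 : u = frameOf x₀ u.1 ((Û u.1).comp (g : V →L[ℝ] V)) := hug
      have h2 : (Û u.1).inverse.comp (frameCoord x₀ u) = (g : V →L[ℝ] V) := by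
        have := hτ u.1 huW g
        rwa [← h1] at this
      simp only [h2]
      exact ⟨⟨g, hg, rfl⟩, h1.symm⟩
    · intro x hx a ha
      refine ⟨(frameComp_mem_suBundle_iff b hν₀ (hS x hx) a).mpr ha, rfl, hτ x hx a⟩
    · intro u hu huW g hg
      rfl

end Principal

/-! ### Tangent vectors of the reduced bundle -/

section Curves

variable {n : ℕ} {M : Type*} [TopologicalSpace M] [ChartedSpace (EuclideanSpace ℝ (Fin n)) M]
  {F : Type*} [NormedAddCommGroup F] [NormedSpace ℝ F]
  {T : M → Type*} [TopologicalSpace (TotalSpace F T)]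
  [∀ x, AddCommGroup (T x)] [∀ x, Module ℝ (T x)] [∀ x, TopologicalSpace (T x)]
  [∀ x, IsTopologicalAddGroup (T x)] [∀ x, ContinuousSMul ℝ (T x)]
  [FiberBundle F T] [VectorBundle ℝ F T]
  {V : Type*} [NormedAddCommGroup V] [NormedSpace ℂ V] [FiniteDimensional ℂ V]
  [ContMDiffVectorBundle ∞ F T (𝓡 n)]
  [FiniteDimensional ℝ F] [T2Space M] [IsManifold (𝓡 n) ∞ M]

variable (n) in
theorem mfderiv_extChartAt_injective {x : M} {ξ η : TangentSpace (𝓡 n) x}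
    (h : mvfderiv (𝓡 n) (extChartAt (𝓡 n) x) x ξ = mvfderiv (𝓡 n) (extChartAt (𝓡 n) x) x η) :
    ξ = η := by
  obtain ⟨e, he⟩ := isInvertible_mfderiv_extChartAt (I := 𝓡 n) (mem_extChartAt_source x)
  have h1 : ∀ ζ, e ζ = mvfderiv (𝓡 n) (extChartAt (𝓡 n) x) x ζ := fun ζ =>
    congrArg (fun A : TangentSpace (𝓡 n) x →L[ℝ] EuclideanSpace ℝ (Fin n) => A ζ) he
  exact e.injective (by rw [h1, h1, h])

theorem exists_tangentMap_eq {X E' H' : Type*} [NormedAddCommGroup E'] [NormedSpace ℝ E']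
    [TopologicalSpace H'] {I : ModelWithCorners ℝ E' H'} [TopologicalSpace X] [ChartedSpace H' X]
    {γ : ℝ → X} {u : X} (h : γ 0 = u) : ∃ ξ : TangentSpace I u,
      tangentMap 𝓘(ℝ, ℝ) I γ ⟨0, (1 : ℝ)⟩ = (⟨u, ξ⟩ : TangentBundle I X) := by
  subst h
  exact ⟨_, rfl⟩

/-- A nonzero multiple of any tangent vector is the velocity of a curve in a given neighbourhood
which is defined for all times. -/
theorem exists_curve {x : M} {W : Set M} (hW : W ∈ 𝓝 x) (X : TangentSpace (𝓡 n) x) :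
    ∃ (c : ℝ → M) (ε : ℝ), ε ≠ 0 ∧ ContMDiff 𝓘(ℝ, ℝ) (𝓡 n) ∞ c ∧ (∀ t, c t ∈ W) ∧
      tangentMap 𝓘(ℝ, ℝ) (𝓡 n) c ⟨0, (1 : ℝ)⟩ = (⟨x, ε • X⟩ : TangentBundle (𝓡 n) M) := by
  let φ := extChartAt (𝓡 n) x
  let v : EuclideanSpace ℝ (Fin n) := mvfderiv (𝓡 n) φ x X
  have h1 : ∀ᶠ y in 𝓝 (φ x), y ∈ φ.target ∧ φ.symm y ∈ W :=
    Filter.Eventually.and (extChartAt_target_mem_nhds (I := 𝓡 n) x) (eventually_chart (n := n) hW)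
  obtain ⟨δ, hδ, hball⟩ := Metric.eventually_nhds_iff_ball.mp h1
  let ε := δ / (‖v‖ + 1)
  have hε : 0 < ε := by positivity
  -- the sine keeps the curve in a ball around `φ x`
  let k : ℝ → EuclideanSpace ℝ (Fin n) := fun t => φ x + (Real.sin t * ε) • v
  have hk : ∀ t, k t ∈ Metric.ball (φ x) δ := by
    intro t
    rw [Metric.mem_ball, dist_eq_norm]
    simp only [k, add_sub_cancel_left, norm_smul, norm_mul, Real.norm_eq_abs, abs_of_pos hε]
    calc |Real.sin t| * ε * ‖v‖ ≤ 1 * ε * ‖v‖ := by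
          gcongr
          exact Real.abs_sin_le_one t
      _ < ε * (‖v‖ + 1) := by linarith
      _ = δ := div_mul_cancel₀ _ (by positivity)
  have hks : ContDiff ℝ ∞ k := contDiff_const.add
    (((Real.contDiff_sin.of_le le_top).mul contDiff_const).smul contDiff_const)
  have hc : ContMDiff 𝓘(ℝ, ℝ) (𝓡 n) ∞ fun t => φ.symm (k t) := fun t =>
    ((contMDiffOn_extChartAt_symm (n := ∞) x).contMDiffAt
      ((isOpen_extChartAt_target x).mem_nhds (hball _ (hk t)).1)).comp t hks.contMDiff.contMDiffAt
  refine ⟨fun t => φ.symm (k t), ε, hε.ne', hc, fun t => (hball _ (hk t)).2, ?_⟩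
  have h0 : φ.symm (k 0) = x := by
    simp only [k, Real.sin_zero, zero_mul, zero_smul, add_zero]
    exact extChartAt_to_inv x
  obtain ⟨ζ, hζ⟩ := exists_tangentMap_eq (I := 𝓡 n) (γ := fun t => φ.symm (k t)) h0
  rw [hζ]
  congr 1
  refine mfderiv_extChartAt_injective n ?_
  rw [map_smul]
  have h3 := hasDerivAt_comp_curve hc hζ (mdifferentiableAt_extChartAt (mem_chart_source _ x))
  have h4 : (φ ∘ fun t => φ.symm (k t)) = k := funext fun t => φ.right_inv (hball _ (hk t)).1
  rw [h4] at h3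
  have h5 : HasDerivAt k (ε • v) 0 := by
    have h6 := (((Real.hasDerivAt_sin 0).mul_const ε).smul_const v).const_add (φ x)
    rwa [Real.cos_zero, one_mul] at h6
  exact h3.unique h5

/-- A tangent vector of the frame space is determined by its projection to `M` and its component in
the preferred trivialization. -/
theorem frame_tangent_eq_zero {u : FrameSpace F T V} {ξ : TangentSpace (frameModel n F V) u}
    (h1 : frameProj n u ξ = 0)
    (h2 : mvfderiv (frameModel n F V) (frameCoord u.1) u ξ = 0) : ξ = 0 := by
  have hd : MDifferentiableAt (frameModel n F V) 𝓘(ℝ, EuclideanSpace ℝ (Fin n) × (V →L[ℝ] F))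
    (extChartAt (frameModel n F V) u) u := mdifferentiableAt_extChartAt (mem_chart_source _ u)
  obtain ⟨e, he⟩ := isInvertible_mfderiv_extChartAt (I := frameModel n F V)
    (mem_extChartAt_source u)
  have h3 : e ξ = mvfderiv (frameModel n F V) (extChartAt (frameModel n F V) u) u ξ :=
    congrArg (fun A : TangentSpace (frameModel n F V) u →L[ℝ]
      EuclideanSpace ℝ (Fin n) × (V →L[ℝ] F) => A ξ) he
  have hf := mvfderiv_clm_comp (ContinuousLinearMap.fst ℝ _ _) hd ξ
  have hs := mvfderiv_clm_comp (ContinuousLinearMap.snd ℝ _ _) hd ξ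
  simp only [extChartAt_frame n u] at hf hs
  have hf' : mvfderiv (frameModel n F V)
      (fun q : FrameSpace F T V => extChartAt (𝓡 n) u.1 q.1) u ξ = 0 := by
    have h4 := mfderiv_comp u (I' := 𝓡 n) (I'' := 𝓘(ℝ, EuclideanSpace ℝ (Fin n)))
      (mdifferentiableAt_extChartAt (I := 𝓡 n) (mem_chart_source _ u.1))
      ((contMDiff_frameProj (n := n) (V := V) (F := F) (T := T) u).mdifferentiableAt
        (by simp : (∞ : WithTop ℕ∞) ≠ 0))
    refine (congrArg (fun A : TangentSpace (frameModel n F V) u →L[ℝ]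
      EuclideanSpace ℝ (Fin n) => A ξ) h4).trans ?_
    change mfderiv (𝓡 n) 𝓘(ℝ, EuclideanSpace ℝ (Fin n)) (extChartAt (𝓡 n) u.1) u.1
      (frameProj n u ξ) = 0
    rw [h1, map_zero]
  apply e.injective
  rw [map_zero, h3]
  refine Prod.ext ?_ ?_
  · exact hf.symm.trans hf'
  · exact hs.symm.trans h2

theorem contMDiff_frameComp (a : V →L[ℝ] V) :
    ContMDiff (frameModel n F V) (frameModel n F V) ∞
      (frameComp a : FrameSpace F T V → FrameSpace F T V) := by
  intro u
  have hx := self_mem_coordDomain (F := F) (T := T) u.1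
  refine ((contMDiffWithinAt_frame_iff (n := n) (s := univ) (x₀ := u.1) (a := u)
    (f := fun q : FrameSpace F T V => frameComp a q) hx).mpr
    ⟨(contMDiff_frameProj u).contMDiffWithinAt, ?_⟩).contMDiffAt univ_mem
  exact ((contMDiffAt_frameCoord hx).clm_comp contMDiffAt_const).contMDiffWithinAt

/-- The orbits of one-parameter groups are smooth curves. -/
theorem contMDiff_frameComp_exp (A : V →L[ℝ] V) (u : FrameSpace F T V) :
    ContMDiff 𝓘(ℝ, ℝ) (frameModel n F V) ∞
      (fun t : ℝ => frameComp (NormedSpace.exp (t • A)) u) := by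
  have hcV : CompleteSpace V := FiniteDimensional.complete ℝ V
  intro t
  have hx := self_mem_coordDomain (F := F) (T := T) u.1
  refine ((contMDiffWithinAt_frame_iff (n := n) (s := univ) (x₀ := u.1) (a := t)
    (f := fun t : ℝ => frameComp (NormedSpace.exp (t • A)) u) hx).mpr
    ⟨contMDiffWithinAt_const, ?_⟩).contMDiffAt univ_mem
  refine ContDiff.contMDiff ?_ |>.contMDiffAt.contMDiffWithinAt
  have h1 : ContDiff ℝ ∞ fun t : ℝ => (NormedSpace.exp (t • A) : V →L[ℝ] V) :=
    contDiff_exp.comp (contDiff_id.smul contDiff_const)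
  exact (contDiff_const (c := frameCoord u.1 u)).clm_comp h1

end Curves

/-! ### Equivariance and injectivity of the connection form -/

section InducedCartan

variable {n : ℕ} {M : Type*} [TopologicalSpace M] [ChartedSpace (EuclideanSpace ℝ (Fin n)) M]
  {F : Type*} [NormedAddCommGroup F] [NormedSpace ℝ F]
  {T : M → Type*} [TopologicalSpace (TotalSpace F T)]
  [∀ x, AddCommGroup (T x)] [∀ x, Module ℝ (T x)] [∀ x, TopologicalSpace (T x)]
  [∀ x, IsTopologicalAddGroup (T x)] [∀ x, ContinuousSMul ℝ (T x)]
  [FiberBundle F T] [VectorBundle ℝ F T]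
  {V : Type*} [NormedAddCommGroup V] [NormedSpace ℂ V] [FiniteDimensional ℂ V]
  [ContMDiffVectorBundle ∞ F T (𝓡 n)]
  [FiniteDimensional ℝ F] [T2Space M] [IsManifold (𝓡 n) ∞ M]
  {r s : ℕ} {c : ConformalStructure n M r s} {𝒯 : StandardTractorBundle F T c}
  {B : V →ₗ⋆[ℂ] V →ₗ[ℂ] ℂ} {L : Submodule ℝ V} {J : OrthogonalComplexStructure 𝒯.metric}
  {m : ℕ} {ν₀ : ⋀[ℂ]^m V} {ν : (x : M) → ⋀[ℂ]^m (J.Fiber x)}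

variable (V) in
/-- The connection form at `u`, in the preferred trivialization at the base point of `u`. -/
abbrev selfConnForm (D : CovariantDerivative (𝓡 n) F T) (u : FrameSpace F T V) :
    TangentSpace (frameModel n F V) u →L[ℝ] (V →L[ℝ] V) :=
  connForm V D u.1 u

theorem frameProj_comp (a : V →L[ℝ] V) (u : FrameSpace F T V)
    (ξ : TangentSpace (frameModel n F V) u) :
    frameProj n (frameComp a u)
      (mfderiv (frameModel n F V) (frameModel n F V) (frameComp a) u ξ) = frameProj n u ξ := by
  have h1 := mfderiv_comp u
    ((contMDiff_frameProj (n := n) (V := V) (F := F) (T := T) (frameComp a u)).mdifferentiableAt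
      (by simp : (∞ : WithTop ℕ∞) ≠ 0))
    ((contMDiff_frameComp (n := n) (F := F) (T := T) a u).mdifferentiableAt
      (by simp : (∞ : WithTop ℕ∞) ≠ 0))
  exact (congrArg (fun A : TangentSpace (frameModel n F V) u →L[ℝ] TangentSpace (𝓡 n) u.1 => A ξ)
    h1).symm

/-- The function of a section is equivariant. -/
theorem inverse_frameComp {u : FrameSpace F T V} (hu : Function.Bijective (frameMap u))
    (g : V ≃L[ℝ] V) (w : T u.1) :
    (frameMap (frameComp (g : V →L[ℝ] V) u)).inverse w = g.symm ((frameMap u).inverse w) := by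
  have hug : Function.Bijective (frameMap (frameComp (g : V →L[ℝ] V) u)) :=
    hu.comp g.bijective
  apply hug.1
  refine (frame_apply_inverse hug w).trans ?_
  change w = frameMap u (g (g.symm _))
  rw [g.apply_symm_apply, frame_apply_inverse hu]

/-- The connection form is equivariant. -/
theorem selfConnForm_frameComp {D : CovariantDerivative (𝓡 n) F T} {u : FrameSpace F T V}
    (hu : Function.Bijective (frameMap u)) (g : V ≃L[ℝ] V)
    (ξ : TangentSpace (frameModel n F V) u) :
    selfConnForm V D (frameComp (g : V →L[ℝ] V) u)
        (mfderiv (frameModel n F V) (frameModel n F V) (frameComp (g : V →L[ℝ] V)) u ξ) =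
      ((g⁻¹ : V ≃L[ℝ] V) : V →L[ℝ] V).comp ((selfConnForm V D u ξ).comp (g : V →L[ℝ] V)) := by
  have hug : Function.Bijective (frameMap (frameComp (g : V →L[ℝ] V) u)) :=
    hu.comp g.bijective
  refine (eq_connForm (mem_frameDomain_self hug) fun s hs => ?_).symm
  rw [frameProj_comp]
  have h1 := inverse_frameComp hu g (D s u.1 (frameProj n u ξ))
  rw [inverse_conn (self_mem_sectionDomain _) hu ξ hs, map_add] at h1
  have hfs := (contMDiffAt_equivariantFunction (n := n) hu hs).mdifferentiableAt
    (by simp : (∞ : WithTop ℕ∞) ≠ 0)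
  have hfg := (contMDiffAt_equivariantFunction (n := n) hug hs).mdifferentiableAt
    (by simp : (∞ : WithTop ℕ∞) ≠ 0)
  have h2 : mvfderiv (frameModel n F V) (equivariantFunction V s) (frameComp (g : V →L[ℝ] V) u)
      (mfderiv (frameModel n F V) (frameModel n F V) (frameComp (g : V →L[ℝ] V)) u ξ) =
      g.symm (mvfderiv (frameModel n F V) (equivariantFunction V s) u ξ) := by
    have h3 := mfderiv_comp u hfg
      ((contMDiff_frameComp (n := n) (F := F) (T := T) (g : V →L[ℝ] V) u).mdifferentiableAt
        (by simp : (∞ : WithTop ℕ∞) ≠ 0))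
    have h4 : (equivariantFunction V s ∘ frameComp (g : V →L[ℝ] V)) =ᶠ[𝓝 u]
        fun q => (g.symm : V →L[ℝ] V) (equivariantFunction V s q) := by
      filter_upwards [eventually_bijective (n := n) hu] with q hq
      exact inverse_frameComp hq g (s q.1)
    have h5 := mvfderiv_congr (I := frameModel n F V) h4 ξ
    rw [mvfderiv_clm_comp (g.symm : V →L[ℝ] V) hfs ξ] at h5
    refine Eq.trans ?_ h5
    exact (congrArg (fun A : TangentSpace (frameModel n F V) u →L[ℝ] V => A ξ) h3).symm
  rw [h2]
  have h6 : equivariantFunction V s (frameComp (g : V →L[ℝ] V) u) =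
      g.symm (equivariantFunction V s u) := inverse_frameComp hu g _
  refine h1.trans ?_
  congr 1
  change g.symm _ = g.symm (selfConnForm V D u ξ (g _))
  rw [h6, g.apply_symm_apply]

/-- The connection form reproduces the generators of fundamental vector fields. -/
theorem selfConnForm_fundamental {D : CovariantDerivative (𝓡 n) F T} {u : FrameSpace F T V}
    (hu : Function.Bijective (frameMap u)) {A : V →L[ℝ] V} {ζ : TangentSpace (frameModel n F V) u}
    (hζ : tangentMap 𝓘(ℝ, ℝ) (frameModel n F V)
      (fun t : ℝ => frameComp (NormedSpace.exp (t • A)) u) ⟨0, (1 : ℝ)⟩ =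
        (⟨u, ζ⟩ : TangentBundle (frameModel n F V) (FrameSpace F T V))) :
    selfConnForm V D u ζ = A ∧ frameProj n u ζ = 0 := by
  have hcV : CompleteSpace V := FiniteDimensional.complete ℝ V
  have hsm := contMDiff_frameComp_exp (n := n) A u
  have hproj : frameProj n u ζ = 0 := by
    have h1 := tangentMap_comp_curve hsm hζ
      ((contMDiff_frameProj (n := n) (V := V) (F := F) (T := T) u).mdifferentiableAt
        (by simp : (∞ : WithTop ℕ∞) ≠ 0))
    have h2 : tangentMap 𝓘(ℝ, ℝ) (𝓡 n) (fun _ : ℝ => u.1) ⟨0, (1 : ℝ)⟩ =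
        (⟨u.1, 0⟩ : TangentBundle (𝓡 n) M) := by
      simp only [tangentMap, mfderiv_const]
      rfl
    have h3 := h1.symm.trans h2
    exact eq_of_heq (TotalSpace.mk.injEq .. ▸ h3 : _ ∧ _).2
  refine ⟨(eq_connForm (mem_frameDomain_self hu) fun s hs => ?_).symm, hproj⟩
  rw [hproj, map_zero, map_zero]
  have hfs := (contMDiffAt_equivariantFunction (n := n) hu hs).mdifferentiableAt
    (by simp : (∞ : WithTop ℕ∞) ≠ 0)
  have h1 := hasDerivAt_comp_curve hsm hζ hfs
  have hexp : ∀ t : ℝ, ∃ g : V ≃L[ℝ] V, (g : V →L[ℝ] V) = NormedSpace.exp (t • A) ∧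
      (g.symm : V →L[ℝ] V) = NormedSpace.exp ((-t) • A) := by
    intro t
    let _ : NormedAlgebra ℚ (V →L[ℝ] V) := NormedAlgebra.restrictScalars ℚ ℝ _
    have h2 : NormedSpace.exp (t • A) * NormedSpace.exp ((-t) • A) = 1 := by
      rw [← NormedSpace.exp_add_of_commute ((Commute.refl A).smul_left t |>.smul_right (-t)),
        ← add_smul, add_neg_cancel, zero_smul, NormedSpace.exp_zero]
    have h3 : NormedSpace.exp ((-t) • A) * NormedSpace.exp (t • A) = 1 := by
      rw [← NormedSpace.exp_add_of_commute ((Commute.refl A).smul_left (-t) |>.smul_right t),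
        ← add_smul, neg_add_cancel, zero_smul, NormedSpace.exp_zero]
    refine ⟨ContinuousLinearEquiv.equivOfInverse (NormedSpace.exp (t • A))
      (NormedSpace.exp ((-t) • A)) (fun v => ?_) (fun v => ?_), rfl, rfl⟩
    · exact congrArg (fun f : V →L[ℝ] V => f v) h3
    · exact congrArg (fun f : V →L[ℝ] V => f v) h2
  have h2 : (equivariantFunction V s ∘ fun t : ℝ => frameComp (NormedSpace.exp (t • A)) u) =
      fun t : ℝ => NormedSpace.exp ((-t) • A) (equivariantFunction V s u) := by
    funext t
    obtain ⟨g, hg, hg'⟩ := hexp t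
    rw [← hg', Function.comp_apply, ← hg]
    exact inverse_frameComp hu g _
  rw [h2] at h1
  have h3 : HasDerivAt (fun t : ℝ => NormedSpace.exp ((-t) • A) (equivariantFunction V s u))
      (-(A (equivariantFunction V s u))) 0 := by
    have h4 : HasDerivAt (fun t : ℝ => NormedSpace.exp (t • (-A))) (-A) 0 := by
      have h5 : HasFDerivAt (NormedSpace.exp : (V →L[ℝ] V) → (V →L[ℝ] V))
          (1 : (V →L[ℝ] V) →L[ℝ] (V →L[ℝ] V)) ((0 : ℝ) • (-A)) := by
        rw [zero_smul]; exact hasFDerivAt_exp_zero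
      have h6 : HasDerivAt (fun t : ℝ => t • (-A)) (-A) 0 := by
        simpa using (hasDerivAt_id (0 : ℝ)).smul_const (-A)
      exact h5.comp_hasDerivAt 0 h6
    simp only [smul_neg, ← neg_smul] at h4
    exact ((ContinuousLinearMap.apply ℝ V (equivariantFunction V s u)).hasFDerivAt.comp_hasDerivAt
      0 h4)
  rw [h1.unique h3, neg_add_cancel]

/-- Every tangent vector of `M` lifts to a tangent vector of the reduced bundle. -/
theorem exists_lift (b : Module.Basis (Fin m) ℂ V) (hν₀ : ν₀ ≠ 0)
    (hsec : HasLocalSections (n := n) (suBundle 𝒯 B L J ν₀ ν)) {u : FrameSpace F T V}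
    (hu : u ∈ suBundle 𝒯 B L J ν₀ ν) (X : TangentSpace (𝓡 n) u.1) :
    ∃ ξ ∈ tangentTo (frameModel n F V) (suBundle 𝒯 B L J ν₀ ν) u, frameProj n u ξ = X := by
  obtain ⟨W, hW, huW, hWc, Û, hÛ, hÛu, hS⟩ := exists_section_through b hν₀ hsec hu
  obtain ⟨γ, ε, hε, hγ, hγW, hγX⟩ := exists_curve (hW.mem_nhds huW) X
  let δ : ℝ → FrameSpace F T V := fun t => frameOf u.1 (γ t) (Û (γ t))
  have hδ : ContMDiff 𝓘(ℝ, ℝ) (frameModel n F V) ∞ δ := fun t =>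
    (contMDiffWithinAt_frameOf (S := univ) (hWc (hγW t)) (hγ t).contMDiffWithinAt
      ((hÛ.contMDiffAt (hW.mem_nhds (hγW t))).comp t (hγ t)).contMDiffWithinAt).contMDiffAt
      univ_mem
  have hγ0 : γ 0 = u.1 := congrArg TotalSpace.proj hγX
  have hδ0 : δ 0 = u := by
    change frameOf u.1 (γ 0) (Û (γ 0)) = u
    rw [hγ0, hÛu]
    exact frameOf_frameCoord (hWc huW)
  obtain ⟨ξ, hξ⟩ := exists_tangentMap_eq (I := frameModel n F V) hδ0
  have h1 := tangentMap_comp_curve hδ hξ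
    ((contMDiff_frameProj (n := n) (V := V) (F := F) (T := T) u).mdifferentiableAt
      (by simp : (∞ : WithTop ℕ∞) ≠ 0))
  have h2 : frameProj n u ξ = ε • X :=
    eq_of_heq (TotalSpace.mk.injEq .. ▸ h1.symm.trans hγX : _ ∧ _).2
  refine ⟨ε⁻¹ • ξ, Submodule.smul_mem _ _ (Submodule.subset_span
    ⟨δ, hδ, fun t => hS _ (hγW t), hξ⟩), ?_⟩
  rw [ContinuousLinearMap.map_smul, h2, smul_smul, inv_mul_cancel₀ hε, one_smul]

theorem mem_lieAlgebraOf {r' s' : ℕ} (hB : HasHermitianSignature B r' s') {A : V →L[ℝ] V}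
    (hA : A ∈ suStabilizerAlgebra B L) : A ∈ lieAlgebraOf (suStabilizer B L) := fun t =>
  exp_mem_suStabilizer hB (Submodule.smul_mem _ t hA)

/-- Fundamental vectors are tangent to the reduced bundle. -/
theorem exists_fundamental (b : Module.Basis (Fin m) ℂ V) {u : FrameSpace F T V}
    (hu : u ∈ suBundle 𝒯 B L J ν₀ ν) {A : V →L[ℝ] V}
    (hA : A ∈ lieAlgebraOf (suStabilizer B L)) :
    ∃ ζ ∈ tangentTo (frameModel n F V) (suBundle 𝒯 B L J ν₀ ν) u,
      tangentMap 𝓘(ℝ, ℝ) (frameModel n F V)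
        (fun t : ℝ => frameComp (NormedSpace.exp (t • A)) u) ⟨0, (1 : ℝ)⟩ =
          (⟨u, ζ⟩ : TangentBundle (frameModel n F V) (FrameSpace F T V)) ∧
      selfConnForm V 𝒯.conn u ζ = A := by
  have h0 : frameComp (NormedSpace.exp ((0 : ℝ) • A)) u = u := by
    rw [zero_smul, NormedSpace.exp_zero]
    rfl
  obtain ⟨ζ, hζ⟩ := exists_tangentMap_eq (I := frameModel n F V)
    (γ := fun t : ℝ => frameComp (NormedSpace.exp (t • A)) u) h0
  refine ⟨ζ, Submodule.subset_span ⟨_, contMDiff_frameComp_exp A u, fun t => ?_, hζ⟩, hζ,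
    (selfConnForm_fundamental hu.1.1 hζ).1⟩
  obtain ⟨g, hg, hgA⟩ := hA t
  rw [← hgA]
  exact frameComp_mem_suBundle b hu hg

/-- Sections of the line subbundle correspond to functions with values in `L`. -/
theorem equivariantFunction_mem {u : FrameSpace F T V} (hu : u ∈ cartanBundle 𝒯 B L)
    {σ : (x : M) → T x} (hσ : ∀ x, σ x ∈ 𝒯.line x) : equivariantFunction V σ u ∈ L := by
  have h1 := hσ u.1
  rw [← hu.2.2] at h1
  obtain ⟨v, hv, hvu⟩ := h1
  have h2 : equivariantFunction V σ u = v := by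
    rw [equivariantFunction, ← hvu]
    exact frame_inverse_apply_self hu.1 v
  rwa [h2]

/-- If `ω(ξ) = 0`, then the covariant derivatives in the direction of `ξ` of sections of the line
subbundle have values in it, so `ξ` is vertical by nondegeneracy. For vertical vectors, `ω(ξ)`
determines the derivative of the frame. -/
theorem selfConnForm_injective {u : FrameSpace F T V} (hu : u ∈ cartanBundle 𝒯 B L)
    {ξ : TangentSpace (frameModel n F V) u}
    (hξ : ξ ∈ tangentTo (frameModel n F V) (cartanBundle 𝒯 B L) u)
    (h0 : selfConnForm V 𝒯.conn u ξ = 0) : ξ = 0 := by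
  have hproj : frameProj n u ξ = 0 := by
    by_contra hX
    obtain ⟨σ, hσ, hσl, hnd⟩ := 𝒯.nondegenerate u.1 _ hX
    apply hnd
    have hfs := (contMDiffAt_equivariantFunction (n := n) hu.1 hσ).mdifferentiableAt
      (by simp : (∞ : WithTop ℕ∞) ≠ 0)
    have h1 := mvfderiv_mem_of_tangentTo (I := frameModel n F V) L hfs
      (Eventually.of_forall fun q hq => equivariantFunction_mem hq hσl) hξ
    have h2 := inverse_conn (D := 𝒯.conn) (self_mem_sectionDomain u.1) hu.1 ξ hσ
    rw [h0, zero_apply, add_zero] at h2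
    rw [← h2] at h1
    rw [← frame_apply_inverse hu.1 (𝒯.conn σ u.1 (frameProj n u ξ)), ← hu.2.2]
    exact ⟨_, h1, rfl⟩
  refine frame_tangent_eq_zero hproj (ContinuousLinearMap.ext fun v => ?_)
  have hx := self_mem_coordDomain (F := F) (T := T) u.1
  obtain ⟨A, hA⟩ := exists_equiv_of_bijective ((frameCoord_bijective_iff hx).mpr hu.1)
  have h1 := connForm_apply (D := 𝒯.conn) u.1 u ξ v
  rw [show connForm V 𝒯.conn u.1 u ξ = 0 from h0, hproj, map_zero, ← hA,
    ContinuousLinearMap.inverse_equiv] at h1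
  have h2 := A.symm.map_eq_zero_iff.mp h1.symm
  simpa using h2

end InducedCartan

/-! ### The induced Cartan connection on the reduced bundle -/

section CartanConnection

variable {n : ℕ} {M : Type*} [TopologicalSpace M] [ChartedSpace (EuclideanSpace ℝ (Fin n)) M]
  {F : Type*} [NormedAddCommGroup F] [NormedSpace ℝ F]
  {T : M → Type*} [TopologicalSpace (TotalSpace F T)]
  [∀ x, AddCommGroup (T x)] [∀ x, Module ℝ (T x)] [∀ x, TopologicalSpace (T x)]
  [∀ x, IsTopologicalAddGroup (T x)] [∀ x, ContinuousSMul ℝ (T x)]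
  [FiberBundle F T] [VectorBundle ℝ F T]
  {V : Type*} [NormedAddCommGroup V] [NormedSpace ℂ V] [FiniteDimensional ℂ V]
  [ContMDiffVectorBundle ∞ F T (𝓡 n)]
  [FiniteDimensional ℝ F] [T2Space M] [IsManifold (𝓡 n) ∞ M]
  {r s : ℕ} {c : ConformalStructure n M r s} {𝒯 : StandardTractorBundle F T c}
  {B : V →ₗ⋆[ℂ] V →ₗ[ℂ] ℂ} {L : Submodule ℝ V} {J : OrthogonalComplexStructure 𝒯.metric}
  {m : ℕ} {ν₀ : ⋀[ℂ]^m V} {ν : (x : M) → ⋀[ℂ]^m (J.Fiber x)}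

/-- The kernel of a nonzero functional `Re B(v₀, ·)` is a hyperplane. -/
theorem finrank_orthogonal {r' s' : ℕ} (hB : HasHermitianSignature B r' s') {v₀ : V}
    (hv₀ : v₀ ≠ 0) :
    Module.finrank ℝ (LinearMap.ker (reForm B v₀)) + 1 = 2 * (r' + s') := by
  have h1 := (reForm B v₀).finrank_range_add_finrank_ker
  have h2 : Module.finrank ℝ V = 2 * (r' + s') := by
    rw [finrank_real_of_complex, hB.finrank]
  have h3 : Module.finrank ℝ (LinearMap.range (reForm B v₀)) = 1 := by
    have h4 : LinearMap.range (reForm B v₀) = ⊤ := by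
      refine LinearMap.range_eq_top.mpr (LinearMap.surjective fun h => hv₀ ?_)
      exact (reForm_nondegenerate hB).1 v₀ fun w => congrArg (fun f : V →ₗ[ℝ] ℝ => f w) h
    rw [h4, finrank_top, Module.finrank_self]
  omega

/-- Let `σ` be the null section spanning the line subbundle. The derivatives of `σ`, together with
`σ` itself, span the orthogonal complement of `σ`. -/
theorem exists_conn_eq {r' s' : ℕ} (hB : HasHermitianSignature B r' s') (hr : r + 1 = 2 * r')
    (hs : s + 1 = 2 * s') (hn : n = r + s) {u : FrameSpace F T V} (hu : u ∈ cartanBundle 𝒯 B L)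
    {σ : (x : M) → T x} (hσs : SmoothSection n F σ) (hσ0 : ∀ x, σ x ≠ 0)
    (hσσ : ∀ x, 𝒯.metric.form x (σ x) (σ x) = 0) {g : PseudoRiemannianMetric n M r s}
    (hg : ∀ (x : M) (ξ η : TangentSpace (𝓡 n) x),
      𝒯.metric.form x (𝒯.conn σ x ξ) (𝒯.conn σ x η) = g.form x ξ η) {w : V}
    (hw : (B (equivariantFunction V σ u) w).re = 0) :
    ∃ (X : TangentSpace (𝓡 n) u.1) (t : ℝ),
      (frameMap u).inverse (𝒯.conn σ u.1 X) + t • equivariantFunction V σ u = w := by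
  set v₀ := equivariantFunction V σ u
  have hv₀ : v₀ ≠ 0 := by
    intro h
    apply hσ0 u.1
    rw [← frame_apply_inverse hu.1 (σ u.1)]
    change frameMap u v₀ = 0
    rw [h, map_zero]
  -- `σ` is null, hence orthogonal to its derivatives
  have horth : ∀ X, 𝒯.metric.form u.1 (𝒯.conn σ u.1 X) (σ u.1) = 0 := by
    intro X
    have h1 := 𝒯.conn_metric σ σ hσs hσs u.1 X
    have h2 : (fun y => 𝒯.metric.form y (σ y) (σ y)) = fun _ => 0 := funext hσσ
    rw [h2, mfderiv_const] at h1
    have h3 : (0 : ℝ) = 𝒯.metric.form u.1 (𝒯.conn σ u.1 X) (σ u.1) +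
      𝒯.metric.form u.1 (σ u.1) (𝒯.conn σ u.1 X) := h1
    have h4 := 𝒯.metric.symm u.1 (σ u.1) (𝒯.conn σ u.1 X)
    linarith
  -- `Λ` is injective because `X ↦ ∇_X σ` is isometric for a metric of the conformal class; its
  -- image has dimension `n + 1`, like the orthogonal complement of `v₀`
  let Λ : TangentSpace (𝓡 n) u.1 × ℝ →ₗ[ℝ] V :=
    LinearMap.coprod ((frameMap u).inverse.toLinearMap.comp (𝒯.conn σ u.1).toLinearMap)
      (LinearMap.toSpanSingleton ℝ V v₀)
  have hΛ : ∀ X t, Λ (X, t) = (frameMap u).inverse (𝒯.conn σ u.1 X) + t • v₀ := fun X t => rfl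
  have hker : LinearMap.ker Λ = ⊥ := by
    rw [LinearMap.ker_eq_bot']
    rintro ⟨X, t⟩ h
    rw [hΛ] at h
    have h1 := congrArg (frameMap u) h
    rw [map_add, map_smul, map_zero, frame_apply_inverse hu.1] at h1
    have h2 : frameMap u v₀ = σ u.1 := frame_apply_inverse hu.1 _
    rw [h2] at h1
    have hX : X = 0 := by
      refine HasSignature.eq_zero (W := TangentSpace (𝓡 n) u.1)
        (b := ((ContinuousLinearMap.coeLM ℝ).comp (g.form u.1).toLinearMap))
        (g.signature u.1) fun Y => ?_
      change g.form u.1 X Y = 0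
      rw [← hg]
      have h3 : 𝒯.metric.form u.1 (𝒯.conn σ u.1 X + t • σ u.1) (𝒯.conn σ u.1 Y) = 0 := by
        rw [h1, map_zero, zero_apply]
      rw [map_add, map_smul, add_apply, smul_apply, 𝒯.metric.symm _ (σ u.1), horth, smul_zero,
        add_zero] at h3
      exact h3
    subst hX
    rw [map_zero, zero_add] at h1
    rw [(smul_eq_zero.mp h1).resolve_right (hσ0 u.1)]
    rfl
  have hle : LinearMap.range Λ ≤ LinearMap.ker (reForm B v₀) := by
    rintro _ ⟨⟨X, t⟩, rfl⟩
    have h1 := form_eq_re hu (σ u.1) (𝒯.conn σ u.1 X)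
    have h2 : 0 = (B v₀ v₀).re := (hσσ u.1).symm.trans (form_eq_re hu (σ u.1) (σ u.1))
    rw [𝒯.metric.symm, horth] at h1
    rw [LinearMap.mem_ker, hΛ, map_add, map_smul]
    change (B v₀ _).re + t * (B v₀ v₀).re = 0
    rw [← h2, mul_zero, add_zero]
    exact h1.symm
  have heq : LinearMap.range Λ = LinearMap.ker (reForm B v₀) := by
    refine Submodule.eq_of_le_of_finrank_eq hle ?_
    have : Module.Finite ℝ (TangentSpace (𝓡 n) u.1) :=
      inferInstanceAs (Module.Finite ℝ (EuclideanSpace ℝ (Fin n)))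
    have h1 := finrank_orthogonal hB hv₀
    rw [LinearMap.finrank_range_of_inj (LinearMap.ker_eq_bot.mp hker), Module.finrank_prod,
      Module.finrank_self]
    have h2 : Module.finrank ℝ (TangentSpace (𝓡 n) u.1) = n :=
      finrank_euclideanSpace_fin
    omega
  have hwm : w ∈ LinearMap.ker (reForm B v₀) := hw
  rw [← heq] at hwm
  obtain ⟨⟨X, t⟩, h⟩ := hwm
  exact ⟨X, t, h⟩

/-- Given `A ∈ 𝔰𝔲(V)`, a tangent vector `ξ` of the reduced bundle is chosen such that `A - ω(ξ)`
maps `L` to itself; the remaining difference is the value of `ω` on a fundamental vector. -/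
theorem selfConnForm_surjective (hJ : J.IsParallel 𝒯.conn) (hν : IsParallelTop J 𝒯.conn ν)
    {r' s' : ℕ} (hB : HasHermitianSignature B r' s') (hr : r + 1 = 2 * r') (hs : s + 1 = 2 * s')
    (hn : n = r + s) (b : Module.Basis (Fin m) ℂ V) (hν₀ : ν₀ ≠ 0)
    (hsec : HasLocalSections (n := n) (suBundle 𝒯 B L J ν₀ ν)) (hL : Module.finrank ℝ L = 1)
    {u : FrameSpace F T V} (hu : u ∈ suBundle 𝒯 B L J ν₀ ν) {A : V →L[ℝ] V} (hA : A ∈ su B) :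
    ∃ ξ ∈ tangentTo (frameModel n F V) (suBundle 𝒯 B L J ν₀ ν) u,
      selfConnForm V 𝒯.conn u ξ = A := by
  obtain ⟨σ, hσs, hσ, hσσ, g, hg⟩ := exists_null_section 𝒯
  have hσl : ∀ x, σ x ∈ 𝒯.line x := fun x => by
    rw [(hσ x).2]; exact Submodule.mem_span_singleton_self _
  set v₀ := equivariantFunction V σ u with hv₀
  have hv₀L : v₀ ∈ L := equivariantFunction_mem hu.1 hσl
  have hv₀0 : v₀ ≠ 0 := by
    intro h
    apply (hσ u.1).1
    rw [← frame_apply_inverse hu.1.1 (σ u.1)]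
    change frameMap u v₀ = 0
    rw [h, map_zero]
  have hLs : ∀ v ∈ L, ∃ a : ℝ, v = a • v₀ := by
    intro v hv
    obtain ⟨a, ha⟩ := exists_smul_eq_of_finrank_eq_one hL (x := ⟨v₀, hv₀L⟩)
      (fun h => hv₀0 (congrArg Subtype.val h)) ⟨v, hv⟩
    exact ⟨a, (congrArg Subtype.val ha).symm⟩
  have hAv : (B v₀ (A v₀)).re = 0 := by
    have h1 := congrArg Complex.re (hA.1 v₀ v₀)
    rw [Complex.add_re, hB.symm (A v₀), Complex.conj_re, Complex.zero_re] at h1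
    linarith
  obtain ⟨X, t, hX⟩ := exists_conn_eq hB hr hs hn hu.1 hσs (fun x => (hσ x).1) hσσ hg hAv
  obtain ⟨ξ, hξ, hξX⟩ := exists_lift b hν₀ hsec hu X
  have hfs := (contMDiffAt_equivariantFunction (n := n) hu.1.1 hσs).mdifferentiableAt
    (by simp : (∞ : WithTop ℕ∞) ≠ 0)
  have h1 := mvfderiv_mem_of_tangentTo (I := frameModel n F V) L hfs
    (Eventually.of_forall fun q (hq : q ∈ suBundle 𝒯 B L J ν₀ ν) =>
      equivariantFunction_mem hq.1 hσl) hξ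
  have h2 := inverse_conn (D := 𝒯.conn) (self_mem_sectionDomain u.1) hu.1.1 ξ hσs
  rw [hξX] at h2
  -- the difference of `A` and `ω(ξ)` belongs to the Lie algebra of the structure group
  have hmem : A - selfConnForm V 𝒯.conn u ξ ∈ suStabilizerAlgebra B L := by
    refine ⟨(su B).sub_mem hA
      (connForm_mem_su hJ hν b hν₀ hu (self_mem_sectionDomain _) hξ), fun v hv => ?_⟩
    obtain ⟨a, rfl⟩ := hLs v hv
    rw [map_smul]
    refine L.smul_mem a ?_
    have h3 : (A - selfConnForm V 𝒯.conn u ξ) v₀ =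
        mvfderiv (frameModel n F V) (equivariantFunction V σ) u ξ + t • v₀ := by
      rw [sub_apply, ← hX, h2, ← hv₀]
      change _ + connForm V 𝒯.conn u.1 u ξ v₀ + _ - connForm V 𝒯.conn u.1 u ξ v₀ = _
      abel
    rw [h3]
    exact L.add_mem h1 (L.smul_mem t hv₀L)
  obtain ⟨ζ, hζ, -, hζA⟩ := exists_fundamental b hu (mem_lieAlgebraOf hB hmem)
  refine ⟨ξ + ζ, Submodule.add_mem _ hξ hζ, ?_⟩
  rw [ContinuousLinearMap.map_add, hζA]
  abel

/-- A one-form on the reduced bundle which is given by the connection form is a Cartan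
connection. -/
theorem isCartanConnection_of_eq_selfConnForm (hJ : J.IsParallel 𝒯.conn)
    (hν : IsParallelTop J 𝒯.conn ν)
    {r' s' : ℕ} (hB : HasHermitianSignature B r' s') (hr : r + 1 = 2 * r') (hs : s + 1 = 2 * s')
    (hn : n = r + s) (b : Module.Basis (Fin m) ℂ V) (hν₀ : ν₀ ≠ 0)
    (hsec : HasLocalSections (n := n) (suBundle 𝒯 B L J ν₀ ν)) (hL : Module.finrank ℝ L = 1)
    {θ : OneFormOn (frameModel n F V) (suBundle 𝒯 B L J ν₀ ν) (su B)}
    (hθ : ∀ u ξ, (θ u ξ : V →L[ℝ] V) = selfConnForm V 𝒯.conn (u : FrameSpace F T V) ξ) :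
    IsCartanConnection (suStabilizer B L) θ where
  smooth u₀ hu₀ := ⟨frameDomain n F T V u₀.1, isOpen_frameDomain _, mem_frameDomain_self hu₀.1.1,
    connForm V 𝒯.conn u₀.1, fun _ hY =>
      contMDiffOn_connForm 𝒯.conn_smooth u₀.1 (isOpen_frameDomain _) subset_rfl hY,
    fun u hu ξ => (congrArg (fun A : TangentSpace (frameModel n F V) (u : FrameSpace F T V) →L[ℝ]
      (V →L[ℝ] V) => A ξ) (connForm_eq hu (mem_frameDomain_self u.2.1.1))).trans (hθ u ξ).symm⟩
  bijective u := by
    constructor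
    · rw [← LinearMap.ker_eq_bot, LinearMap.ker_eq_bot']
      intro ξ hξ
      have h1 := hθ u ξ
      rw [hξ] at h1
      exact Subtype.ext (selfConnForm_injective u.2.1
        (tangentTo_mono _ (suBundle_subset 𝒯 B L J ν₀ ν) u ξ.2) h1.symm)
    · intro A
      obtain ⟨ξ, hξ, h1⟩ := selfConnForm_surjective hJ hν hB hr hs hn b hν₀ hsec hL u.2 A.2
      exact ⟨⟨ξ, hξ⟩, Subtype.ext ((hθ u ⟨ξ, hξ⟩).trans h1)⟩
  equivariant g hg u ξ := by
    refine ⟨frameComp_mem_suBundle b u.2 hg, ⟨_, mfderiv_mem_tangentTo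
      (contMDiff_frameComp (g : V →L[ℝ] V))
      (fun q hq => frameComp_mem_suBundle b hq hg) ξ.2⟩, rfl, ?_⟩
    rw [hθ, hθ]
    exact selfConnForm_frameComp u.2.1.1 g _
  fundamental A hA u := by
    obtain ⟨ζ, hζ, h1, h2⟩ := exists_fundamental (𝒯 := 𝒯) b u.2 hA
    exact ⟨⟨ζ, hζ⟩, h1, (hθ u ⟨ζ, hζ⟩).trans h2⟩

/-- The restriction of a canonical Cartan connection to the reduced bundle. -/
theorem exists_restriction (hJ : J.IsParallel 𝒯.conn) (hν : IsParallelTop J 𝒯.conn ν)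
    {r' s' : ℕ} (hB : HasHermitianSignature B r' s') (hr : r + 1 = 2 * r') (hs : s + 1 = 2 * s')
    (hn : n = r + s) (b : Module.Basis (Fin m) ℂ V) (hν₀ : ν₀ ≠ 0)
    (hsec : HasLocalSections (n := n) (suBundle 𝒯 B L J ν₀ ν)) (hL : Module.finrank ℝ L = 1)
    {θ : OneFormOn (frameModel n F V) (cartanBundle 𝒯 B L) (so B)}
    (hθ : IsCanonicalCartanConnection 𝒯 B L θ) :
    ∃ θSU : OneFormOn (frameModel n F V) (suBundle 𝒯 B L J ν₀ ν) (su B),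
      (∀ u ξ, (θSU u ξ : V →L[ℝ] V) = θ ⟨u, suBundle_subset 𝒯 B L J ν₀ ν u.2⟩
        ⟨ξ, tangentTo_mono _ (suBundle_subset 𝒯 B L J ν₀ ν) u ξ.2⟩) ∧
      IsCartanConnection (suStabilizer B L) θSU := by
  let θSU : OneFormOn (frameModel n F V) (suBundle 𝒯 B L J ν₀ ν) (su B) := fun u =>
    LinearMap.codRestrict (su B)
      ((selfConnForm V 𝒯.conn (u : FrameSpace F T V) :
        TangentSpace (frameModel n F V) (u : FrameSpace F T V) →ₗ[ℝ] (V →L[ℝ] V)).comp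
        (tangentTo (frameModel n F V) (suBundle 𝒯 B L J ν₀ ν) (u : FrameSpace F T V)).subtype)
      fun ξ => connForm_mem_su hJ hν b hν₀ u.2 (self_mem_sectionDomain _) ξ.2
  exact ⟨θSU, fun u ξ => (hθ.apply_eq ⟨u, suBundle_subset 𝒯 B L J ν₀ ν u.2⟩
      (self_mem_sectionDomain _) ⟨ξ, tangentTo_mono _ (suBundle_subset 𝒯 B L J ν₀ ν) u ξ.2⟩).symm,
    isCartanConnection_of_eq_selfConnForm hJ hν hB hr hs hn b hν₀ hsec hL fun u ξ => rfl⟩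

end CartanConnection

end TractorSU

end

theorem proposition2p2 {n p q : ℕ} (hn : 3 ≤ n) (hpq : n = (2 * p + 1) + (2 * q + 1))
    {M : Type*} [TopologicalSpace M] [T2Space M]
    [ChartedSpace (EuclideanSpace ℝ (Fin n)) M] [IsManifold (𝓡 n) ∞ M]
    (c : TractorSU.ConformalStructure n M (2 * p + 1) (2 * q + 1))
    {F : Type*} [NormedAddCommGroup F] [NormedSpace ℝ F] [FiniteDimensional ℝ F]
    {T : M → Type*} [TopologicalSpace (TotalSpace F T)]
    [∀ x, AddCommGroup (T x)] [∀ x, Module ℝ (T x)] [∀ x, TopologicalSpace (T x)]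
    [∀ x, IsTopologicalAddGroup (T x)] [∀ x, ContinuousSMul ℝ (T x)]
    [FiberBundle F T] [VectorBundle ℝ F T] [ContMDiffVectorBundle ∞ F T (𝓡 n)]
    (𝒯 : TractorSU.StandardTractorBundle F T c)
    (J : TractorSU.OrthogonalComplexStructure 𝒯.metric) (hJ : J.IsParallel 𝒯.conn)
    (ν : (x : M) → ⋀[ℂ]^(p + q + 2) (J.Fiber x)) (hν : TractorSU.IsParallelTop J 𝒯.conn ν)
    (hν_ne : ∀ x, ν x ≠ 0)
    {V : Type*} [NormedAddCommGroup V] [NormedSpace ℂ V] [FiniteDimensional ℂ V]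
    (B : V →ₗ⋆[ℂ] V →ₗ[ℂ] ℂ)
    (hB : TractorSU.HasHermitianSignature B (p + 1) (q + 1))
    (L : Submodule ℝ V) (hL : Module.finrank ℝ L = 1)
    (hL_isotropic : ∀ v ∈ L, B v v = 0)
    (ν₀ : ⋀[ℂ]^(p + q + 2) V) (hν₀ : ν₀ ≠ 0)
    (hnorm : ∀ x : M, ∃ y ∈ connectedComponent x, ∃ a : ℂ,
      TractorSU.IsTopSqNorm (fun v w => B v w) ν₀ a ∧
      TractorSU.IsTopSqNorm (J.hermitian y) (ν y) a) :
    TractorSU.IsPrincipalFrameBundle n (TractorSU.suBundle 𝒯 B L J ν₀ ν)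
      (TractorSU.specialUnitary B ⊓ TractorSU.lineStabilizer L) ∧
    (∃! θ : TractorSU.OneFormOn (TractorSU.frameModel n F V)
        (TractorSU.cartanBundle 𝒯 B L) (TractorSU.so B),
      TractorSU.IsCanonicalCartanConnection 𝒯 B L θ) ∧
    ∀ θ : TractorSU.OneFormOn (TractorSU.frameModel n F V)
        (TractorSU.cartanBundle 𝒯 B L) (TractorSU.so B),
      TractorSU.IsCanonicalCartanConnection 𝒯 B L θ →
      ∃ θSU : TractorSU.OneFormOn (TractorSU.frameModel n F V)
          (TractorSU.suBundle 𝒯 B L J ν₀ ν) (TractorSU.su B),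
        (∀ u ξ, (θSU u ξ : V →L[ℝ] V) =
            θ ⟨u, TractorSU.suBundle_subset 𝒯 B L J ν₀ ν u.2⟩
              ⟨ξ, TractorSU.tangentTo_mono _ (TractorSU.suBundle_subset 𝒯 B L J ν₀ ν) u ξ.2⟩) ∧
        TractorSU.IsCartanConnection
          (TractorSU.specialUnitary B ⊓ TractorSU.lineStabilizer L) θSU := by
  obtain ⟨b⟩ : Nonempty (Module.Basis (Fin (p + q + 2)) ℂ V) :=
    ⟨Module.finBasisOfFinrankEq ℂ V (by rw [hB.finrank]; omega)⟩
  have hsec : TractorSU.HasLocalSections (n := n) (TractorSU.suBundle 𝒯 B L J ν₀ ν) := fun x₀ =>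
    TractorSU.exists_local_section hJ hν hB (by omega) (by omega) (by omega) b hL hL_isotropic hν₀
      hnorm x₀
  exact ⟨TractorSU.isPrincipalFrameBundle_suBundle hB b hν₀ hsec,
    TractorSU.existsUnique_canonicalCartanConnection 𝒯 B L, fun θ hθ =>
    TractorSU.exists_restriction hJ hν hB (by omega) (by omega) hpq b hν₀ hsec hL hθ⟩
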